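/- **Model.** Let $(Z_i,\tilde\zeta_i,\tilde\varepsilon_i,\zeta_i,\varepsilon_i)$, $i=0,1,2,\dots$, be i.i.d. random vectors with values in $\mathbb R^r\times\mathbb R^q\times\mathbb R^h\times\mathbb R^p\times\mathbb R^m$ such that, for each $i$, the five components are mutually independent, $Z_i$ has finite variance, $\tilde\zeta_i\sim N(0,\tilde\Psi)$ and $\tilde\varepsilon_i\sim N(0,\tilde\Omega)$ with $\tilde\Psi,\tilde\Omega$ positive definite, and $\zeta_i,\varepsilon_i$ have mean $0$ and finite covariance matrices $\Psi,\Omega$. Let $\varphi:\mathbb R^q\to\mathbb R^l$ be measurable and let $$\xi_i=\tilde\alpha+\tilde B\xi_i+\tilde\Gamma Z_i+\tilde\zeta_i,\qquad X_i=\tilde\nu+\tilde\Lambda\xi_i+\tilde KZ_i+\tilde\varepsilon_i,$$ $$\eta_i=\alpha+B\varphi(\xi_i)+\Gamma Z_i+\zeta_i,\qquad Y_i=\nu+\Lambda\eta_i+KZ_i+\varepsilon_i,$$ where $\tilde B$ has zero diagonal, $I-\tilde B$ is invertible and $\varphi(\xi_i)$ has finite variance. The matrix $K$ is arbitrary (in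 particular $K\neq0$ is allowed). Write $\theta_1=(\tilde\alpha,\tilde B,\tilde\Gamma,\tilde\nu,\tilde\Lambda,\tilde K,\tilde\Omega,\tilde\Psi)$, $\theta_2=(\alpha,B,\Gamma,\nu,\Lambda,K,\Omega,\Psi)$ for the true parameters, $\varphi^*_i=E[\varphi(\xi_i)\mid X_i,Z_i]$ and $V_i=(Z_i,\varphi_i^*,Y_i)$. **Two-stage estimator.** Let $\Theta_1\ni\theta_1$ be a set of first-stage parameters (with $\tilde B$ of zero diagonal, $I-\tilde B$ invertible, $\tilde\Psi,\tilde\Omega$ positive semidefinite, and $\Sigma_X(\theta)=\tilde\Lambda(I-\tilde B)^{-1}\tilde\Psi(I-\tilde B)^{-t}\tilde\Lambda^t+\tilde\Omega$ positive definite). Let $\hat\theta_{1}=\hat\theta_{1,n}$ maximize over $\Theta_1$ the normal likelihood of $X_0,\dots,X_{n-1}$ given $Z_0,\dots,Z_{n-1}$, and let $\varphi^*_{n,i}=E_{\hat\theta_1}[\varphi(\xi_i)\mid X_i,Z_i]$, the mean of $\varphi$ under the normal conditional distribution of $\xi_i$ given $(X_i,Z_i)$ in the first-stage model with parameter $\hat\theta_1$.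 Let $\Theta_2\ni\theta_2$ be a set of second-stage parameters (with $\Psi,\Omega$ positive semidefinite) in which $\Psi$ is unrestricted; it is enough that $\Psi$ may be replaced by any $\Psi'$ with $\Psi'-\Psi$ positive semidefinite. The second stage fits, by normal maximum likelihood to $(Z_i,\varphi^*_{n,i},Y_i)$, $i<n$, the linear model $\eta_i=\alpha_2+B_2\varphi_i+\Gamma_2Z_i+\zeta_i$, $Y_i=\nu_2+\Lambda_2\eta_i+K_2Z_i+\varepsilon_i$ with covariates $(Z_i,\varphi_i)$ of unstructured mean $(\mu_Z,\mu_\varphi)$ and covariance $(\Sigma_Z,\Sigma_{z,\varphi},\Sigma_\varphi)$, that is, with modelled mean $$\mu_V=\bigl(\mu_Z,\ \mu_\varphi,\ \nu_2+\Lambda_2\alpha_2+\Lambda_2B_2\mu_\varphi+(\Lambda_2\Gamma_2+K_2)\mu_Z\bigr)$$ and modelled covariance matrix $\Sigma_V$ with the blocks $\Sigma_Z$, $\Sigma_{z,\varphi}$, $\Sigma_\varphi$ and $$\Sigma_{z,y}=[\Sigma_{z,\varphi}B_2^t+\Sigma_Z\Gamma_2^t]\Lambda_2^t+\Sigma_ZK_2^t,\qquad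 \Sigma_{\varphi,y}=[\Sigma_\varphi B_2^t+\Sigma_{\varphi,z}\Gamma_2^t]\Lambda_2^t+\Sigma_{\varphi,z}K_2^t,$$ $$\Sigma_y=\Lambda_2\Sigma_\eta\Lambda_2^t+\Lambda_2\Gamma_2\Sigma_ZK_2^t+K_2\Sigma_Z\Gamma_2^t\Lambda_2^t+\Lambda_2B_2\Sigma_{\varphi,z}K_2^t+K_2\Sigma_{z,\varphi}B_2^t\Lambda_2^t+K_2\Sigma_ZK_2^t+\Omega_2,$$ $$\Sigma_\eta=B_2\Sigma_\varphi B_2^t+B_2\Sigma_{\varphi,z}\Gamma_2^t+\Gamma_2\Sigma_{z,\varphi}B_2^t+\Gamma_2\Sigma_Z\Gamma_2^t+\Psi_2 ,$$ over all parameters with $(\alpha_2,B_2,\Gamma_2,\nu_2,\Lambda_2,K_2,\Omega_2,\Psi_2)\in\Theta_2$ and $\Sigma_V$ positive definite. The estimators are any random sequences that, almost surely, are such maximizers for all large $n$. **Identification and regularity.** Let $\tau^*$ be the second-stage parameter value with $B_2=B$, $\Lambda_2=\Lambda$, $\Gamma_2=\Gamma$, $K_2=K$, $\Omega_2=\Omega$,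 $\alpha_2=\alpha$, $\nu_2=\nu$, $\mu_Z=E Z_i$, $\mu_\varphi=E\varphi(\xi_i)$, $\Sigma_Z=\mathrm{Var}\,Z_i$, $\Sigma_{z,\varphi}=\mathrm{Cov}[Z_i,\varphi_i^*]$, $\Sigma_\varphi=\mathrm{Var}\,\varphi_i^*$ and $$\Psi_2=\Psi+B\,\mathrm{Var}[\varphi(\xi_i)-\varphi_i^*]\,B^t .$$ Call a parameter $\theta_0$ identified in $\Theta$ by a map $f$ if for every neighbourhood $U$ of $\theta_0$ there is a neighbourhood $W$ of $f(\theta_0)$ such that $\theta\in\Theta$, $f(\theta)\in W$ imply $\theta\in U$. Assume: (i) $\theta_1$ is identified in $\Theta_1$ by the intercept, slope and residual covariance of the modelled regression of $X$ on $Z$; (ii) $\tau^*$ is identified by $(\mu_V,\Sigma_V)$ in the parameter set of the second-stage model; (iii) $\mathrm{Var}(V_i)$ is positive definite; (iv) for some neighbourhood $U$ of $\theta_1$ there is an integrable $G$ with $\sup_{\theta\in U\cap\Theta_1}\lVert E_{\theta}[\varphi(\xi_0)\mid X_0,Z_0]\rVert^2\le G$ almost surely. **Theorem.** The modelled mean and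 covariance at $\tau^*$ are the true ones: $\mu_V(\tau^*)=E(V_i)$ and $\Sigma_V(\tau^*)=\mathrm{Var}(V_i)$ for every $i$. The two-stage estimator is strongly consistent for all parameters except $\Psi$: almost surely, as $n\to\infty$, $\hat\theta_1\to\theta_1$, and $\hat\alpha_2\to\alpha$, $\hat B_2\to B$, $\hat\Gamma_2\to\Gamma$, $\hat\nu_2\to\nu$, $\hat\Lambda_2\to\Lambda$, $\hat K_2\to K$, $\hat\Omega_2\to\Omega$, while $\hat\Psi_2\to\Psi+B\,\mathrm{Var}[\varphi(\xi_i)-\varphi^*_i]\,B^t$. -/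

import Mathlib

open MeasureTheory ProbabilityTheory Filter Topology Matrix

noncomputable section

/-! ### Parameters -/

/-- Parameters of the linear structural equation model for the latent predictor,
`ξ = α + B ξ + Γ Z + ζ₁`, `X = ν + Λ ξ + K Z + ε₁`, `Var ζ₁ = Ψ`, `Var ε₁ = Ω`
(`q` latent predictors, `r` covariates, `h` indicators). -/
@[ext]
structure StageOneParam (q r h : ℕ) where
  α : Fin q → ℝ
  B : Matrix (Fin q) (Fin q) ℝ
  Γ : Matrix (Fin q) (Fin r) ℝ
  ν : Fin h → ℝ
  Λ : Matrix (Fin h) (Fin q) ℝ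
  K : Matrix (Fin h) (Fin r) ℝ
  Ω : Matrix (Fin h) (Fin h) ℝ
  Ψ : Matrix (Fin q) (Fin q) ℝ

/-- Parameters of the model for the latent response,
`η = α + B φ(ξ) + Γ Z + ζ₂`, `Y = ν + Λ η + K Z + ε₂`, `Var ζ₂ = Ψ`, `Var ε₂ = Ω`
(`p` latent responses, `l` coordinates of `φ`, `r` covariates, `m` indicators). -/
@[ext]
structure StageTwoParam (p l r m : ℕ) where
  α : Fin p → ℝ
  B : Matrix (Fin p) (Fin l) ℝ
  Γ : Matrix (Fin p) (Fin r) ℝ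
  ν : Fin m → ℝ
  Λ : Matrix (Fin m) (Fin p) ℝ
  K : Matrix (Fin m) (Fin r) ℝ
  Ω : Matrix (Fin m) (Fin m) ℝ
  Ψ : Matrix (Fin p) (Fin p) ℝ

/-- All parameters of the linear model fitted in the second stage: those of the measurement and
structural equations, and the unstructured means and (co)variances of the second-stage
covariates `Z` and `φ*`. -/
@[ext]
structure StageTwoFit (p l r m : ℕ) where
  θ : StageTwoParam p l r m
  μZ : Fin r → ℝ
  μφ : Fin l → ℝ
  VZ : Matrix (Fin r) (Fin r) ℝ
  VZφ : Matrix (Fin r) (Fin l) ℝ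
  Vφ : Matrix (Fin l) (Fin l) ℝ

/-- Convergence of parameters is convergence of every component. -/
instance {q r h : ℕ} : TopologicalSpace (StageOneParam q r h) :=
  .induced (fun θ => (θ.α, θ.B, θ.Γ, θ.ν, θ.Λ, θ.K, θ.Ω, θ.Ψ)) inferInstance

instance {p l r m : ℕ} : TopologicalSpace (StageTwoParam p l r m) :=
  .induced (fun θ => (θ.α, θ.B, θ.Γ, θ.ν, θ.Λ, θ.K, θ.Ω, θ.Ψ)) inferInstance

instance {p l r m : ℕ} : TopologicalSpace (StageTwoFit p l r m) :=
  .induced (fun τ => (τ.θ, τ.μZ, τ.μφ, τ.VZ, τ.VZφ, τ.Vφ)) inferInstance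

/-- The parameter `θ₀` is identified in the parameter set `Θ` from the moments `f`: parameters in
`Θ` whose moments are close to those of `θ₀` are close to `θ₀`. It implies that no other
parameter in `Θ` has the same moments as `θ₀`, and is implied by this if `Θ` is compact and
`f` continuous. -/
def IdentifiedAt {T M : Type*} [TopologicalSpace T] [TopologicalSpace M]
    (f : T → M) (Θ : Set T) (θ₀ : T) : Prop :=
  ∀ U ∈ 𝓝 θ₀, ∃ W ∈ 𝓝 (f θ₀), ∀ θ ∈ Θ, f θ ∈ W → θ ∈ U

/-! ### Gaussian log-likelihood -/

/-- Logarithm of the density at `x` of the normal distribution with mean `μ` and positive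
definite covariance matrix `S`. -/
def gaussianLogDensity {ι : Type*} [Fintype ι] [DecidableEq ι]
    (μ : ι → ℝ) (S : Matrix ι ι ℝ) (x : ι → ℝ) : ℝ :=
  -(1 / 2) * (Fintype.card ι * Real.log (2 * Real.pi) + Real.log S.det
    + (x - μ) ⬝ᵥ (S⁻¹ *ᵥ (x - μ)))

/-! ### First stage -/

namespace StageOneParam

variable {q r h l : ℕ}

/-- Covariance of `ξ` given `Z`. -/
def latentCov (θ : StageOneParam q r h) : Matrix (Fin q) (Fin q) ℝ :=
  (1 - θ.B)⁻¹ * θ.Ψ * ((1 - θ.B)⁻¹)ᵀ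

/-- Mean of `ξ` given `Z = z`. -/
def latentMean (θ : StageOneParam q r h) (z : Fin r → ℝ) : Fin q → ℝ :=
  (1 - θ.B)⁻¹ *ᵥ (θ.α + θ.Γ *ᵥ z)

/-- Intercept of the regression of `X` on `Z`. -/
def intercept (θ : StageOneParam q r h) : Fin h → ℝ :=
  θ.ν + θ.Λ *ᵥ ((1 - θ.B)⁻¹ *ᵥ θ.α)

/-- Slope of the regression of `X` on `Z`. -/
def slope (θ : StageOneParam q r h) : Matrix (Fin h) (Fin r) ℝ :=
  θ.Λ * (1 - θ.B)⁻¹ * θ.Γ + θ.K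

/-- Covariance of `X` given `Z`. -/
def cov (θ : StageOneParam q r h) : Matrix (Fin h) (Fin h) ℝ :=
  θ.Λ * θ.latentCov * θ.Λᵀ + θ.Ω

/-- Mean of `X` given `Z = z`. -/
def condMean (θ : StageOneParam q r h) (z : Fin r → ℝ) : Fin h → ℝ :=
  θ.intercept + θ.slope *ᵥ z

/-- The parameters of the conditional distribution `N (intercept + slope Z, cov)` of `X`
given `Z`. -/
def reducedForm (θ : StageOneParam q r h) :
    (Fin h → ℝ) × Matrix (Fin h) (Fin r) ℝ × Matrix (Fin h) (Fin h) ℝ :=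
  (θ.intercept, θ.slope, θ.cov)

/-- The requirements on a parameter value of the first-stage model. -/
structure Admissible (θ : StageOneParam q r h) : Prop where
  diag_B : ∀ j, θ.B j j = 0
  isUnit : IsUnit (1 - θ.B)
  posSemidef_Ψ : θ.Ψ.PosSemidef
  posSemidef_Ω : θ.Ω.PosSemidef
  posDef_cov : θ.cov.PosDef

/-- Conditional mean of `ξ` given `X = x` and `Z = z` under `θ`. -/
def posteriorMean (θ : StageOneParam q r h) (x : Fin h → ℝ) (z : Fin r → ℝ) : Fin q → ℝ :=
  θ.latentMean z + (θ.latentCov * θ.Λᵀ * θ.cov⁻¹) *ᵥ (x - θ.condMean z)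

/-- Conditional covariance of `ξ` given `X` and `Z` under `θ`. -/
def posteriorCov (θ : StageOneParam q r h) : Matrix (Fin q) (Fin q) ℝ :=
  θ.latentCov - θ.latentCov * θ.Λᵀ * θ.cov⁻¹ * θ.Λ * θ.latentCov

/-- The prediction `E_θ[φ(ξ) | X = x, Z = z]`: under `θ`, the conditional distribution of `ξ`
is normal with mean `posteriorMean` and covariance `posteriorCov`. -/
def predict (φ : (Fin q → ℝ) → Fin l → ℝ) (θ : StageOneParam q r h)
    (x : Fin h → ℝ) (z : Fin r → ℝ) : Fin l → ℝ := fun j =>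
  ∫ u, φ (WithLp.ofLp u) j ∂multivariateGaussian (WithLp.toLp 2 (θ.posteriorMean x z)) θ.posteriorCov

/-- Log-likelihood of `X₀, …, X₍ₙ₋₁₎` given `Z₀, …, Z₍ₙ₋₁₎`. -/
def logLik (n : ℕ) (x : ℕ → Fin h → ℝ) (z : ℕ → Fin r → ℝ) (θ : StageOneParam q r h) : ℝ :=
  ∑ i ∈ Finset.range n, gaussianLogDensity (θ.condMean (z i)) θ.cov (x i)

/-- `θ` is a maximum likelihood estimate in the parameter set `Θ`. -/
def IsMLE (Θ : Set (StageOneParam q r h)) (n : ℕ) (x : ℕ → Fin h → ℝ) (z : ℕ → Fin r → ℝ)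
    (θ : StageOneParam q r h) : Prop :=
  θ ∈ Θ ∧ ∀ θ' ∈ Θ, logLik n x z θ' ≤ logLik n x z θ

end StageOneParam

/-! ### Second stage -/

/-- The second-stage data `(Z, φ*, Y)` of one subject. -/
def stackData {r l m : ℕ} (z : Fin r → ℝ) (f : Fin l → ℝ) (y : Fin m → ℝ) :
    (Fin r ⊕ Fin l) ⊕ Fin m → ℝ :=
  Sum.elim (Sum.elim z f) y

namespace StageTwoFit

variable {p l r m : ℕ}

/-- Modelled mean of `(Z, φ*, Y)`. -/
def mean (τ : StageTwoFit p l r m) : (Fin r ⊕ Fin l) ⊕ Fin m → ℝ :=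
  stackData τ.μZ τ.μφ
    (τ.θ.ν + τ.θ.Λ *ᵥ τ.θ.α + (τ.θ.Λ * τ.θ.B) *ᵥ τ.μφ + (τ.θ.Λ * τ.θ.Γ + τ.θ.K) *ᵥ τ.μZ)

/-- Modelled variance of `η`. -/
def covη (τ : StageTwoFit p l r m) : Matrix (Fin p) (Fin p) ℝ :=
  τ.θ.B * τ.Vφ * τ.θ.Bᵀ + τ.θ.B * τ.VZφᵀ * τ.θ.Γᵀ + τ.θ.Γ * τ.VZφ * τ.θ.Bᵀ
    + τ.θ.Γ * τ.VZ * τ.θ.Γᵀ + τ.θ.Ψ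

/-- Modelled covariance of `Z` and `Y`. -/
def covZY (τ : StageTwoFit p l r m) : Matrix (Fin r) (Fin m) ℝ :=
  (τ.VZφ * τ.θ.Bᵀ + τ.VZ * τ.θ.Γᵀ) * τ.θ.Λᵀ + τ.VZ * τ.θ.Kᵀ

/-- Modelled covariance of `φ*` and `Y`. -/
def covφY (τ : StageTwoFit p l r m) : Matrix (Fin l) (Fin m) ℝ :=
  (τ.Vφ * τ.θ.Bᵀ + τ.VZφᵀ * τ.θ.Γᵀ) * τ.θ.Λᵀ + τ.VZφᵀ * τ.θ.Kᵀ

/-- Modelled variance of `Y`. -/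
def covY (τ : StageTwoFit p l r m) : Matrix (Fin m) (Fin m) ℝ :=
  τ.θ.Λ * τ.covη * τ.θ.Λᵀ + τ.θ.Λ * τ.θ.Γ * τ.VZ * τ.θ.Kᵀ + τ.θ.K * τ.VZ * τ.θ.Γᵀ * τ.θ.Λᵀ
    + τ.θ.Λ * τ.θ.B * τ.VZφᵀ * τ.θ.Kᵀ + τ.θ.K * τ.VZφ * τ.θ.Bᵀ * τ.θ.Λᵀ
    + τ.θ.K * τ.VZ * τ.θ.Kᵀ + τ.θ.Ω

/-- Modelled covariance matrix of `(Z, φ*, Y)`. -/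
def cov (τ : StageTwoFit p l r m) :
    Matrix ((Fin r ⊕ Fin l) ⊕ Fin m) ((Fin r ⊕ Fin l) ⊕ Fin m) ℝ :=
  fromBlocks (fromBlocks τ.VZ τ.VZφ τ.VZφᵀ τ.Vφ) (fromRows τ.covZY τ.covφY)
    (fromCols τ.covZYᵀ τ.covφYᵀ) τ.covY

/-- Modelled mean and covariance. -/
def moments (τ : StageTwoFit p l r m) :
    ((Fin r ⊕ Fin l) ⊕ Fin m → ℝ) ×
      Matrix ((Fin r ⊕ Fin l) ⊕ Fin m) ((Fin r ⊕ Fin l) ⊕ Fin m) ℝ :=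
  (τ.mean, τ.cov)

/-- Parameter set of the fitted linear model: `θ` in `Θ`, the moments of the covariates
unstructured, the modelled covariance matrix nonsingular. -/
def paramSet (Θ : Set (StageTwoParam p l r m)) : Set (StageTwoFit p l r m) :=
  {τ | τ.θ ∈ Θ ∧ τ.cov.PosDef}

/-- Normal log-likelihood of the second-stage data `v₀, …, v₍ₙ₋₁₎`. -/
def logLik (n : ℕ) (v : ℕ → (Fin r ⊕ Fin l) ⊕ Fin m → ℝ) (τ : StageTwoFit p l r m) : ℝ :=
  ∑ i ∈ Finset.range n, gaussianLogDensity τ.mean τ.cov (v i)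

/-- `τ` is a (pseudo) maximum likelihood estimate in the linear model. -/
def IsMLE (Θ : Set (StageTwoParam p l r m)) (n : ℕ) (v : ℕ → (Fin r ⊕ Fin l) ⊕ Fin m → ℝ)
    (τ : StageTwoFit p l r m) : Prop :=
  τ ∈ paramSet Θ ∧ ∀ τ' ∈ paramSet Θ, logLik n v τ' ≤ logLik n v τ

end StageTwoFit

/-! ### The non-linear structural equation model -/

variable {S : Type*} [MeasurableSpace S]

/-- Mean vector of a random vector. -/
def meanVec {ι : Type*} (P : Measure S) (U : S → ι → ℝ) : ι → ℝ :=
  fun a => ∫ ω, U ω a ∂P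

/-- Covariance matrix of two random vectors. -/
def covMat {ι κ : Type*} (P : Measure S) (U : S → ι → ℝ) (W : S → κ → ℝ) : Matrix ι κ ℝ :=
  Matrix.of fun a b => cov[fun ω => U ω a, fun ω => W ω b; P]

/-- `φ* = E[φ(ξ) | X, Z]`, for one subject. -/
def condPhi {q r h l : ℕ} (P : Measure S) (φ : (Fin q → ℝ) → Fin l → ℝ)
    (ξ : S → Fin q → ℝ) (X : S → Fin h → ℝ) (Z : S → Fin r → ℝ) : S → Fin l → ℝ :=
  fun ω j => (P[fun ω' => φ (ξ ω') j |
    MeasurableSpace.comap (fun ω' => (X ω', Z ω')) inferInstance]) ω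

/-- The non-linear structural equation model for i.i.d. subjects `i = 0, 1, 2, …` with true
parameters `θ₁`, `θ₂`. -/
structure IsNonlinearSEM {p q r l h m : ℕ} (P : Measure S) (φ : (Fin q → ℝ) → Fin l → ℝ)
    (θ₁ : StageOneParam q r h) (θ₂ : StageTwoParam p l r m)
    (Z : ℕ → S → Fin r → ℝ) (ξ : ℕ → S → Fin q → ℝ) (X : ℕ → S → Fin h → ℝ)
    (η : ℕ → S → Fin p → ℝ) (Y : ℕ → S → Fin m → ℝ)
    (ζ₁ : ℕ → S → Fin q → ℝ) (ε₁ : ℕ → S → Fin h → ℝ)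
    (ζ₂ : ℕ → S → Fin p → ℝ) (ε₂ : ℕ → S → Fin m → ℝ) : Prop where
  /-- the structural and measurement equations -/
  eq_ξ : ∀ i ω, ξ i ω = θ₁.α + θ₁.B *ᵥ ξ i ω + θ₁.Γ *ᵥ Z i ω + ζ₁ i ω
  eq_X : ∀ i ω, X i ω = θ₁.ν + θ₁.Λ *ᵥ ξ i ω + θ₁.K *ᵥ Z i ω + ε₁ i ω
  eq_η : ∀ i ω, η i ω = θ₂.α + θ₂.B *ᵥ φ (ξ i ω) + θ₂.Γ *ᵥ Z i ω + ζ₂ i ω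
  eq_Y : ∀ i ω, Y i ω = θ₂.ν + θ₂.Λ *ᵥ η i ω + θ₂.K *ᵥ Z i ω + ε₂ i ω
  measurable_φ : Measurable φ
  measurable_Z : ∀ i, Measurable (Z i)
  measurable_ζ₁ : ∀ i, Measurable (ζ₁ i)
  measurable_ε₁ : ∀ i, Measurable (ε₁ i)
  measurable_ζ₂ : ∀ i, Measurable (ζ₂ i)
  measurable_ε₂ : ∀ i, Measurable (ε₂ i)
  /-- subjects are independent and identically distributed -/
  iIndep : iIndepFun (fun i ω => (Z i ω, ζ₁ i ω, ε₁ i ω, ζ₂ i ω, ε₂ i ω)) P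
  identDistrib : ∀ i, IdentDistrib (fun ω => (Z i ω, ζ₁ i ω, ε₁ i ω, ζ₂ i ω, ε₂ i ω))
    (fun ω => (Z 0 ω, ζ₁ 0 ω, ε₁ 0 ω, ζ₂ 0 ω, ε₂ 0 ω)) P P
  /-- for each subject, `Z`, `ζ₁`, `ε₁`, `ζ₂`, `ε₂` are mutually independent -/
  indep_Z : ∀ i, IndepFun (Z i) (fun ω => (ζ₁ i ω, ε₁ i ω, ζ₂ i ω, ε₂ i ω)) P
  indep_ζ₁ : ∀ i, IndepFun (ζ₁ i) (fun ω => (ε₁ i ω, ζ₂ i ω, ε₂ i ω)) P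
  indep_ε₁ : ∀ i, IndepFun (ε₁ i) (fun ω => (ζ₂ i ω, ε₂ i ω)) P
  indep_ζ₂ : ∀ i, IndepFun (ζ₂ i) (ε₂ i) P
  /-- the residuals of the first-stage model are normal, those of the second-stage model have
  mean zero and finite variance -/
  law_ζ₁ : ∀ i, P.map (fun ω => WithLp.toLp 2 (ζ₁ i ω)) = multivariateGaussian 0 θ₁.Ψ
  law_ε₁ : ∀ i, P.map (fun ω => WithLp.toLp 2 (ε₁ i ω)) = multivariateGaussian 0 θ₁.Ω
  memLp_ζ₂ : ∀ i, MemLp (ζ₂ i) 2 P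
  memLp_ε₂ : ∀ i, MemLp (ε₂ i) 2 P
  mean_ζ₂ : ∀ i, meanVec P (ζ₂ i) = 0
  mean_ε₂ : ∀ i, meanVec P (ε₂ i) = 0
  cov_ζ₂ : ∀ i, covMat P (ζ₂ i) (ζ₂ i) = θ₂.Ψ
  cov_ε₂ : ∀ i, covMat P (ε₂ i) (ε₂ i) = θ₂.Ω
  /-- finite variances of the covariates and of `φ(ξ)` -/
  memLp_Z : ∀ i, MemLp (Z i) 2 P
  memLp_φ : ∀ i, MemLp (fun ω => φ (ξ i ω)) 2 P

/-- The parameter value of the second-stage linear model with the true means and (co)variances of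
the covariates `(Z, φ*)` and the true parameters `θ₂`, except that `Ψ` is replaced by
`Ψ + B Var[φ(ξ) - φ*] Bᵗ`. -/
def stageTwoLimit {p q r l h m : ℕ} (P : Measure S) (φ : (Fin q → ℝ) → Fin l → ℝ)
    (θ₂ : StageTwoParam p l r m) (ξ : S → Fin q → ℝ) (X : S → Fin h → ℝ) (Z : S → Fin r → ℝ) :
    StageTwoFit p l r m where
  θ := { θ₂ with
    Ψ := θ₂.Ψ + θ₂.B * covMat P (fun ω => φ (ξ ω) - condPhi P φ ξ X Z ω)
      (fun ω => φ (ξ ω) - condPhi P φ ξ X Z ω) * θ₂.Bᵀ }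
  μZ := meanVec P Z
  μφ := meanVec P (fun ω => φ (ξ ω))
  VZ := covMat P Z Z
  VZφ := covMat P Z (condPhi P φ ξ X Z)
  Vφ := covMat P (condPhi P φ ξ X Z) (condPhi P φ ξ X Z)

end

section LinearAlgebra

variable {ι κ : Type*} [Fintype ι] [Fintype κ]

lemma tendsto_matrix_nhds {m n T : Type*} {f : Filter T} {M : T → Matrix m n ℝ}
    {A : Matrix m n ℝ} :
    Tendsto M f (𝓝 A) ↔ ∀ i j, Tendsto (fun t => M t i j) f (𝓝 (A i j)) :=
  tendsto_pi_nhds.trans (forall_congr' fun _ => tendsto_pi_nhds)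

lemma Matrix.PosSemidef.abs_entry_le_trace {Q : Matrix ι ι ℝ} (hQ : Q.PosSemidef) (i j : ι) :
    |Q i j| ≤ Q.trace := by
  classical
  have hdiag : ∀ k, Q k k ≤ Q.trace := fun k =>
    Finset.single_le_sum (f := fun k => Q k k) (fun k _ => hQ.diag_nonneg) (Finset.mem_univ k)
  have hsymm : Q j i = Q i j := by simpa using congrFun (congrFun hQ.isHermitian i) j
  have hpm : ∀ s : ℝ, 0 ≤ Q i i + s * Q i j + s * Q j i + s * s * Q j j := by
    intro s
    have h := hQ.dotProduct_mulVec_nonneg (Pi.single i 1 + s • Pi.single j 1)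
    simp only [star_trivial, mulVec_add, mulVec_smul, mulVec_single_one, add_dotProduct,
      dotProduct_add, smul_dotProduct, dotProduct_smul, single_one_dotProduct, smul_eq_mul,
      col_apply] at h
    linarith
  have h1 := hpm 1
  have h2 := hpm (-1)
  have := hdiag i
  have := hdiag j
  rw [abs_le]
  constructor <;> linarith

lemma Matrix.PosSemidef.abs_trace_mul_le {Q : Matrix ι ι ℝ} (hQ : Q.PosSemidef)
    (E : Matrix ι ι ℝ) : |(Q * E).trace| ≤ Q.trace * ∑ i, ∑ j, |E i j| := by
  calc |(Q * E).trace| = |∑ i, ∑ j, Q i j * E j i| := by simp [trace, mul_apply]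
    _ ≤ ∑ i, ∑ j, |Q i j * E j i| :=
      (Finset.abs_sum_le_sum_abs _ _).trans
        (Finset.sum_le_sum fun i _ => Finset.abs_sum_le_sum_abs _ _)
    _ ≤ ∑ i, ∑ j, Q.trace * |E j i| := by
      gcongr with i _ j _
      rw [abs_mul]
      gcongr
      exact hQ.abs_entry_le_trace i j
    _ = Q.trace * ∑ i, ∑ j, |E i j| := by
      rw [Finset.sum_comm]; simp [Finset.mul_sum]

lemma posSemidef_vecMulVec_self (x : ι → ℝ) : (vecMulVec x x).PosSemidef := by
  simpa using posSemidef_vecMulVec_self_star x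

lemma trace_vecMulVec_self_mul (x : ι → ℝ) (A : Matrix ι ι ℝ) :
    (vecMulVec x x * A).trace = x ⬝ᵥ A *ᵥ x := by
  rw [vecMulVec_mul, trace_vecMulVec, dotProduct_mulVec, dotProduct_comm]

variable [DecidableEq ι]

open scoped MatrixOrder ComplexOrder in
lemma Matrix.PosDef.exists_isUnit_transpose_mul_self {A : Matrix ι ι ℝ} (hA : A.PosDef) :
    ∃ R : Matrix ι ι ℝ, IsUnit R ∧ A = Rᵀ * R := by
  obtain ⟨R, hR⟩ := CStarAlgebra.nonneg_iff_eq_star_mul_self.mp hA.posSemidef.nonneg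
  have hR' : A = Rᵀ * R := by rw [hR, star_eq_conjTranspose, conjTranspose_eq_transpose_of_trivial]
  refine ⟨R, ?_, hR'⟩
  have h := hA.isUnit
  rw [isUnit_iff_isUnit_det, hR', det_mul] at h
  rw [isUnit_iff_isUnit_det]
  exact isUnit_of_mul_isUnit_right h

/-- The trace is controlled by the pairing with a positive definite matrix. -/
lemma Matrix.PosDef.exists_trace_le_mul_trace {A : Matrix ι ι ℝ} (hA : A.PosDef) :
    ∃ c : ℝ, 0 < c ∧ ∀ Q : Matrix ι ι ℝ, Q.PosSemidef → Q.trace ≤ c * (Q * A).trace := by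
  obtain ⟨R, hR, rfl⟩ := hA.exists_isUnit_transpose_mul_self
  have hRu := (isUnit_iff_isUnit_det _).1 hR
  refine ⟨1 + ∑ i, ∑ j, |(R⁻¹ᵀ * R⁻¹) i j|, by positivity, fun Q hQ => ?_⟩
  have hK : (R * Q * Rᵀ).PosSemidef := by
    simpa [conjTranspose_eq_transpose_of_trivial] using hQ.mul_mul_conjTranspose_same R
  have h1 : (R * Q * Rᵀ).trace = (Q * (Rᵀ * R)).trace := by
    rw [trace_mul_comm, ← Matrix.mul_assoc, trace_mul_comm]
  have h2 : ((R * Q * Rᵀ) * (R⁻¹ᵀ * R⁻¹)).trace = Q.trace := by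
    have : (R * Q * Rᵀ) * (R⁻¹ᵀ * R⁻¹) = R * (Q * (Rᵀ * R⁻¹ᵀ) * R⁻¹) := by
      simp only [Matrix.mul_assoc]
    rw [this, ← transpose_mul, nonsing_inv_mul _ hRu, transpose_one, Matrix.mul_one,
      trace_mul_comm, Matrix.mul_assoc, nonsing_inv_mul _ hRu, Matrix.mul_one]
  have h3 := (le_abs_self _).trans (hK.abs_trace_mul_le (R⁻¹ᵀ * R⁻¹))
  rw [h2, h1] at h3
  have h4 : 0 ≤ (Q * (Rᵀ * R)).trace := h1 ▸ hK.trace_nonneg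
  nlinarith

/-- A small perturbation is negligible against a positive definite matrix, uniformly over
positive semidefinite weights. -/
lemma Matrix.PosDef.eventually_abs_trace_mul_le {A : Matrix ι ι ℝ} (hA : A.PosDef)
    {T : Type*} {f : Filter T} {E : T → Matrix ι ι ℝ} (hE : Tendsto E f (𝓝 0)) {ε : ℝ}
    (hε : 0 < ε) :
    ∀ᶠ t in f, ∀ Q : Matrix ι ι ℝ, Q.PosSemidef → |(Q * E t).trace| ≤ ε * (Q * A).trace := by
  obtain ⟨c, hc, hcA⟩ := hA.exists_trace_le_mul_trace
  have hsum : Tendsto (fun t => ∑ i, ∑ j, |E t i j|) f (𝓝 0) := by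
    have : Continuous fun M : Matrix ι ι ℝ => ∑ i, ∑ j, |M i j| := by fun_prop
    simpa [Function.comp_def] using (this.tendsto 0).comp hE
  filter_upwards [hsum.eventually (gt_mem_nhds (show 0 < ε / c by positivity))] with t ht Q hQ
  calc |(Q * E t).trace| ≤ Q.trace * ∑ i, ∑ j, |E t i j| := hQ.abs_trace_mul_le _
    _ ≤ Q.trace * (ε / c) := by gcongr; exact hQ.trace_nonneg
    _ ≤ (c * (Q * A).trace) * (ε / c) := by gcongr; exact hcA Q hQ
    _ = ε * (Q * A).trace := by field_simp

lemma Matrix.PosDef.eventually_posDef {A : Matrix ι ι ℝ} (hA : A.PosDef)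
    {T : Type*} {f : Filter T} {M : T → Matrix ι ι ℝ} (hM : Tendsto M f (𝓝 A))
    (hsymm : ∀ᶠ t in f, (M t).IsHermitian) : ∀ᶠ t in f, (M t).PosDef := by
  have hE : Tendsto (fun t => M t - A) f (𝓝 0) := by simpa using hM.sub_const A
  filter_upwards [hsymm, hA.eventually_abs_trace_mul_le hE one_half_pos] with t ht hQ
  refine .of_dotProduct_mulVec_pos ht fun x hx => ?_
  have h1 := hA.dotProduct_mulVec_pos hx
  have h2 := hQ _ (posSemidef_vecMulVec_self x)
  rw [trace_vecMulVec_self_mul, trace_vecMulVec_self_mul, sub_mulVec, dotProduct_sub] at h2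
  have h3 := (abs_le.1 h2).1
  simp only [star_trivial] at *
  linarith

lemma Real.two_mul_log_le_self {x : ℝ} (hx : 0 < x) : 2 * Real.log x ≤ x := by
  have h1 := Real.log_le_sub_one_of_pos (show 0 < x / 2 by positivity)
  have h2 := Real.log_le_sub_one_of_pos (show (0 : ℝ) < 2 by norm_num)
  rw [Real.log_div hx.ne' two_ne_zero] at h1
  linarith

lemma Real.sq_sqrt_sub_one_le {x : ℝ} (hx : 0 < x) :
    (√x - 1) ^ 2 ≤ x - 1 - Real.log x := by
  have h := Real.log_le_sub_one_of_pos (Real.sqrt_pos.2 hx)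
  rw [Real.log_sqrt hx.le] at h
  have := Real.sq_sqrt hx.le
  nlinarith

lemma Real.abs_sub_one_le_of_sub_log_le {x s : ℝ} (hx : 0 < x) (hs : 0 ≤ s)
    (h : x - 1 - Real.log x ≤ s ^ 2) : |x - 1| ≤ s * (2 + s) := by
  have h1 := abs_le_of_sq_le_sq' ((Real.sq_sqrt_sub_one_le hx).trans h) hs
  have h2 := Real.sq_sqrt hx.le
  have h3 := Real.sqrt_nonneg x
  rw [abs_le]
  constructor <;> nlinarith

/-- Stein's loss of a positive definite matrix `K` relative to the identity. -/
lemma Matrix.PosDef.trace_sub_log_det {K : Matrix ι ι ℝ} (hK : K.PosDef) :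
    K.trace - Real.log K.det - Fintype.card ι =
      ∑ i, (hK.isHermitian.eigenvalues i - 1 - Real.log (hK.isHermitian.eigenvalues i)) := by
  have h1 := hK.isHermitian.trace_eq_sum_eigenvalues
  have h2 := hK.isHermitian.det_eq_prod_eigenvalues
  simp only [RCLike.ofReal_real_eq_id, id_eq] at h1 h2
  rw [h1, h2, Real.log_prod fun i _ => (hK.eigenvalues_pos i).ne']
  simp [Finset.sum_sub_distrib]
  ring

lemma Matrix.PosDef.trace_sub_log_det_nonneg {K : Matrix ι ι ℝ} (hK : K.PosDef) :
    0 ≤ K.trace - Real.log K.det - Fintype.card ι := by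
  rw [hK.trace_sub_log_det]
  exact Finset.sum_nonneg fun i _ =>
    (sq_nonneg _).trans (Real.sq_sqrt_sub_one_le (hK.eigenvalues_pos i))

lemma Matrix.PosDef.trace_le_two_mul {K : Matrix ι ι ℝ} (hK : K.PosDef) :
    K.trace ≤ 2 * (K.trace - Real.log K.det - Fintype.card ι) + 2 * Fintype.card ι := by
  have h2 := hK.isHermitian.det_eq_prod_eigenvalues
  have h1 := hK.isHermitian.trace_eq_sum_eigenvalues
  simp only [RCLike.ofReal_real_eq_id, id_eq] at h1 h2
  have : 2 * Real.log K.det ≤ K.trace := by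
    rw [h1, h2, Real.log_prod fun i _ => (hK.eigenvalues_pos i).ne', Finset.mul_sum]
    exact Finset.sum_le_sum fun i _ => Real.two_mul_log_le_self (hK.eigenvalues_pos i)
  linarith

lemma Matrix.PosDef.abs_sub_one_apply_le {K : Matrix ι ι ℝ} (hK : K.PosDef) (i j : ι) :
    |(K - 1) i j| ≤ Fintype.card ι * (√(K.trace - Real.log K.det - Fintype.card ι) *
      (2 + √(K.trace - Real.log K.det - Fintype.card ι))) := by
  set s := √(K.trace - Real.log K.det - Fintype.card ι) with hs
  have hev : ∀ k, |hK.isHermitian.eigenvalues k - 1| ≤ s * (2 + s) := by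
    intro k
    refine Real.abs_sub_one_le_of_sub_log_le (hK.eigenvalues_pos k) (Real.sqrt_nonneg _) ?_
    rw [hs, Real.sq_sqrt hK.trace_sub_log_det_nonneg, hK.trace_sub_log_det]
    exact Finset.single_le_sum (f := fun i =>
      hK.isHermitian.eigenvalues i - 1 - Real.log (hK.isHermitian.eigenvalues i))
      (fun i _ => (sq_nonneg _).trans (Real.sq_sqrt_sub_one_le (hK.eigenvalues_pos i)))
      (Finset.mem_univ k)
  set U : Matrix ι ι ℝ := hK.isHermitian.eigenvectorUnitary.1 with hU
  have hUmem : U ∈ unitaryGroup ι ℝ := hK.isHermitian.eigenvectorUnitary.2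
  have hspec : K - 1 = U * diagonal (fun k => hK.isHermitian.eigenvalues k - 1) * star U := by
    have h := hK.isHermitian.spectral_theorem
    rw [Unitary.conjStarAlgAut_apply] at h
    have h1 : U * star U = 1 := Unitary.mul_star_self_of_mem hUmem
    have h2 : diagonal (fun k => hK.isHermitian.eigenvalues k - 1) =
        diagonal (RCLike.ofReal ∘ hK.isHermitian.eigenvalues) - (1 : Matrix ι ι ℝ) := by
      rw [← diagonal_one, diagonal_sub]; rfl
    rw [h2, Matrix.mul_sub, Matrix.sub_mul, Matrix.mul_one, h1]
    exact congrArg (· - 1) h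
  rw [hspec, Matrix.mul_apply]
  calc |∑ k, (U * diagonal fun k => hK.isHermitian.eigenvalues k - 1) i k * (star U) k j|
      ≤ ∑ k, |(U * diagonal fun k => hK.isHermitian.eigenvalues k - 1) i k * (star U) k j| :=
        Finset.abs_sum_le_sum_abs _ _
    _ ≤ ∑ _k : ι, s * (2 + s) := by
        refine Finset.sum_le_sum fun k _ => ?_
        rw [mul_diagonal, star_apply, star_trivial, abs_mul, abs_mul]
        have h1 := entry_norm_bound_of_unitary hUmem i k
        have h2 := entry_norm_bound_of_unitary hUmem j k
        rw [Real.norm_eq_abs] at h1 h2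
        calc _ ≤ 1 * (s * (2 + s)) * 1 := by gcongr; exact hev k
          _ = _ := by ring
    _ = _ := by simp

lemma tendsto_one_of_trace_sub_log_det {T : Type*} {f : Filter T} {K : T → Matrix ι ι ℝ}
    (hK : ∀ᶠ t in f, (K t).PosDef)
    (h : Tendsto (fun t => (K t).trace - Real.log (K t).det - Fintype.card ι) f (𝓝 0)) :
    Tendsto K f (𝓝 1) := by
  refine tendsto_matrix_nhds.2 fun i j => ?_
  have hb : Tendsto (fun t => Fintype.card ι *
      (√((K t).trace - Real.log (K t).det - Fintype.card ι) *
      (2 + √((K t).trace - Real.log (K t).det - Fintype.card ι)))) f (𝓝 0) := by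
    have hc : Continuous fun x : ℝ => Fintype.card ι * (√x * (2 + √x)) := by fun_prop
    simpa [Function.comp_def] using (hc.tendsto 0).comp h
  have : Tendsto (fun t => (K t - 1) i j) f (𝓝 0) := by
    refine squeeze_zero_norm' ?_ hb
    filter_upwards [hK] with t ht using ht.abs_sub_one_apply_le i j
  simpa using this.add_const ((1 : Matrix ι ι ℝ) i j)

lemma continuousAt_inv_of_isUnit {A : Matrix ι ι ℝ} (hA : IsUnit A) :
    ContinuousAt (fun M : Matrix ι ι ℝ => M⁻¹) A := by
  refine continuousAt_matrix_inv A ?_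
  rw [Ring.inverse_eq_inv']
  exact continuousAt_inv₀ ((isUnit_iff_isUnit_det _).1 hA).ne_zero

lemma tendsto_zero_of_trace_transpose_mul_mul {T : Type*} {f : Filter T}
    {Q : T → Matrix ι ι ℝ} {Q₀ : Matrix ι ι ℝ} (hQ₀ : Q₀.PosDef) (hQ : Tendsto Q f (𝓝 Q₀))
    {D : T → Matrix ι κ ℝ} (h : Tendsto (fun t => ((D t)ᵀ * Q t * D t).trace) f (𝓝 0)) :
    Tendsto D f (𝓝 0) := by
  obtain ⟨c, hc, hcQ⟩ := hQ₀.exists_trace_le_mul_trace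
  have hE : Tendsto (fun t => Q t - Q₀) f (𝓝 0) := by simpa using hQ.sub_const Q₀
  have hlim : Tendsto (fun t => √(2 * c * ((D t)ᵀ * Q t * D t).trace)) f (𝓝 0) := by
    have hc : Continuous fun x : ℝ => √(2 * c * x) := by fun_prop
    simpa [Function.comp_def] using (hc.tendsto 0).comp h
  refine tendsto_matrix_nhds.2 fun i j => squeeze_zero_norm' ?_ hlim
  filter_upwards [hQ₀.eventually_abs_trace_mul_le hE one_half_pos] with t ht
  have hDD : (D t * (D t)ᵀ).PosSemidef := by
    simpa [conjTranspose_eq_transpose_of_trivial] using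
      posSemidef_conjTranspose_mul_self (R := ℝ) (D t)ᵀ
  have h1 := (abs_le.1 (ht _ hDD)).1
  have h2 := hcQ _ hDD
  have h3 : (D t * (D t)ᵀ * Q t).trace = ((D t)ᵀ * Q t * D t).trace := by
    rw [trace_mul_cycle, trace_mul_cycle, trace_mul_cycle]
  rw [Matrix.mul_sub, trace_sub, h3] at h1
  have h4 : (D t i j) ^ 2 ≤ (D t * (D t)ᵀ).trace := by
    calc (D t i j) ^ 2 ≤ ∑ j, (D t i j) ^ 2 :=
          Finset.single_le_sum (f := fun j => (D t i j) ^ 2) (fun _ _ => sq_nonneg _)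
            (Finset.mem_univ j)
      _ = (D t * (D t)ᵀ) i i := by simp [mul_apply, pow_two]
      _ ≤ _ := Finset.single_le_sum (f := fun k => (D t * (D t)ᵀ) k k)
            (fun k _ => hDD.diag_nonneg) (Finset.mem_univ i)
  rw [Real.norm_eq_abs]
  refine Real.abs_le_sqrt (h4.trans (h2.trans ?_))
  nlinarith

/-- Values of `(A, D)` at which the Gaussian discrepancy of a regression is nearly as small as at
the truth `(A₀, 0)` converge to the truth. No compactness is needed. -/
theorem tendsto_of_gaussian_discrepancy_le [DecidableEq κ] {T : Type*} {f : Filter T}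
    {A₀ : Matrix ι ι ℝ} (hA₀ : A₀.PosDef) {W₀ : Matrix κ κ ℝ} (hW₀ : W₀.PosDef)
    {S : T → Matrix ι ι ℝ} {C : T → Matrix ι κ ℝ} {W : T → Matrix κ κ ℝ}
    (hS : Tendsto S f (𝓝 A₀)) (hC : Tendsto C f (𝓝 0)) (hW : Tendsto W f (𝓝 W₀))
    {A : T → Matrix ι ι ℝ} {D : T → Matrix ι κ ℝ} (hA : ∀ᶠ t in f, (A t).PosDef)
    {b : T → ℝ} (hb : Tendsto b f (𝓝 (Real.log A₀.det + Fintype.card ι)))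
    (h : ∀ᶠ t in f, Real.log (A t).det + ((A t)⁻¹ *
      (S t - C t * (D t)ᵀ - D t * (C t)ᵀ + D t * W t * (D t)ᵀ)).trace ≤ b t) :
    Tendsto A f (𝓝 A₀) ∧ Tendsto D f (𝓝 0) := by
  obtain ⟨c, hc, hcW⟩ := hW₀.exists_trace_le_mul_trace
  obtain ⟨R, hR, hRA⟩ := hA₀.exists_isUnit_transpose_mul_self
  have hRu := (isUnit_iff_isUnit_det _).1 hR
  have hRt : IsUnit Rᵀ.det := by rwa [det_transpose]
  have hWE : Tendsto (fun t => W t - W₀) f (𝓝 0) := by simpa using hW.sub_const W₀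
  have hE : Tendsto (fun t => (S t - A₀) - (4 * c) • (C t * (C t)ᵀ)) f (𝓝 0) := by
    have hCt : Tendsto (fun t => (C t)ᵀ) f (𝓝 0) := by
      simpa [Function.comp_def] using
        ((continuous_id.matrix_transpose (A := fun M : Matrix ι κ ℝ => M)).tendsto 0).comp hC
    have h1 : Tendsto (fun t => C t * (C t)ᵀ) f (𝓝 0) := by
      have hm : Continuous fun p : Matrix ι κ ℝ × Matrix κ ι ℝ => p.1 * p.2 :=
        continuous_fst.matrix_mul continuous_snd
      simpa [Function.comp_def] using (hm.tendsto (0, 0)).comp (hC.prodMk_nhds hCt)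
    simpa using (hS.sub_const A₀).sub (h1.const_smul (4 * c))
  set K : T → Matrix ι ι ℝ := fun t => R * (A t)⁻¹ * Rᵀ with hKdef
  set loss : T → ℝ := fun t => (K t).trace - Real.log (K t).det - Fintype.card ι with hloss
  set p : T → ℝ := fun t => ((D t)ᵀ * (A t)⁻¹ * D t).trace with hp
  have hKpos : ∀ᶠ t in f, (K t).PosDef := by
    filter_upwards [hA] with t ht
    have hinj : Function.Injective (Rᵀ).mulVec :=
      mulVec_injective_of_isUnit ((isUnit_iff_isUnit_det _).2 hRt)
    simpa [conjTranspose_eq_transpose_of_trivial] using ht.inv.conjTranspose_mul_mul_same hinj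
  have hppos : ∀ᶠ t in f, 0 ≤ p t := by
    filter_upwards [hA] with t ht
    have := ht.inv.posSemidef.conjTranspose_mul_mul_same (D t)
    rw [conjTranspose_eq_transpose_of_trivial] at this
    exact this.trace_nonneg
  have hdetA₀ : A₀.det = R.det * R.det := by rw [hRA, det_mul, det_transpose]
  have hKtr : ∀ t, (K t).trace = ((A t)⁻¹ * A₀).trace := fun t => by
    rw [hKdef, hRA]; dsimp only
    rw [trace_mul_comm, ← Matrix.mul_assoc, trace_mul_comm]
  have hKdet : ∀ᶠ t in f, Real.log (K t).det = Real.log A₀.det - Real.log (A t).det := by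
    filter_upwards [hA] with t ht
    rw [← Real.log_div hA₀.det_pos.ne' ht.det_pos.ne', hKdef, hdetA₀]
    dsimp only
    rw [det_mul, det_mul, det_transpose, det_nonsing_inv, Ring.inverse_eq_inv']
    congr 1
    field_simp
  have hmain : ∀ ε, 0 < ε → ε ≤ 1 / 4 → ∀ᶠ t in f, 1 / 2 * loss t + p t / (4 * c) ≤
      (b t - (Real.log A₀.det + Fintype.card ι)) + 2 * Fintype.card ι * ε := by
    intro ε hε hε4
    filter_upwards [hA, hKpos, hKdet, h, hppos, hA₀.eventually_abs_trace_mul_le hE hε,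
      hW₀.eventually_abs_trace_mul_le hWE one_half_pos] with t hAt hKt hdet hbt hpt hEt hWt
    have hQ := hAt.inv.posSemidef
    set Q := (A t)⁻¹ with hQdef
    have hP : ((D t)ᵀ * Q * D t).PosSemidef := by
      simpa [conjTranspose_eq_transpose_of_trivial] using hQ.conjTranspose_mul_mul_same (D t)
    have hN := (hQ.conjTranspose_mul_mul_same ((4 * c) • C t - D t)).trace_nonneg
    have e1 := (abs_le.1 (hEt Q hQ)).1
    have e2 := (abs_le.1 (hWt _ hP)).1
    have e3 := hcW _ hP
    have t1 : (Q * (D t * W t * (D t)ᵀ)).trace = ((D t)ᵀ * Q * D t * W t).trace := by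
      rw [← Matrix.mul_assoc, trace_mul_comm]; simp only [Matrix.mul_assoc]
    have t2 : ((C t)ᵀ * Q * D t).trace = (Q * (D t * (C t)ᵀ)).trace := by
      rw [Matrix.mul_assoc, trace_mul_comm, Matrix.mul_assoc]
    have t3 : ((D t)ᵀ * Q * C t).trace = (Q * (C t * (D t)ᵀ)).trace := by
      rw [Matrix.mul_assoc, trace_mul_comm, Matrix.mul_assoc]
    have t4 : ((C t)ᵀ * Q * C t).trace = (Q * (C t * (C t)ᵀ)).trace := by
      rw [Matrix.mul_assoc, trace_mul_comm, Matrix.mul_assoc]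
    have hN' : 0 ≤ (4 * c) * ((4 * c) * (Q * (C t * (C t)ᵀ)).trace)
        - (4 * c) * (Q * (D t * (C t)ᵀ)).trace - (4 * c) * (Q * (C t * (D t)ᵀ)).trace + p t := by
      rw [← t2, ← t3, ← t4]
      simp only [conjTranspose_eq_transpose_of_trivial, transpose_sub, transpose_smul,
        Matrix.sub_mul, Matrix.mul_sub, Matrix.smul_mul, Matrix.mul_smul, trace_sub, trace_smul,
        smul_eq_mul] at hN
      simp only [hp]
      linarith
    have hcross : (Q * (D t * (C t)ᵀ)).trace + (Q * (C t * (D t)ᵀ)).trace ≤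
        (4 * c) * (Q * (C t * (C t)ᵀ)).trace + p t / (4 * c) := by
      have : p t / (4 * c) * (4 * c) = p t := by field_simp
      nlinarith
    have hk2 := hKt.trace_le_two_mul
    have hKt' := hKtr t
    have hp2 : p t / (2 * c) ≤ ((D t)ᵀ * Q * D t * W t).trace := by
      rw [Matrix.mul_sub, trace_sub] at e2
      rw [div_le_iff₀ (by positivity)]
      simp only [hp]
      nlinarith
    have hp3 : p t / (2 * c) = p t / (4 * c) + p t / (4 * c) := by field_simp; ring
    simp only [Matrix.mul_sub, Matrix.mul_add, Matrix.mul_smul, trace_sub, trace_add, trace_smul,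
      smul_eq_mul, t1] at hbt e1
    have hl0 := hKt.trace_sub_log_det_nonneg
    have hl : loss t = (K t).trace - Real.log (K t).det - Fintype.card ι := rfl
    rw [← hl] at hk2 hl0
    rw [hdet] at hl
    nlinarith
  have hG : Tendsto (fun t => 1 / 2 * loss t + p t / (4 * c)) f (𝓝 0) := by
    have hb' : Tendsto (fun t => b t - (Real.log A₀.det + Fintype.card ι)) f (𝓝 0) := by
      simpa using hb.sub_const (Real.log A₀.det + Fintype.card ι)
    rw [Metric.tendsto_nhds]
    intro δ hδ
    set ε := min (1 / 4) (δ / (4 * (Fintype.card ι + 1))) with hε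
    have hε0 : 0 < ε := by positivity
    have hεδ : 2 * Fintype.card ι * ε ≤ δ / 2 := by
      have h1 : ε ≤ δ / (4 * (Fintype.card ι + 1)) := min_le_right _ _
      rw [le_div_iff₀ (by positivity)] at h1
      nlinarith
    filter_upwards [hmain ε hε0 (min_le_left _ _), hKpos, hppos,
      hb'.eventually (gt_mem_nhds (half_pos hδ))] with t h1 h2 h3 h4
    have hl0 : 0 ≤ loss t := h2.trace_sub_log_det_nonneg
    rw [Real.dist_eq, sub_zero, abs_of_nonneg (by positivity)]
    linarith
  have hloss0 : Tendsto loss f (𝓝 0) := by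
    have := hG.const_mul 2
    rw [mul_zero] at this
    refine squeeze_zero' (hKpos.mono fun t ht => ht.trace_sub_log_det_nonneg) ?_ this
    filter_upwards [hppos] with t ht
    have : 0 ≤ p t / (4 * c) := by positivity
    linarith
  have hp0 : Tendsto p f (𝓝 0) := by
    have := hG.const_mul (4 * c)
    rw [mul_zero] at this
    refine squeeze_zero' hppos ?_ this
    filter_upwards [hKpos] with t ht
    have hl0 : 0 ≤ loss t := ht.trace_sub_log_det_nonneg
    have : 4 * c * (p t / (4 * c)) = p t := by field_simp
    nlinarith [mul_nonneg hc.le hl0]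
  have hK1 := tendsto_one_of_trace_sub_log_det hKpos hloss0
  have hQ : Tendsto (fun t => (A t)⁻¹) f (𝓝 A₀⁻¹) := by
    have hcont : Continuous fun M : Matrix ι ι ℝ => R⁻¹ * M * Rᵀ⁻¹ := by fun_prop
    have h1 := (hcont.tendsto 1).comp hK1
    have e1 : R⁻¹ * 1 * Rᵀ⁻¹ = A₀⁻¹ := by rw [hRA, Matrix.mul_inv_rev, Matrix.mul_one]
    rw [e1] at h1
    refine h1.congr fun t => ?_
    simp only [Function.comp, hKdef]
    rw [Matrix.mul_assoc R, nonsing_inv_mul_cancel_left _ _ hRu,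
      mul_nonsing_inv_cancel_right _ _ hRt]
  refine ⟨?_, tendsto_zero_of_trace_transpose_mul_mul hA₀.inv hQ hp0⟩
  have hinv : ContinuousAt (fun M : Matrix ι ι ℝ => M⁻¹) A₀⁻¹ :=
    continuousAt_inv_of_isUnit hA₀.inv.isUnit
  have h1 := hinv.tendsto.comp hQ
  rw [nonsing_inv_nonsing_inv _ ((isUnit_iff_isUnit_det _).1 hA₀.isUnit)] at h1
  refine h1.congr' ?_
  filter_upwards [hA] with t ht
  exact nonsing_inv_nonsing_inv _ ((isUnit_iff_isUnit_det _).1 ht.isUnit)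

end LinearAlgebra

section GaussianRegression

/-- The average of the products `u i a * v i b` over `i < n`. -/
noncomputable def avgOuter {ι κ : Type*} (n : ℕ) (u : ℕ → ι → ℝ) (v : ℕ → κ → ℝ) :
    Matrix ι κ ℝ :=
  Matrix.of fun a b => (n : ℝ)⁻¹ * ∑ i ∈ Finset.range n, u i a * v i b

lemma avgOuter_eq_sum {ι κ : Type*} (n : ℕ) (u : ℕ → ι → ℝ) (v : ℕ → κ → ℝ) :
    avgOuter n u v = (n : ℝ)⁻¹ • ∑ i ∈ Finset.range n, vecMulVec (u i) (v i) := by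
  ext a b
  simp [avgOuter, Matrix.sum_apply, vecMulVec_apply]

lemma avgOuter_residual {ι κ : Type*} [Fintype κ] (n : ℕ) (e : ℕ → ι → ℝ) (w : ℕ → κ → ℝ)
    (D : Matrix ι κ ℝ) :
    avgOuter n (fun i => e i - D *ᵥ w i) (fun i => e i - D *ᵥ w i) =
      avgOuter n e e - avgOuter n e w * Dᵀ - D * (avgOuter n e w)ᵀ
        + D * avgOuter n w w * Dᵀ := by
  simp only [avgOuter_eq_sum, transpose_smul, transpose_sum, transpose_vecMulVec, Matrix.smul_mul,
    Matrix.mul_smul, Matrix.sum_mul, Matrix.mul_sum, ← smul_sub, ← smul_add,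
    ← Finset.sum_sub_distrib, ← Finset.sum_add_distrib]
  congr 1
  refine Finset.sum_congr rfl fun i _ => ?_
  rw [mul_vecMulVec, mul_vecMulVec, vecMulVec_mul, vecMulVec_mul, vecMul_transpose,
    sub_vecMulVec, vecMulVec_sub, vecMulVec_sub]
  abel

variable {ι κ : Type*} [Fintype ι] [DecidableEq ι] [Fintype κ] [DecidableEq κ]

lemma sum_gaussianLogDensity {n : ℕ} (hn : n ≠ 0) (u : ℕ → ι → ℝ) (A : Matrix ι ι ℝ) :
    ∑ i ∈ Finset.range n, gaussianLogDensity 0 A (u i) = -(n / 2 : ℝ) *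
      (Fintype.card ι * Real.log (2 * Real.pi) + Real.log A.det +
        (A⁻¹ * avgOuter n u u).trace) := by
  have hn' : (n : ℝ) ≠ 0 := by exact_mod_cast hn
  have h : (n : ℝ) * (A⁻¹ * avgOuter n u u).trace =
      ∑ i ∈ Finset.range n, u i ⬝ᵥ A⁻¹ *ᵥ u i := by
    rw [avgOuter_eq_sum, Matrix.mul_smul, trace_smul, Matrix.mul_sum, trace_sum, smul_eq_mul,
      mul_inv_cancel_left₀ hn']
    refine Finset.sum_congr rfl fun i _ => ?_
    rw [trace_mul_comm, trace_vecMulVec_self_mul]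
  simp only [gaussianLogDensity, sub_zero]
  rw [← Finset.mul_sum, Finset.sum_add_distrib, ← h]
  simp
  ring

lemma gaussianLogDensity_eq_zero_mean (μ x : ι → ℝ) (A : Matrix ι ι ℝ) :
    gaussianLogDensity μ A x = gaussianLogDensity 0 A (x - μ) := by
  simp [gaussianLogDensity]

/-- Consistency of Gaussian maximum likelihood in a regression model: `e n i` are the residuals at
the true parameter and `w i` the regressors, and `(D n, A n)` are the deviation of the regression
coefficients from the truth and the fitted residual covariance. -/
theorem tendsto_of_gaussian_logLik_le
    {A₀ : Matrix ι ι ℝ} (hA₀ : A₀.PosDef) {W₀ : Matrix κ κ ℝ} (hW₀ : W₀.PosDef)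
    {e : ℕ → ℕ → ι → ℝ} {w : ℕ → κ → ℝ}
    (hS : Tendsto (fun n => avgOuter n (e n) (e n)) atTop (𝓝 A₀))
    (hC : Tendsto (fun n => avgOuter n (e n) w) atTop (𝓝 0))
    (hW : Tendsto (fun n => avgOuter n w w) atTop (𝓝 W₀))
    {A : ℕ → Matrix ι ι ℝ} {D : ℕ → Matrix ι κ ℝ} (hA : ∀ᶠ n in atTop, (A n).PosDef)
    (h : ∀ᶠ n in atTop, ∑ i ∈ Finset.range n, gaussianLogDensity 0 A₀ (e n i) ≤
      ∑ i ∈ Finset.range n, gaussianLogDensity 0 (A n) (e n i - D n *ᵥ w i)) :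
    Tendsto A atTop (𝓝 A₀) ∧ Tendsto D atTop (𝓝 0) := by
  refine tendsto_of_gaussian_discrepancy_le hA₀ hW₀ hS hC hW hA
    (b := fun n => Real.log A₀.det + (A₀⁻¹ * avgOuter n (e n) (e n)).trace) ?_ ?_
  · have hc : Continuous fun M : Matrix ι ι ℝ => Real.log A₀.det + (A₀⁻¹ * M).trace := by fun_prop
    have := (hc.tendsto A₀).comp hS
    rwa [nonsing_inv_mul _ ((isUnit_iff_isUnit_det _).1 hA₀.isUnit), trace_one] at this
  · filter_upwards [h, eventually_ne_atTop 0] with n hn hn0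
    rw [sum_gaussianLogDensity hn0 (e n), sum_gaussianLogDensity hn0 (fun i => e n i - D n *ᵥ w i),
      avgOuter_residual] at hn
    have : (0 : ℝ) < n := by positivity
    nlinarith

end GaussianRegression

section GaussianDensity

variable {ι : Type*} [Fintype ι]

lemma pi_gaussianReal_eq_withDensity :
    Measure.pi (fun _ : ι => gaussianReal 0 1) =
      volume.withDensity fun x => ENNReal.ofReal (∏ i, gaussianPDFReal 0 1 (x i)) := by
  refine Measure.pi_eq fun s hs => ?_
  have hint : Integrable (fun x : ι → ℝ => ∏ i, (s i).indicator (gaussianPDFReal 0 1) (x i)) :=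
    Integrable.fintype_prod (μ := fun _ => volume) fun i =>
      (integrable_gaussianPDFReal 0 1).indicator (hs i)
  have hnn : ∀ i (x : ℝ), 0 ≤ (s i).indicator (gaussianPDFReal 0 1) x := fun i x =>
    Set.indicator_nonneg (fun _ _ => gaussianPDFReal_nonneg _ _ _) _
  rw [withDensity_apply _ (MeasurableSet.univ_pi hs),
    ← lintegral_indicator (MeasurableSet.univ_pi hs)]
  have h1 : ∀ x : ι → ℝ, (Set.univ.pi s).indicator
      (fun x => ENNReal.ofReal (∏ i, gaussianPDFReal 0 1 (x i))) x =
      ENNReal.ofReal (∏ i, (s i).indicator (gaussianPDFReal 0 1) (x i)) := by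
    intro x
    by_cases hx : x ∈ Set.univ.pi s
    · rw [Set.indicator_of_mem hx]
      congr 1
      exact Finset.prod_congr rfl fun i _ => (Set.indicator_of_mem (hx i trivial) _).symm
    · rw [Set.indicator_of_notMem hx]
      simp only [Set.mem_univ_pi, not_forall] at hx
      obtain ⟨i, hi⟩ := hx
      rw [Finset.prod_eq_zero (Finset.mem_univ i) (Set.indicator_of_notMem hi _)]
      simp
  simp only [h1]
  rw [← ofReal_integral_eq_lintegral_ofReal hint
    (Eventually.of_forall fun x => Finset.prod_nonneg fun i _ => hnn i _),
    integral_fintype_prod_volume_eq_prod, ENNReal.ofReal_prod_of_nonneg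
      fun i _ => integral_nonneg (hnn i)]
  refine Finset.prod_congr rfl fun i _ => ?_
  rw [integral_indicator (hs i), gaussianReal_apply_eq_integral _ one_ne_zero]

lemma integrable_exp_sub_mul_sum_sq (k : ℝ) {δ : ℝ} (hδ : 0 < δ) :
    Integrable fun u : ι → ℝ => Real.exp (k - δ * ∑ i, u i ^ 2) := by
  have h : Integrable fun u : ι → ℝ => ∏ i, Real.exp (-δ * u i ^ 2) :=
    Integrable.fintype_prod (μ := fun _ => volume) fun i => integrable_exp_neg_mul_sq hδ
  refine (h.const_mul (Real.exp k)).congr (Eventually.of_forall fun u => ?_)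
  dsimp only
  rw [← Real.exp_sum, ← Real.exp_add, ← Finset.mul_sum]
  congr 1
  ring

variable [DecidableEq ι]

lemma continuous_gaussianLogDensity (m : ι → ℝ) (C : Matrix ι ι ℝ) :
    Continuous (gaussianLogDensity m C) := by
  unfold gaussianLogDensity
  fun_prop

lemma measurable_ofReal_exp_gaussianLogDensity (m : ι → ℝ) (C : Matrix ι ι ℝ) :
    Measurable fun u => ENNReal.ofReal (Real.exp (gaussianLogDensity m C u)) :=
  (ENNReal.continuous_ofReal.comp
    (Real.continuous_exp.comp (continuous_gaussianLogDensity m C))).measurable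

open scoped MatrixOrder in
/-- The density of a nondegenerate multivariate normal distribution. -/
theorem map_ofLp_multivariateGaussian (m : ι → ℝ) {C : Matrix ι ι ℝ} (hC : C.PosDef) :
    (multivariateGaussian (WithLp.toLp 2 m) C).map WithLp.ofLp =
      volume.withDensity fun u => ENNReal.ofReal (Real.exp (gaussianLogDensity m C u)) := by
  set M := CFC.sqrt C with hM
  have hMM : M * M = C := CFC.sqrt_mul_sqrt_self C hC.posSemidef.nonneg
  have hMsymm : Mᵀ = M := by
    have : M.PosSemidef := nonneg_iff_posSemidef.1 (CFC.sqrt_nonneg C)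
    simpa [conjTranspose_eq_transpose_of_trivial] using this.isHermitian.eq
  have hdet : M.det ≠ 0 := by
    have := hC.det_pos.ne'
    rw [← hMM, det_mul] at this
    exact left_ne_zero_of_mul this
  set T : (ι → ℝ) → ι → ℝ := fun x => m + M *ᵥ x with hT
  have hTm : Measurable T := by
    have : Continuous T := by rw [hT]; fun_prop
    exact this.measurable
  have hpm := measurable_ofReal_exp_gaussianLogDensity m C
  have hlaw : (multivariateGaussian (WithLp.toLp 2 m) C).map WithLp.ofLp =
      (Measure.pi fun _ : ι => gaussianReal 0 1).map T := by
    rw [multivariateGaussian, ← map_pi_eq_stdGaussian, Measure.map_map (by fun_prop) (by fun_prop),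
      Measure.map_map (by fun_prop) (by fun_prop)]
    congr 1
  have hvol : (volume : Measure (ι → ℝ)).map T = ENNReal.ofReal |M.det⁻¹| • volume := by
    have h1 : T = (fun x => m + x) ∘ toLin' M := by ext; simp [hT]
    have h2 : Measurable (toLin' M) := (toLin' M).continuous_of_finiteDimensional.measurable
    rw [h1, ← Measure.map_map (by fun_prop) h2, Real.map_matrix_volume_pi_eq_smul_volume_pi hdet,
      Measure.map_smul, map_add_left_eq_self]
  have hdens : ∀ x, ENNReal.ofReal (∏ i, gaussianPDFReal 0 1 (x i)) =
      ENNReal.ofReal |M.det| * ENNReal.ofReal (Real.exp (gaussianLogDensity m C (T x))) := by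
    intro x
    rw [← ENNReal.ofReal_mul (abs_nonneg _)]
    congr 1
    have hquad : (T x - m) ⬝ᵥ (C⁻¹ *ᵥ (T x - m)) = ∑ i, x i ^ 2 := by
      have hMu : IsUnit M.det := hdet.isUnit
      rw [hT, add_sub_cancel_left, ← hMM, Matrix.mul_inv_rev, mulVec_mulVec, Matrix.mul_assoc,
        nonsing_inv_mul _ hMu, Matrix.mul_one, dotProduct_mulVec, vecMul_mulVec,
        hMsymm, mul_nonsing_inv _ hMu, vecMul_one]
      simp [dotProduct, pow_two]
    have hlog : Real.log C.det = 2 * Real.log |M.det| := by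
      rw [← hMM, det_mul, Real.log_mul hdet hdet, Real.log_abs]; ring
    have hprod : ∏ i, gaussianPDFReal 0 1 (x i) =
        Real.exp (-(1 / 2) * (Fintype.card ι * Real.log (2 * Real.pi) + ∑ i, x i ^ 2)) := by
      have h2pi : (0 : ℝ) < 2 * Real.pi := by positivity
      have : ∀ t : ℝ, gaussianPDFReal 0 1 t =
          Real.exp (-(1 / 2) * (Real.log (2 * Real.pi) + t ^ 2)) := by
        intro t
        rw [gaussianPDFReal, mul_add, Real.exp_add]
        congr 1
        · rw [NNReal.coe_one, mul_one, Real.sqrt_eq_rpow, ← Real.rpow_neg h2pi.le,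
            Real.rpow_def_of_pos h2pi]
          congr 1; ring
        · congr 1; simp; ring
      simp only [this]
      rw [← Real.exp_sum, ← Finset.mul_sum, Finset.sum_add_distrib]
      simp
    rw [hprod, gaussianLogDensity, hquad, hlog]
    nth_rw 1 [← Real.exp_log (abs_pos.2 hdet)]
    rw [← Real.exp_add]
    congr 1
    ring
  rw [hlaw, pi_gaussianReal_eq_withDensity]
  ext s hs
  rw [Measure.map_apply hTm hs, withDensity_apply _ (hTm hs), withDensity_apply _ hs]
  simp only [hdens]
  rw [lintegral_const_mul' _ _ ENNReal.ofReal_ne_top,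
    ← setLIntegral_map hs hpm hTm, hvol, Measure.restrict_smul, lintegral_smul_measure, smul_eq_mul,
    ← mul_assoc, ← ENNReal.ofReal_mul (abs_nonneg _), ← abs_mul, mul_inv_cancel₀ hdet]
  simp

lemma integral_multivariateGaussian_eq (m : ι → ℝ) {C : Matrix ι ι ℝ} (hC : C.PosDef)
    (f : (ι → ℝ) → ℝ) :
    ∫ u, f (WithLp.ofLp u) ∂multivariateGaussian (WithLp.toLp 2 m) C =
      ∫ u, Real.exp (gaussianLogDensity m C u) * f u := by
  have h1 : ∫ u, f (WithLp.ofLp u) ∂multivariateGaussian (WithLp.toLp 2 m) C =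
      ∫ u, f u ∂(multivariateGaussian (WithLp.toLp 2 m) C).map WithLp.ofLp :=
    (integral_map_equiv (MeasurableEquiv.toLp 2 (ι → ℝ)).symm f).symm
  rw [h1, map_ofLp_multivariateGaussian m hC, integral_withDensity_eq_integral_toReal_smul
    (measurable_ofReal_exp_gaussianLogDensity m C)
    (Eventually.of_forall fun _ => ENNReal.ofReal_lt_top)]
  simp [ENNReal.toReal_ofReal (Real.exp_nonneg _)]

lemma integrable_multivariateGaussian_iff (m : ι → ℝ) {C : Matrix ι ι ℝ} (hC : C.PosDef)
    (f : (ι → ℝ) → ℝ) :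
    Integrable (fun u => f (WithLp.ofLp u)) (multivariateGaussian (WithLp.toLp 2 m) C) ↔
      Integrable fun u => Real.exp (gaussianLogDensity m C u) * f u := by
  have h1 : Integrable (fun u => f (WithLp.ofLp u)) (multivariateGaussian (WithLp.toLp 2 m) C) ↔
      Integrable f ((multivariateGaussian (WithLp.toLp 2 m) C).map WithLp.ofLp) :=
    (integrable_map_equiv (MeasurableEquiv.toLp 2 (ι → ℝ)).symm f).symm
  rw [h1, map_ofLp_multivariateGaussian m hC, integrable_withDensity_iff_integrable_smul'
    (measurable_ofReal_exp_gaussianLogDensity m C)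
    (Eventually.of_forall fun _ => ENNReal.ofReal_lt_top)]
  simp [ENNReal.toReal_ofReal (Real.exp_nonneg _)]

lemma Filter.Tendsto.matrix_mulVec {m n T : Type*} [Fintype n] {l : Filter T}
    {A : T → Matrix m n ℝ} {A₀ : Matrix m n ℝ} {v : T → n → ℝ} {v₀ : n → ℝ}
    (hA : Tendsto A l (𝓝 A₀)) (hv : Tendsto v l (𝓝 v₀)) :
    Tendsto (fun t => A t *ᵥ v t) l (𝓝 (A₀ *ᵥ v₀)) := by
  have hc : Continuous fun p : Matrix m n ℝ × (n → ℝ) => p.1 *ᵥ p.2 := by fun_prop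
  exact (hc.tendsto (A₀, v₀)).comp (hA.prodMk_nhds hv)

lemma Filter.Tendsto.dotProduct {n T : Type*} [Fintype n] {l : Filter T}
    {u v : T → n → ℝ} {u₀ v₀ : n → ℝ} (hu : Tendsto u l (𝓝 u₀)) (hv : Tendsto v l (𝓝 v₀)) :
    Tendsto (fun t => u t ⬝ᵥ v t) l (𝓝 (u₀ ⬝ᵥ v₀)) := by
  have hc : Continuous fun p : (n → ℝ) × (n → ℝ) => p.1 ⬝ᵥ p.2 := by fun_prop
  exact (hc.tendsto (u₀, v₀)).comp (hu.prodMk_nhds hv)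

lemma tendsto_gaussianLogDensity {T : Type*} {l : Filter T} {m : T → ι → ℝ}
    {C : T → Matrix ι ι ℝ} {m₁ : ι → ℝ} {C₁ : Matrix ι ι ℝ} (hC₁ : C₁.PosDef)
    (hm : Tendsto m l (𝓝 m₁)) (hC : Tendsto C l (𝓝 C₁)) (u : ι → ℝ) :
    Tendsto (fun t => gaussianLogDensity (m t) (C t) u) l (𝓝 (gaussianLogDensity m₁ C₁ u)) := by
  have hinv : Tendsto (fun t => (C t)⁻¹) l (𝓝 C₁⁻¹) :=
    (continuousAt_inv_of_isUnit hC₁.isUnit).tendsto.comp hC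
  have hdet : Tendsto (fun t => Real.log (C t).det) l (𝓝 (Real.log C₁.det)) :=
    ((continuous_id.matrix_det.tendsto C₁).comp hC).log hC₁.det_pos.ne'
  have hsub : Tendsto (fun t => u - m t) l (𝓝 (u - m₁)) := hm.const_sub u
  exact ((hdet.const_add _).add (hsub.dotProduct (hinv.matrix_mulVec hsub))).const_mul _

lemma two_mul_gaussianLogDensity_sub (m m₀ u : ι → ℝ) (C C₀ : Matrix ι ι ℝ) :
    2 * gaussianLogDensity m C u - gaussianLogDensity m₀ C₀ u =
      (-(1 / 2) * (Fintype.card ι * Real.log (2 * Real.pi)) - Real.log C.det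
        + 1 / 2 * Real.log C₀.det - m ⬝ᵥ C⁻¹ *ᵥ m + 1 / 2 * (m₀ ⬝ᵥ C₀⁻¹ *ᵥ m₀))
      - 1 / 2 * (u ⬝ᵥ ((2 : ℝ) • C⁻¹ - C₀⁻¹) *ᵥ u)
      + u ⬝ᵥ (C⁻¹ *ᵥ m + C⁻¹ᵀ *ᵥ m - (1 / 2 : ℝ) • (C₀⁻¹ *ᵥ m₀ + C₀⁻¹ᵀ *ᵥ m₀)) := by
  have h : ∀ (A : Matrix ι ι ℝ) (v : ι → ℝ), u ⬝ᵥ Aᵀ *ᵥ v = v ⬝ᵥ A *ᵥ u := fun A v => by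
    rw [mulVec_transpose, dotProduct_comm, dotProduct_mulVec]
  simp only [gaussianLogDensity, sub_mulVec, mulVec_sub, smul_mulVec, dotProduct_sub,
    dotProduct_add, sub_dotProduct, dotProduct_smul, smul_eq_mul, h]
  ring

/-- Near `(m₁, C₁)`, the likelihood ratios relative to `N (m₀, C₀)` are uniformly square integrable
when `2 C₁⁻¹ - C₀⁻¹` is positive definite. -/
lemma exists_gaussianLogDensity_bound {T : Type*} {l : Filter T} {m : T → ι → ℝ}
    {C : T → Matrix ι ι ℝ} {m₀ m₁ : ι → ℝ} {C₀ C₁ : Matrix ι ι ℝ} (hC₁ : C₁.PosDef)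
    (hE : ((2 : ℝ) • C₁⁻¹ - C₀⁻¹).PosDef)
    (hm : Tendsto m l (𝓝 m₁)) (hC : Tendsto C l (𝓝 C₁)) :
    ∃ k δ : ℝ, 0 < δ ∧ ∀ᶠ t in l, ∀ u,
      2 * gaussianLogDensity (m t) (C t) u - gaussianLogDensity m₀ C₀ u ≤
        k - δ * ∑ i, u i ^ 2 := by
  have hinv : Tendsto (fun t => (C t)⁻¹) l (𝓝 C₁⁻¹) :=
    (continuousAt_inv_of_isUnit hC₁.isUnit).tendsto.comp hC
  have hinvT : Tendsto (fun t => (C t)⁻¹ᵀ) l (𝓝 C₁⁻¹ᵀ) :=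
    ((continuous_id.matrix_transpose (A := fun M : Matrix ι ι ℝ => M)).tendsto C₁⁻¹).comp hinv
  have hdet : Tendsto (fun t => Real.log (C t).det) l (𝓝 (Real.log C₁.det)) :=
    ((continuous_id.matrix_det.tendsto C₁).comp hC).log hC₁.det_pos.ne'
  obtain ⟨c, hc, hcE⟩ := hE.exists_trace_le_mul_trace
  set a : T → ℝ := fun t => -(1 / 2) * (Fintype.card ι * Real.log (2 * Real.pi))
    - Real.log (C t).det + 1 / 2 * Real.log C₀.det - m t ⬝ᵥ (C t)⁻¹ *ᵥ m t
    + 1 / 2 * (m₀ ⬝ᵥ C₀⁻¹ *ᵥ m₀) with ha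
  set v : T → ι → ℝ := fun t => (C t)⁻¹ *ᵥ m t + (C t)⁻¹ᵀ *ᵥ m t
    - (1 / 2 : ℝ) • (C₀⁻¹ *ᵥ m₀ + C₀⁻¹ᵀ *ᵥ m₀) with hv
  obtain ⟨a₁, ha₁⟩ : ∃ a₁, Tendsto a l (𝓝 a₁) :=
    ⟨_, (((hdet.const_sub _).add_const _).sub (hm.dotProduct (hinv.matrix_mulVec hm))).add_const _⟩
  obtain ⟨v₁, hv₁⟩ : ∃ v₁, Tendsto v l (𝓝 v₁) :=
    ⟨_, ((hinv.matrix_mulVec hm).add (hinvT.matrix_mulVec hm)).sub_const _⟩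
  have hEt : Tendsto (fun t => ((2 : ℝ) • (C t)⁻¹ - C₀⁻¹) - ((2 : ℝ) • C₁⁻¹ - C₀⁻¹)) l (𝓝 0) := by
    have := ((hinv.const_smul (2 : ℝ)).sub_const C₀⁻¹).sub_const ((2 : ℝ) • C₁⁻¹ - C₀⁻¹)
    rwa [sub_self] at this
  set β := ‖v₁‖ + 1 with hβ
  refine ⟨a₁ + 1 + Fintype.card ι * (2 * c * β ^ 2), 1 / (8 * c), by positivity, ?_⟩
  filter_upwards [ha₁.eventually (gt_mem_nhds (lt_add_one a₁)),
    hv₁.norm.eventually (gt_mem_nhds (lt_add_one ‖v₁‖)),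
    hE.eventually_abs_trace_mul_le hEt one_half_pos] with t h1 h2 h3 u
  rw [two_mul_gaussianLogDensity_sub]
  have q1 := hcE _ (posSemidef_vecMulVec_self u)
  have q2 := (abs_le.1 (h3 _ (posSemidef_vecMulVec_self u))).1
  rw [trace_vecMulVec] at q1
  rw [Matrix.mul_sub _ ((2 : ℝ) • (C t)⁻¹ - C₀⁻¹), trace_sub] at q2
  simp only [trace_vecMulVec_self_mul] at q1 q2
  have q3 : u ⬝ᵥ u = ∑ i, u i ^ 2 := by simp [dotProduct, pow_two]
  have q4 : u ⬝ᵥ v t ≤ 1 / (8 * c) * ∑ i, u i ^ 2 + Fintype.card ι * (2 * c * β ^ 2) := by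
    calc u ⬝ᵥ v t = ∑ i, u i * v t i := rfl
      _ ≤ ∑ i, (1 / (8 * c) * u i ^ 2 + 2 * c * β ^ 2) := by
        refine Finset.sum_le_sum fun i _ => ?_
        have h4 : |v t i| ≤ β := (norm_le_pi_norm (v t) i).trans h2.le
        have h5 : u i * v t i ≤ |u i| * β :=
          (le_abs_self _).trans (by rw [abs_mul]; gcongr)
        have h6 : 1 / (8 * c) * u i ^ 2 + 2 * c * β ^ 2 - |u i| * β =
            1 / (8 * c) * (|u i| - 4 * c * β) ^ 2 := by
          rw [← sq_abs (u i)]; field_simp; ring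
        have h7 : 0 ≤ 1 / (8 * c) * (|u i| - 4 * c * β) ^ 2 := by positivity
        linarith
      _ = _ := by rw [Finset.sum_add_distrib, ← Finset.mul_sum]; simp
  have q5 : 1 / (2 * c) * ∑ i, u i ^ 2 ≤ u ⬝ᵥ ((2 : ℝ) • (C t)⁻¹ - C₀⁻¹) *ᵥ u := by
    rw [← q3, one_div, inv_mul_le_iff₀ (by positivity)]
    nlinarith
  have q6 : 1 / (2 * c) * ∑ i, u i ^ 2 = 4 * (1 / (8 * c) * ∑ i, u i ^ 2) := by
    field_simp; ring
  have h1' : a t < a₁ + 1 := h1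
  rw [ha] at h1'
  dsimp only at h1'
  rw [hv] at q4
  dsimp only at q4
  linarith

theorem tendsto_integral_multivariateGaussian {T : Type*} {l : Filter T}
    [l.IsCountablyGenerated] {m : T → ι → ℝ} {C : T → Matrix ι ι ℝ} {m₀ m₁ : ι → ℝ}
    {C₀ C₁ : Matrix ι ι ℝ} {f : (ι → ℝ) → ℝ} (hf : Measurable f) (hC₀ : C₀.PosDef)
    (hf2 : Integrable (fun u => f (WithLp.ofLp u) ^ 2)
      (multivariateGaussian (WithLp.toLp 2 m₀) C₀))
    (hC₁ : C₁.PosDef) (hE : ((2 : ℝ) • C₁⁻¹ - C₀⁻¹).PosDef)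
    (hm : Tendsto m l (𝓝 m₁)) (hC : Tendsto C l (𝓝 C₁)) (hpos : ∀ᶠ t in l, (C t).PosDef) :
    Tendsto (fun t => ∫ u, f (WithLp.ofLp u) ∂multivariateGaussian (WithLp.toLp 2 (m t)) (C t)) l
      (𝓝 (∫ u, f (WithLp.ofLp u) ∂multivariateGaussian (WithLp.toLp 2 m₁) C₁)) := by
  obtain ⟨k, δ, hδ, hbound⟩ := exists_gaussianLogDensity_bound (m₀ := m₀) hC₁ hE hm hC
  rw [integral_multivariateGaussian_eq m₁ hC₁]
  rw [integrable_multivariateGaussian_iff m₀ hC₀ (fun u => f u ^ 2)] at hf2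
  have hlim : Tendsto (fun t => ∫ u, Real.exp (gaussianLogDensity (m t) (C t) u) * f u) l
      (𝓝 (∫ u, Real.exp (gaussianLogDensity m₁ C₁ u) * f u)) := by
    refine tendsto_integral_filter_of_dominated_convergence
      (fun u => Real.exp (gaussianLogDensity m₀ C₀ u) * f u ^ 2 +
        Real.exp (k - δ * ∑ i, u i ^ 2)) (Eventually.of_forall fun t => ?_) ?_
      (hf2.add (integrable_exp_sub_mul_sum_sq k hδ)) (Eventually.of_forall fun u => ?_)
    · exact ((Real.continuous_exp.comp (continuous_gaussianLogDensity (m t) (C t))).measurable.mul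
        hf).aestronglyMeasurable
    · filter_upwards [hbound] with t ht
      refine Eventually.of_forall fun u => ?_
      set g := gaussianLogDensity (m t) (C t) u
      set g₀ := gaussianLogDensity m₀ C₀ u
      have h1 : Real.exp (2 * g - g₀) ≤ Real.exp (k - δ * ∑ i, u i ^ 2) := Real.exp_le_exp.2 (ht u)
      have h2 : Real.exp (g₀ / 2) ^ 2 = Real.exp g₀ := by rw [← Real.exp_nat_mul]; congr 1; ring
      have h3 : Real.exp (g - g₀ / 2) ^ 2 = Real.exp (2 * g - g₀) := by
        rw [← Real.exp_nat_mul]; congr 1; push_cast; ring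
      have h4 : Real.exp g = Real.exp (g₀ / 2) * Real.exp (g - g₀ / 2) := by
        rw [← Real.exp_add]; congr 1; ring
      rw [Real.norm_eq_abs, abs_mul, abs_of_pos (Real.exp_pos _), h4, ← sq_abs (f u), ← h2]
      rw [← h3] at h1
      nlinarith [sq_nonneg (Real.exp (g₀ / 2) * |f u| - Real.exp (g - g₀ / 2)),
        sq_nonneg (Real.exp (g₀ / 2) * |f u|), sq_nonneg (Real.exp (g - g₀ / 2))]
    · exact ((Real.continuous_exp.tendsto _).comp
        (tendsto_gaussianLogDensity hC₁ hm hC u)).mul_const (f u)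
  refine hlim.congr' ?_
  filter_upwards [hpos] with t ht
  rw [integral_multivariateGaussian_eq (m t) ht]

end GaussianDensity

section CovarianceMatrix

set_option linter.unusedSectionVars false

variable {S : Type*} [MeasurableSpace S] {P : Measure S}
variable {ι κ ι' : Type*} [Fintype ι] [Fintype κ] [Fintype ι']

lemma MeasureTheory.MemLp.mulVec {U : S → κ → ℝ} (hU : MemLp U 2 P) (M : Matrix ι κ ℝ) :
    MemLp (fun ω => M *ᵥ U ω) 2 P :=
  MemLp.of_eval fun i => memLp_finsetSum _ fun j _ => (hU.eval j).const_mul (M i j)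

lemma meanVec_congr_ae {U U' : S → ι → ℝ} (h : U =ᵐ[P] U') : meanVec P U = meanVec P U' :=
  funext fun a => integral_congr_ae (h.mono fun _ hω => congrFun hω a)

lemma covMat_congr_ae {U U' : S → ι → ℝ} {W W' : S → κ → ℝ} (hU : U =ᵐ[P] U')
    (hW : W =ᵐ[P] W') : covMat P U W = covMat P U' W' := by
  ext a b
  have h1 := congrFun (meanVec_congr_ae hU) a
  have h2 := congrFun (meanVec_congr_ae hW) b
  simp only [meanVec] at h1 h2
  simp only [covMat, of_apply, covariance, h1, h2]
  refine integral_congr_ae ?_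
  filter_upwards [hU, hW] with ω hω hω'
  rw [hω, hω']

lemma covMat_transpose (U : S → ι → ℝ) (W : S → κ → ℝ) : (covMat P U W)ᵀ = covMat P W U := by
  ext a b
  exact covariance_comm _ _

variable [IsProbabilityMeasure P]

lemma meanVec_add {U U' : S → ι → ℝ} (hU : MemLp U 2 P) (hU' : MemLp U' 2 P) :
    meanVec P (fun ω => U ω + U' ω) = meanVec P U + meanVec P U' :=
  funext fun a => integral_add ((hU.eval a).integrable one_le_two)
    ((hU'.eval a).integrable one_le_two)

lemma meanVec_const_add (c : ι → ℝ) {U : S → ι → ℝ} (hU : MemLp U 2 P) :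
    meanVec P (fun ω => c + U ω) = c + meanVec P U := by
  have := meanVec_add (memLp_const (μ := P) (p := 2) c) hU
  rw [this]
  congr 1
  ext a
  simp [meanVec]

lemma meanVec_mulVec (M : Matrix ι κ ℝ) {U : S → κ → ℝ} (hU : MemLp U 2 P) :
    meanVec P (fun ω => M *ᵥ U ω) = M *ᵥ meanVec P U := by
  ext a
  simp only [meanVec, mulVec, dotProduct]
  rw [integral_finsetSum _ fun j _ => ((hU.eval j).integrable one_le_two).const_mul (M a j)]
  simp only [integral_const_mul]

lemma covMat_add_left {U U' : S → ι → ℝ} {W : S → κ → ℝ} (hU : MemLp U 2 P) (hU' : MemLp U' 2 P)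
    (hW : MemLp W 2 P) : covMat P (fun ω => U ω + U' ω) W = covMat P U W + covMat P U' W := by
  ext a b
  exact covariance_add_left (hU.eval a) (hU'.eval a) (hW.eval b)

lemma covMat_add_right {U : S → κ → ℝ} {W W' : S → ι → ℝ} (hU : MemLp U 2 P) (hW : MemLp W 2 P)
    (hW' : MemLp W' 2 P) : covMat P U (fun ω => W ω + W' ω) = covMat P U W + covMat P U W' := by
  ext a b
  exact covariance_add_right (hU.eval a) (hW.eval b) (hW'.eval b)

lemma covMat_const_add_left (c : ι → ℝ) {U : S → ι → ℝ} (W : S → κ → ℝ) (hU : MemLp U 2 P) :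
    covMat P (fun ω => c + U ω) W = covMat P U W := by
  ext a b
  exact covariance_const_add_left ((hU.eval a).integrable one_le_two) (c a)

lemma covMat_const_add_right (c : ι → ℝ) (U : S → κ → ℝ) {W : S → ι → ℝ} (hW : MemLp W 2 P) :
    covMat P U (fun ω => c + W ω) = covMat P U W := by
  ext a b
  exact covariance_const_add_right ((hW.eval b).integrable one_le_two) (c b)

lemma covMat_mulVec_left (M : Matrix ι' ι ℝ) {U : S → ι → ℝ} {W : S → κ → ℝ}
    (hU : MemLp U 2 P) (hW : MemLp W 2 P) :
    covMat P (fun ω => M *ᵥ U ω) W = M * covMat P U W := by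
  ext a b
  simp only [covMat, of_apply, mulVec, dotProduct, mul_apply]
  rw [covariance_fun_sum_left (fun j => (hU.eval j).const_mul (M a j)) (hW.eval b)]
  simp only [covariance_const_mul_left]

lemma covMat_mulVec_right (M : Matrix ι' κ ℝ) {U : S → ι → ℝ} {W : S → κ → ℝ}
    (hU : MemLp U 2 P) (hW : MemLp W 2 P) :
    covMat P U (fun ω => M *ᵥ W ω) = covMat P U W * Mᵀ := by
  rw [← covMat_transpose, covMat_mulVec_left M hW hU, transpose_mul, covMat_transpose]

lemma covMat_eq_zero_of_indepFun {U : S → ι → ℝ} {W : S → κ → ℝ} (h : IndepFun U W P)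
    (hU : MemLp U 2 P) (hW : MemLp W 2 P) : covMat P U W = 0 := by
  ext a b
  exact (h.comp (measurable_pi_apply a) (measurable_pi_apply b)).covariance_eq_zero
    (hU.eval a) (hW.eval b)

lemma posSemidef_covMat {U : S → ι → ℝ} (hU : MemLp U 2 P) : (covMat P U U).PosSemidef := by
  refine .of_dotProduct_mulVec_nonneg ?_ fun x => ?_
  · rw [IsHermitian, conjTranspose_eq_transpose_of_trivial, covMat_transpose]
  · set M : Matrix Unit ι ℝ := Matrix.of fun _ => x
    have h1 : covMat P (fun ω => M *ᵥ U ω) (fun ω => M *ᵥ U ω) () () = x ⬝ᵥ covMat P U U *ᵥ x := by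
      rw [covMat_mulVec_left M hU (hU.mulVec M), covMat_mulVec_right M hU hU, mul_apply']
      rfl
    rw [star_trivial, ← h1]
    change 0 ≤ covariance _ _ P
    rw [covariance_self ((hU.mulVec M).eval ()).aestronglyMeasurable.aemeasurable]
    exact variance_nonneg _ _

lemma covMat_apply_eq_sub {U : S → ι → ℝ} {W : S → κ → ℝ} (hU : MemLp U 2 P) (hW : MemLp W 2 P)
    (a : ι) (b : κ) :
    covMat P U W a b = ∫ ω, U ω a * W ω b ∂P - meanVec P U a * meanVec P W b :=
  covariance_eq_sub (hU.eval a) (hW.eval b)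

end CovarianceMatrix

section Independence

variable {S : Type*} [MeasurableSpace S] {P : Measure S} [IsProbabilityMeasure P]
variable {α β γ : Type*} [MeasurableSpace α] [MeasurableSpace β] [MeasurableSpace γ]

/-- If `U` and `V` are independent and `(U, V)` is independent of `W`, then `U` is independent of
`(V, W)`. -/
lemma ProbabilityTheory.IndepFun.prodMk_of_prodMk {U : S → α} {V : S → β} {W : S → γ}
    (hU : Measurable U) (hV : Measurable V) (hW : Measurable W) (h : IndepFun U V P)
    (h' : IndepFun (fun ω => (U ω, V ω)) W P) : IndepFun U (fun ω => (V ω, W ω)) P := by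
  have hVW : IndepFun V W P := h'.comp measurable_snd measurable_id
  rw [indepFun_iff_map_prod_eq_prod_map_map hU.aemeasurable (hV.prodMk hW).aemeasurable]
  rw [indepFun_iff_map_prod_eq_prod_map_map hU.aemeasurable hV.aemeasurable] at h
  rw [indepFun_iff_map_prod_eq_prod_map_map (hU.prodMk hV).aemeasurable hW.aemeasurable, h] at h'
  rw [indepFun_iff_map_prod_eq_prod_map_map hV.aemeasurable hW.aemeasurable] at hVW
  have : IsProbabilityMeasure (P.map U) := Measure.isProbabilityMeasure_map hU.aemeasurable
  have : IsProbabilityMeasure (P.map V) := Measure.isProbabilityMeasure_map hV.aemeasurable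
  have : IsProbabilityMeasure (P.map W) := Measure.isProbabilityMeasure_map hW.aemeasurable
  rw [hVW, ← Measure.prodAssoc_prod, ← h', Measure.map_map MeasurableEquiv.prodAssoc.measurable
    ((hU.prodMk hV).prodMk hW)]
  rfl

/-- Conditional expectation of a function of `(W, R)` given `W`, for independent `W`, `R`. -/
lemma condExp_ae_eq_integral_of_indepFun {W : S → β} {R : S → γ}
    (hW : Measurable W) (hR : Measurable R)
    (hind : IndepFun W R P) {f : β × γ → ℝ} (hf : Measurable f)
    (hint : Integrable (fun ω => f (W ω, R ω)) P) :
    P[fun ω => f (W ω, R ω) | MeasurableSpace.comap W inferInstance] =ᵐ[P]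
      fun ω => ∫ r, f (W ω, r) ∂P.map R := by
  have : IsProbabilityMeasure (P.map W) := Measure.isProbabilityMeasure_map hW.aemeasurable
  have : IsProbabilityMeasure (P.map R) := Measure.isProbabilityMeasure_map hR.aemeasurable
  have hlaw := (indepFun_iff_map_prod_eq_prod_map_map hW.aemeasurable hR.aemeasurable).1 hind
  have hintp : Integrable f ((P.map W).prod (P.map R)) := by
    rw [← hlaw]
    exact (integrable_map_measure hf.aestronglyMeasurable (hW.prodMk hR).aemeasurable).2 hint
  have hgm : StronglyMeasurable fun w => ∫ r, f (w, r) ∂P.map R :=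
    hf.stronglyMeasurable.integral_prod_right'
  have hgint : Integrable (fun w => ∫ r, f (w, r) ∂P.map R) (P.map W) := hintp.integral_prod_left
  refine (ae_eq_condExp_of_forall_setIntegral_eq hW.comap_le hint (fun s _ _ => ?_) ?_ ?_).symm
  · exact ((integrable_map_measure hgm.aestronglyMeasurable hW.aemeasurable).1 hgint).integrableOn
  · rintro s ⟨t, ht, rfl⟩ _
    rw [← setIntegral_map ht hgm.aestronglyMeasurable hW.aemeasurable]
    have h1 : ∫ ω in W ⁻¹' t, f (W ω, R ω) ∂P =
        ∫ x in t ×ˢ Set.univ, f x ∂(P.map W).prod (P.map R) := by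
      rw [← hlaw, setIntegral_map (ht.prod MeasurableSet.univ) hf.aestronglyMeasurable
        (hW.prodMk hR).aemeasurable]
      congr 2
      ext ω; simp
    rw [h1, setIntegral_prod _ hintp.integrableOn]
    simp
  · exact (hgm.comp_measurable (comap_measurable W)).aestronglyMeasurable

end Independence

section GaussianVector

variable {S : Type*} [MeasurableSpace S] {P : Measure S}
variable {ι : Type*} [Fintype ι] [DecidableEq ι]

lemma hasGaussianLaw_of_map_toLp {U : S → ι → ℝ} (hU : Measurable U) {m : ι → ℝ}
    {C : Matrix ι ι ℝ}
    (h : P.map (fun ω => WithLp.toLp 2 (U ω)) = multivariateGaussian (WithLp.toLp 2 m) C) :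
    HasGaussianLaw U P := by
  have hU' : Measurable fun ω => WithLp.toLp 2 (U ω) := by fun_prop
  have h1 : HasGaussianLaw (fun ω => WithLp.toLp 2 (U ω)) P :=
    ⟨by rw [h]; infer_instance⟩
  exact h1.map_equiv (EuclideanSpace.equiv ι ℝ)

lemma meanVec_of_map_toLp {U : S → ι → ℝ} (hU : Measurable U) {m : ι → ℝ} {C : Matrix ι ι ℝ}
    (h : P.map (fun ω => WithLp.toLp 2 (U ω)) = multivariateGaussian (WithLp.toLp 2 m) C) :
    meanVec P U = m := by
  have hU' : Measurable fun ω => WithLp.toLp 2 (U ω) := by fun_prop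
  ext a
  have h1 : ∫ ω, U ω a ∂P =
      ∫ u : EuclideanSpace ℝ ι, u a ∂multivariateGaussian (WithLp.toLp 2 m) C := by
    rw [← h, integral_map hU'.aemeasurable
      (by fun_prop : Measurable fun u : EuclideanSpace ℝ ι => u a).aestronglyMeasurable]
  rw [meanVec, h1]
  have h2 := (EuclideanSpace.proj a : EuclideanSpace ℝ ι →L[ℝ] ℝ).integral_comp_comm
    (IsGaussian.integrable_id (μ := multivariateGaussian (WithLp.toLp 2 m) C))
  simpa using h2

lemma covMat_of_map_toLp {U : S → ι → ℝ} (hU : Measurable U) {m : ι → ℝ} {C : Matrix ι ι ℝ}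
    (hC : C.PosSemidef)
    (h : P.map (fun ω => WithLp.toLp 2 (U ω)) = multivariateGaussian (WithLp.toLp 2 m) C) :
    covMat P U U = C := by
  have hU' : Measurable fun ω => WithLp.toLp 2 (U ω) := by fun_prop
  ext a b
  rw [← covariance_eval_multivariateGaussian (μ := WithLp.toLp 2 m) hC a b, ← h,
    covariance_map (by fun_prop : Measurable _).aestronglyMeasurable
      (by fun_prop : Measurable _).aestronglyMeasurable hU'.aemeasurable]
  rfl

lemma map_toLp_eq_multivariateGaussian [IsProbabilityMeasure P] {U : S → ι → ℝ} (hU : Measurable U)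
    (hg : HasGaussianLaw U P) :
    P.map (fun ω => WithLp.toLp 2 (U ω)) =
      multivariateGaussian (WithLp.toLp 2 (meanVec P U)) (covMat P U U) := by
  have hU' : Measurable fun ω => WithLp.toLp 2 (U ω) := by fun_prop
  have hg' : HasGaussianLaw (fun ω => WithLp.toLp 2 (U ω)) P :=
    hg.map_equiv (EuclideanSpace.equiv ι ℝ).symm
  have := hg'.isGaussian_map
  have hmem := hg.memLp_two
  apply IsGaussian.ext
  · rw [integral_id_multivariateGaussian', integral_map hU'.aemeasurable aestronglyMeasurable_id]
    ext a
    have h2 := (EuclideanSpace.proj a : EuclideanSpace ℝ ι →L[ℝ] ℝ).integral_comp_comm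
      hg'.integrable
    simp only [EuclideanSpace.coe_proj] at h2
    exact h2.symm
  · rw [← ContinuousLinearMap.toBilinForm_inj]
    refine LinearMap.BilinForm.ext_basis (EuclideanSpace.basisFun ι ℝ).toBasis fun i j => ?_
    have he : ∀ i : ι, (fun u : EuclideanSpace ℝ ι =>
        inner ℝ ((EuclideanSpace.basisFun ι ℝ).toBasis i) u) = fun u => u i := by
      intro i; ext u; simp [PiLp.inner_apply]
    rw [ContinuousLinearMap.toBilinForm_apply, ContinuousLinearMap.toBilinForm_apply,
      covarianceBilin_apply_eq_cov IsGaussian.memLp_two_id,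
      covarianceBilin_apply_eq_cov IsGaussian.memLp_two_id, he, he,
      covariance_eval_multivariateGaussian (posSemidef_covMat hmem),
      covariance_map (by fun_prop : Measurable _).aestronglyMeasurable
      (by fun_prop : Measurable _).aestronglyMeasurable hU'.aemeasurable]
    rfl

lemma multivariateGaussian_eq_map_add (m : EuclideanSpace ℝ ι) (C : Matrix ι ι ℝ) :
    multivariateGaussian m C = (multivariateGaussian 0 C).map fun u => m + u := by
  rw [multivariateGaussian, multivariateGaussian, Measure.map_map (by fun_prop) (by fun_prop)]
  congr 1
  ext u
  simp

end GaussianVector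

section Prediction

namespace StageOneParam

variable {q r h l : ℕ}

lemma predict_eq_integral_add {φ : (Fin q → ℝ) → Fin l → ℝ} (hφ : Measurable φ)
    (θ : StageOneParam q r h) (x : Fin h → ℝ) (z : Fin r → ℝ) (j : Fin l) :
    predict φ θ x z j = ∫ u : EuclideanSpace ℝ (Fin q),
      φ (θ.posteriorMean x z + WithLp.ofLp u) j ∂multivariateGaussian 0 θ.posteriorCov := by
  have hm : Measurable fun u : EuclideanSpace ℝ (Fin q) => φ (WithLp.ofLp u) j :=
    (measurable_pi_apply j).comp (hφ.comp (by fun_prop))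
  rw [predict, multivariateGaussian_eq_map_add, integral_map (by fun_prop) hm.aestronglyMeasurable]
  rfl

lemma continuous_posteriorMean (θ : StageOneParam q r h) :
    Continuous fun y : (Fin h → ℝ) × (Fin r → ℝ) => θ.posteriorMean y.1 y.2 := by
  unfold posteriorMean latentMean condMean
  fun_prop

lemma measurable_predict {φ : (Fin q → ℝ) → Fin l → ℝ} (hφ : Measurable φ)
    (θ : StageOneParam q r h) :
    Measurable fun y : (Fin h → ℝ) × (Fin r → ℝ) => predict φ θ y.1 y.2 := by
  refine measurable_pi_lambda _ fun j => ?_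
  simp only [predict_eq_integral_add hφ]
  have hm : Measurable fun y : ((Fin h → ℝ) × (Fin r → ℝ)) × EuclideanSpace ℝ (Fin q) =>
      φ (θ.posteriorMean y.1.1 y.1.2 + WithLp.ofLp y.2) j := by
    have h1 : Measurable fun y : ((Fin h → ℝ) × (Fin r → ℝ)) × EuclideanSpace ℝ (Fin q) =>
        θ.posteriorMean y.1.1 y.1.2 :=
      θ.continuous_posteriorMean.measurable.comp measurable_fst
    exact (measurable_pi_apply j).comp (hφ.comp (h1.add (by fun_prop)))
  exact hm.stronglyMeasurable.integral_prod_right'.measurable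

/-- The posterior covariance as the covariance of `ξ - L X` given `Z`, with `L` the coefficients of
the regression of `ξ` on `X`. -/
lemma posteriorCov_eq_joseph {θ : StageOneParam q r h} (hΨ : θ.Ψ.IsHermitian)
    (hcov : θ.cov.PosDef) :
    θ.posteriorCov = (1 - θ.latentCov * θ.Λᵀ * θ.cov⁻¹ * θ.Λ) * θ.latentCov *
        (1 - θ.latentCov * θ.Λᵀ * θ.cov⁻¹ * θ.Λ)ᵀ
      + θ.latentCov * θ.Λᵀ * θ.cov⁻¹ * θ.Ω * (θ.latentCov * θ.Λᵀ * θ.cov⁻¹)ᵀ := by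
  have hΨ' : θ.Ψᵀ = θ.Ψ := by simpa [IsHermitian, conjTranspose_eq_transpose_of_trivial] using hΨ
  have hΦ : θ.latentCovᵀ = θ.latentCov := by
    simp [latentCov, transpose_mul, hΨ', Matrix.mul_assoc]
  have hC : (θ.cov⁻¹)ᵀ = θ.cov⁻¹ := by
    have := hcov.inv.isHermitian
    rwa [IsHermitian, conjTranspose_eq_transpose_of_trivial] at this
  have hu := (isUnit_iff_isUnit_det _).1 hcov.isUnit
  set L := θ.latentCov * θ.Λᵀ * θ.cov⁻¹ with hL
  have hLt : Lᵀ = θ.cov⁻¹ * θ.Λ * θ.latentCov := by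
    simp [hL, transpose_mul, hC, hΦ, Matrix.mul_assoc]
  have hΩ : θ.Ω = θ.cov - θ.Λ * θ.latentCov * θ.Λᵀ := by rw [cov]; abel
  have h1 : L * θ.cov = θ.latentCov * θ.Λᵀ := by
    rw [hL, Matrix.mul_assoc, nonsing_inv_mul _ hu, Matrix.mul_one]
  have h2 : L * θ.cov * Lᵀ = L * θ.Λ * θ.latentCov := by
    rw [h1, hLt]
    simp only [hL, Matrix.mul_assoc]
  have h3 : θ.latentCov * θ.Λᵀ * Lᵀ = L * θ.Λ * θ.latentCov := by rw [← h1, h2]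
  rw [posteriorCov, ← hL, hΩ]
  simp only [transpose_sub, transpose_one, transpose_mul, Matrix.mul_sub, Matrix.sub_mul,
    Matrix.mul_one, Matrix.one_mul, h2]
  rw [← Matrix.mul_assoc θ.latentCov, h3]
  simp only [Matrix.mul_assoc]
  abel

lemma posDef_latentCov {θ : StageOneParam q r h} (hΨ : θ.Ψ.PosDef) (hB : IsUnit (1 - θ.B)) :
    θ.latentCov.PosDef := by
  have hu : IsUnit ((1 - θ.B)⁻¹)ᵀ := by
    rw [isUnit_iff_isUnit_det, det_transpose, isUnit_nonsing_inv_det_iff]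
    exact (isUnit_iff_isUnit_det _).1 hB
  have := hΨ.conjTranspose_mul_mul_same (mulVec_injective_of_isUnit hu)
  simpa [conjTranspose_eq_transpose_of_trivial, latentCov] using this

lemma posDef_posteriorCov {θ : StageOneParam q r h} (hθ : θ.Admissible) (hΨ : θ.Ψ.PosDef)
    (hΩ : θ.Ω.PosDef) : θ.posteriorCov.PosDef := by
  have hΦ := posDef_latentCov hΨ hθ.isUnit
  have hJ := posteriorCov_eq_joseph hΨ.isHermitian hθ.posDef_cov
  set L := θ.latentCov * θ.Λᵀ * θ.cov⁻¹ with hL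
  set N := 1 - L * θ.Λ with hN
  have h1 : (N * θ.latentCov * Nᵀ).PosSemidef := by
    simpa [conjTranspose_eq_transpose_of_trivial] using hΦ.posSemidef.mul_mul_conjTranspose_same N
  have h2 : (L * θ.Ω * Lᵀ).PosSemidef := by
    simpa [conjTranspose_eq_transpose_of_trivial] using hΩ.posSemidef.mul_mul_conjTranspose_same L
  rw [hJ]
  refine .of_dotProduct_mulVec_pos (h1.add h2).isHermitian fun x hx => ?_
  rw [star_trivial, add_mulVec, dotProduct_add]
  have e : ∀ {n : ℕ} (M : Matrix (Fin q) (Fin n) ℝ) (A : Matrix (Fin n) (Fin n) ℝ),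
      x ⬝ᵥ (M * A * Mᵀ) *ᵥ x = (Mᵀ *ᵥ x) ⬝ᵥ A *ᵥ (Mᵀ *ᵥ x) := by
    intro n M A
    rw [← mulVec_mulVec, ← mulVec_mulVec, dotProduct_mulVec, mulVec_transpose]
  have p1 := h1.dotProduct_mulVec_nonneg x
  have p2 := h2.dotProduct_mulVec_nonneg x
  rw [star_trivial] at p1 p2
  by_cases hLx : Lᵀ *ᵥ x = 0
  · have hNx : Nᵀ *ᵥ x = x := by
      rw [hN, transpose_sub, transpose_one, transpose_mul, sub_mulVec, one_mulVec, ← mulVec_mulVec,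
        hLx, mulVec_zero, sub_zero]
    have := hΦ.dotProduct_mulVec_pos hx
    rw [star_trivial] at this
    rw [e N, hNx]
    linarith
  · have := hΩ.dotProduct_mulVec_pos hLx
    rw [star_trivial, ← e L] at this
    linarith

end StageOneParam

end Prediction

namespace IsNonlinearSEM

variable {S : Type*} [MeasurableSpace S] {P : Measure S} [IsProbabilityMeasure P]
  {p q r l h m : ℕ} {φ : (Fin q → ℝ) → Fin l → ℝ}
  {θ₁ : StageOneParam q r h} {θ₂ : StageTwoParam p l r m}
  {Z : ℕ → S → Fin r → ℝ} {ξ : ℕ → S → Fin q → ℝ} {X : ℕ → S → Fin h → ℝ}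
  {η : ℕ → S → Fin p → ℝ} {Y : ℕ → S → Fin m → ℝ}
  {ζ₁ : ℕ → S → Fin q → ℝ} {ε₁ : ℕ → S → Fin h → ℝ}
  {ζ₂ : ℕ → S → Fin p → ℝ} {ε₂ : ℕ → S → Fin m → ℝ}

set_option linter.unusedSectionVars false

lemma ξ_eq (hM : IsNonlinearSEM P φ θ₁ θ₂ Z ξ X η Y ζ₁ ε₁ ζ₂ ε₂) (hB : IsUnit (1 - θ₁.B))
    (i : ℕ) (ω : S) : ξ i ω = θ₁.latentMean (Z i ω) + (1 - θ₁.B)⁻¹ *ᵥ ζ₁ i ω := by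
  have hu := (isUnit_iff_isUnit_det _).1 hB
  have h1 : (1 - θ₁.B) *ᵥ ξ i ω = θ₁.α + θ₁.Γ *ᵥ Z i ω + ζ₁ i ω := by
    rw [sub_mulVec, one_mulVec]
    nth_rw 1 [hM.eq_ξ i ω]
    abel
  rw [StageOneParam.latentMean, ← mulVec_add, ← h1, mulVec_mulVec, nonsing_inv_mul _ hu,
    one_mulVec]

/-- The residual of the regression of `X` on `Z`. -/
lemma X_sub_condMean (hM : IsNonlinearSEM P φ θ₁ θ₂ Z ξ X η Y ζ₁ ε₁ ζ₂ ε₂)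
    (hB : IsUnit (1 - θ₁.B)) (i : ℕ) (ω : S) :
    X i ω - θ₁.condMean (Z i ω) = (θ₁.Λ * (1 - θ₁.B)⁻¹) *ᵥ ζ₁ i ω + ε₁ i ω := by
  rw [hM.eq_X i ω, hM.ξ_eq hB]
  simp only [StageOneParam.condMean, StageOneParam.intercept, StageOneParam.slope,
    StageOneParam.latentMean, mulVec_add, add_mulVec, mulVec_mulVec, Matrix.mul_assoc]
  abel

/-- The data of a subject are a fixed function of the covariates and the residuals. -/
lemma exists_measurable_data (hM : IsNonlinearSEM P φ θ₁ θ₂ Z ξ X η Y ζ₁ ε₁ ζ₂ ε₂)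
    (hB : IsUnit (1 - θ₁.B)) :
    ∃ F : (Fin r → ℝ) × (Fin q → ℝ) × (Fin h → ℝ) × (Fin p → ℝ) × (Fin m → ℝ) →
        (Fin r → ℝ) × (Fin q → ℝ) × (Fin h → ℝ) × (Fin m → ℝ), Measurable F ∧
      ∀ i ω, (Z i ω, ξ i ω, X i ω, Y i ω) = F (Z i ω, ζ₁ i ω, ε₁ i ω, ζ₂ i ω, ε₂ i ω) := by
  set fξ : (Fin r → ℝ) × (Fin q → ℝ) → Fin q → ℝ :=
    fun t => θ₁.latentMean t.1 + (1 - θ₁.B)⁻¹ *ᵥ t.2 with hfξ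
  have hξm : Measurable fξ := by
    have : Continuous fξ := by
      rw [hfξ]; unfold StageOneParam.latentMean; fun_prop
    exact this.measurable
  refine ⟨fun t => (t.1, fξ (t.1, t.2.1),
    θ₁.ν + θ₁.Λ *ᵥ fξ (t.1, t.2.1) + θ₁.K *ᵥ t.1 + t.2.2.1,
    θ₂.ν + θ₂.Λ *ᵥ (θ₂.α + θ₂.B *ᵥ φ (fξ (t.1, t.2.1)) + θ₂.Γ *ᵥ t.1 + t.2.2.2.1)
      + θ₂.K *ᵥ t.1 + t.2.2.2.2), ?_, fun i ω => ?_⟩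
  · have hmv : ∀ {a b : ℕ} (M : Matrix (Fin a) (Fin b) ℝ),
        Measurable fun v : Fin b → ℝ => M *ᵥ v := fun M =>
      (by fun_prop : Continuous fun v => M *ᵥ v).measurable
    have h1 : Measurable fun t : (Fin r → ℝ) × (Fin q → ℝ) × (Fin h → ℝ) × (Fin p → ℝ) ×
        (Fin m → ℝ) => fξ (t.1, t.2.1) := hξm.comp (by fun_prop)
    have h2 := hM.measurable_φ.comp h1
    refine measurable_fst.prodMk (h1.prodMk (Measurable.prodMk ?_ ?_))
    · exact ((((hmv θ₁.Λ).comp h1).const_add θ₁.ν).add ((hmv θ₁.K).comp measurable_fst)).add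
        (by fun_prop)
    · exact ((((hmv θ₂.Λ).comp (((((hmv θ₂.B).comp h2).const_add θ₂.α).add
        ((hmv θ₂.Γ).comp measurable_fst)).add (by fun_prop))).const_add θ₂.ν).add
        ((hmv θ₂.K).comp measurable_fst)).add (by fun_prop)
  · have hξ : ξ i ω = fξ (Z i ω, ζ₁ i ω) := hM.ξ_eq hB i ω
    simp only [← hξ, ← hM.eq_X i ω, ← hM.eq_η i ω, ← hM.eq_Y i ω]

lemma measurable_data (hM : IsNonlinearSEM P φ θ₁ θ₂ Z ξ X η Y ζ₁ ε₁ ζ₂ ε₂)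
    (hB : IsUnit (1 - θ₁.B)) (i : ℕ) :
    Measurable fun ω => (Z i ω, ξ i ω, X i ω, Y i ω) := by
  obtain ⟨F, hF, hFeq⟩ := hM.exists_measurable_data hB
  simp only [hFeq]
  exact hF.comp ((hM.measurable_Z i).prodMk ((hM.measurable_ζ₁ i).prodMk
    ((hM.measurable_ε₁ i).prodMk ((hM.measurable_ζ₂ i).prodMk (hM.measurable_ε₂ i)))))

lemma identDistrib_data (hM : IsNonlinearSEM P φ θ₁ θ₂ Z ξ X η Y ζ₁ ε₁ ζ₂ ε₂)
    (hB : IsUnit (1 - θ₁.B)) (i : ℕ) :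
    IdentDistrib (fun ω => (Z i ω, ξ i ω, X i ω, Y i ω)) (fun ω => (Z 0 ω, ξ 0 ω, X 0 ω, Y 0 ω))
      P P := by
  obtain ⟨F, hF, hFeq⟩ := hM.exists_measurable_data hB
  simp only [hFeq]
  exact (hM.identDistrib i).comp hF

/-- Strong law of large numbers for functions of the data. -/
lemma tendsto_average (hM : IsNonlinearSEM P φ θ₁ θ₂ Z ξ X η Y ζ₁ ε₁ ζ₂ ε₂)
    (hB : IsUnit (1 - θ₁.B))
    {g : (Fin r → ℝ) × (Fin q → ℝ) × (Fin h → ℝ) × (Fin m → ℝ) → ℝ} (hg : Measurable g)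
    (hint : Integrable (fun ω => g (Z 0 ω, ξ 0 ω, X 0 ω, Y 0 ω)) P) :
    ∀ᵐ ω ∂P, Tendsto
      (fun n : ℕ => (n : ℝ)⁻¹ * ∑ i ∈ Finset.range n, g (Z i ω, ξ i ω, X i ω, Y i ω)) atTop
      (𝓝 (∫ ω, g (Z 0 ω, ξ 0 ω, X 0 ω, Y 0 ω) ∂P)) := by
  obtain ⟨F, hF, hFeq⟩ := hM.exists_measurable_data hB
  refine strong_law_ae (fun i ω => g (Z i ω, ξ i ω, X i ω, Y i ω)) hint (fun i j hij => ?_)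
    fun i => (hM.identDistrib_data hB i).comp hg
  simp only [Function.onFun, hFeq]
  exact (hM.iIndep.indepFun hij).comp (hg.comp hF) (hg.comp hF)

lemma hasGaussianLaw_residuals (hM : IsNonlinearSEM P φ θ₁ θ₂ Z ξ X η Y ζ₁ ε₁ ζ₂ ε₂) (i : ℕ) :
    HasGaussianLaw (fun ω => (ζ₁ i ω, ε₁ i ω)) P := by
  have hind : IndepFun (ζ₁ i) (ε₁ i) P := (hM.indep_ζ₁ i).comp measurable_id measurable_fst
  exact hind.hasGaussianLaw
    (hasGaussianLaw_of_map_toLp (m := 0) (hM.measurable_ζ₁ i) (by simpa using hM.law_ζ₁ i))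
    (hasGaussianLaw_of_map_toLp (m := 0) (hM.measurable_ε₁ i) (by simpa using hM.law_ε₁ i))

lemma memLp_ζ₁ (hM : IsNonlinearSEM P φ θ₁ θ₂ Z ξ X η Y ζ₁ ε₁ ζ₂ ε₂) (i : ℕ) :
    MemLp (ζ₁ i) 2 P := (hM.hasGaussianLaw_residuals i).fst.memLp_two

lemma memLp_ε₁ (hM : IsNonlinearSEM P φ θ₁ θ₂ Z ξ X η Y ζ₁ ε₁ ζ₂ ε₂) (i : ℕ) :
    MemLp (ε₁ i) 2 P := (hM.hasGaussianLaw_residuals i).snd.memLp_two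

lemma meanVec_ζ₁ (hM : IsNonlinearSEM P φ θ₁ θ₂ Z ξ X η Y ζ₁ ε₁ ζ₂ ε₂) (i : ℕ) :
    meanVec P (ζ₁ i) = 0 := by
  refine meanVec_of_map_toLp (m := 0) (C := θ₁.Ψ) (hM.measurable_ζ₁ i) ?_
  simpa using hM.law_ζ₁ i

lemma meanVec_ε₁ (hM : IsNonlinearSEM P φ θ₁ θ₂ Z ξ X η Y ζ₁ ε₁ ζ₂ ε₂) (i : ℕ) :
    meanVec P (ε₁ i) = 0 := by
  refine meanVec_of_map_toLp (m := 0) (C := θ₁.Ω) (hM.measurable_ε₁ i) ?_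
  simpa using hM.law_ε₁ i

lemma covMat_ζ₁ (hM : IsNonlinearSEM P φ θ₁ θ₂ Z ξ X η Y ζ₁ ε₁ ζ₂ ε₂) (hΨ : θ₁.Ψ.PosSemidef)
    (i : ℕ) : covMat P (ζ₁ i) (ζ₁ i) = θ₁.Ψ := by
  refine covMat_of_map_toLp (m := 0) (hM.measurable_ζ₁ i) hΨ ?_
  simpa using hM.law_ζ₁ i

lemma covMat_ε₁ (hM : IsNonlinearSEM P φ θ₁ θ₂ Z ξ X η Y ζ₁ ε₁ ζ₂ ε₂) (hΩ : θ₁.Ω.PosSemidef)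
    (i : ℕ) : covMat P (ε₁ i) (ε₁ i) = θ₁.Ω := by
  refine covMat_of_map_toLp (m := 0) (hM.measurable_ε₁ i) hΩ ?_
  simpa using hM.law_ε₁ i

lemma covMat_ζ₁_ε₁ (hM : IsNonlinearSEM P φ θ₁ θ₂ Z ξ X η Y ζ₁ ε₁ ζ₂ ε₂) (i : ℕ) :
    covMat P (ζ₁ i) (ε₁ i) = 0 :=
  covMat_eq_zero_of_indepFun ((hM.indep_ζ₁ i).comp measurable_id measurable_fst)
    (hM.memLp_ζ₁ i) (hM.memLp_ε₁ i)

/-- Covariance of linear combinations of the first-stage residuals. -/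
lemma covMat_residuals (hM : IsNonlinearSEM P φ θ₁ θ₂ Z ξ X η Y ζ₁ ε₁ ζ₂ ε₂)
    (hΨ : θ₁.Ψ.PosSemidef) (hΩ : θ₁.Ω.PosSemidef) (i : ℕ) {a b : ℕ}
    (M : Matrix (Fin a) (Fin q) ℝ) (N : Matrix (Fin a) (Fin h) ℝ)
    (M' : Matrix (Fin b) (Fin q) ℝ) (N' : Matrix (Fin b) (Fin h) ℝ) :
    covMat P (fun ω => M *ᵥ ζ₁ i ω + N *ᵥ ε₁ i ω) (fun ω => M' *ᵥ ζ₁ i ω + N' *ᵥ ε₁ i ω) =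
      M * θ₁.Ψ * M'ᵀ + N * θ₁.Ω * N'ᵀ := by
  have hz := hM.memLp_ζ₁ i
  have he := hM.memLp_ε₁ i
  have hez : covMat P (ε₁ i) (ζ₁ i) = 0 := by
    rw [← covMat_transpose, hM.covMat_ζ₁_ε₁, transpose_zero]
  have hs : MemLp (fun ω => M' *ᵥ ζ₁ i ω + N' *ᵥ ε₁ i ω) 2 P :=
    (hz.mulVec M').add (he.mulVec N')
  rw [covMat_add_left (hz.mulVec M) (he.mulVec N) hs,
    covMat_add_right (hz.mulVec M) (hz.mulVec M') (he.mulVec N'),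
    covMat_add_right (he.mulVec N) (hz.mulVec M') (he.mulVec N'),
    covMat_mulVec_left M hz (hz.mulVec M'), covMat_mulVec_left M hz (he.mulVec N'),
    covMat_mulVec_left N he (hz.mulVec M'), covMat_mulVec_left N he (he.mulVec N'),
    covMat_mulVec_right M' hz hz, covMat_mulVec_right N' hz he,
    covMat_mulVec_right M' he hz, covMat_mulVec_right N' he he,
    hM.covMat_ζ₁ hΨ, hM.covMat_ε₁ hΩ, hM.covMat_ζ₁_ε₁, hez]
  simp [Matrix.mul_assoc]

lemma meanVec_residuals (hM : IsNonlinearSEM P φ θ₁ θ₂ Z ξ X η Y ζ₁ ε₁ ζ₂ ε₂) (i : ℕ) {a : ℕ}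
    (M : Matrix (Fin a) (Fin q) ℝ) (N : Matrix (Fin a) (Fin h) ℝ) :
    meanVec P (fun ω => M *ᵥ ζ₁ i ω + N *ᵥ ε₁ i ω) = 0 := by
  rw [meanVec_add ((hM.memLp_ζ₁ i).mulVec M) ((hM.memLp_ε₁ i).mulVec N),
    meanVec_mulVec M (hM.memLp_ζ₁ i), meanVec_mulVec N (hM.memLp_ε₁ i), hM.meanVec_ζ₁,
    hM.meanVec_ε₁]
  simp

/-- `ξ = posteriorMean X Z + R` with a residual `R` that is independent of `(X, Z)` and normal with
mean zero and covariance `posteriorCov`. -/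
theorem exists_posterior_residual (hM : IsNonlinearSEM P φ θ₁ θ₂ Z ξ X η Y ζ₁ ε₁ ζ₂ ε₂)
    (hθ : θ₁.Admissible) (i : ℕ) :
    ∃ R : S → Fin q → ℝ, Measurable R ∧
      (∀ ω, ξ i ω = θ₁.posteriorMean (X i ω) (Z i ω) + R ω) ∧
      P.map (fun ω => WithLp.toLp 2 (R ω)) = multivariateGaussian 0 θ₁.posteriorCov ∧
      IndepFun (fun ω => (X i ω, Z i ω)) R P := by
  have hΨ := hθ.posSemidef_Ψ
  have hΩ := hθ.posSemidef_Ω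
  have hΨt : θ₁.Ψᵀ = θ₁.Ψ := by
    simpa [IsHermitian, conjTranspose_eq_transpose_of_trivial] using hΨ.isHermitian
  have hu := (isUnit_iff_isUnit_det _).1 hθ.posDef_cov.isUnit
  set A := (1 - θ₁.B)⁻¹ with hA
  set L := θ₁.latentCov * θ₁.Λᵀ * θ₁.cov⁻¹ with hL
  set e : S → Fin h → ℝ := fun ω => (θ₁.Λ * A) *ᵥ ζ₁ i ω + (1 : Matrix _ _ ℝ) *ᵥ ε₁ i ω with he
  set R : S → Fin q → ℝ := fun ω => (A - L * θ₁.Λ * A) *ᵥ ζ₁ i ω + (-L) *ᵥ ε₁ i ω with hR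
  have hmv : ∀ {a b : ℕ} (M : Matrix (Fin a) (Fin b) ℝ),
      Measurable fun v : Fin b → ℝ => M *ᵥ v := fun M =>
    (by fun_prop : Continuous fun v => M *ᵥ v).measurable
  have hRm : Measurable R :=
    ((hmv _).comp (hM.measurable_ζ₁ i)).add ((hmv _).comp (hM.measurable_ε₁ i))
  have hem : Measurable e :=
    ((hmv _).comp (hM.measurable_ζ₁ i)).add ((hmv _).comp (hM.measurable_ε₁ i))
  have hXe : ∀ ω, X i ω = θ₁.condMean (Z i ω) + e ω := fun ω => by
    have := hM.X_sub_condMean hθ.isUnit i ω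
    rw [he]; dsimp only
    rw [one_mulVec, ← this]; abel
  have hcRe : covMat P R e = 0 := by
    rw [hR, he, hM.covMat_residuals hΨ hΩ]
    have h1 : L * θ₁.cov = θ₁.latentCov * θ₁.Λᵀ := by
      rw [hL, Matrix.mul_assoc, nonsing_inv_mul _ hu, Matrix.mul_one]
    rw [StageOneParam.cov, Matrix.mul_add, StageOneParam.latentCov, ← hA] at h1
    have h2 : L * θ₁.Ω = A * θ₁.Ψ * Aᵀ * θ₁.Λᵀ - L * (θ₁.Λ * (A * θ₁.Ψ * Aᵀ) * θ₁.Λᵀ) := by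
      rw [← h1]; abel
    simp only [transpose_mul, transpose_one, Matrix.mul_one, Matrix.neg_mul, h2, Matrix.sub_mul,
      Matrix.mul_assoc]
    abel
  have hcRR : covMat P R R = θ₁.posteriorCov := by
    rw [hR, hM.covMat_residuals hΨ hΩ,
      StageOneParam.posteriorCov_eq_joseph hΨ.isHermitian hθ.posDef_cov, ← hL,
      StageOneParam.latentCov, ← hA]
    simp only [transpose_sub, transpose_one, transpose_mul, transpose_neg, Matrix.neg_mul,
      Matrix.mul_neg, neg_neg, Matrix.sub_mul, Matrix.mul_sub, Matrix.one_mul, Matrix.mul_one,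
      Matrix.mul_assoc]
  have hjoint : HasGaussianLaw (fun ω => (R ω, e ω)) P := by
    have hlin : ∀ {a : ℕ} (M : Matrix (Fin a) (Fin q) ℝ) (N : Matrix (Fin a) (Fin h) ℝ),
        ∃ T : (Fin q → ℝ) × (Fin h → ℝ) →L[ℝ] (Fin a → ℝ), ∀ x, T x = M *ᵥ x.1 + N *ᵥ x.2 :=
      fun M N => ⟨LinearMap.toContinuousLinearMap
        (M.mulVecLin ∘ₗ LinearMap.fst ℝ _ _ + N.mulVecLin ∘ₗ LinearMap.snd ℝ _ _), fun x => rfl⟩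
    obtain ⟨T₁, hT₁⟩ := hlin (A - L * θ₁.Λ * A) (-L)
    obtain ⟨T₂, hT₂⟩ := hlin (θ₁.Λ * A) (1 : Matrix _ _ ℝ)
    have := (hM.hasGaussianLaw_residuals i).map_fun (T₁.prod T₂)
    simpa [hT₁, hT₂, hR, he] using this
  have hRe : IndepFun R e P :=
    hjoint.indepFun_of_covariance_eval (X := fun a ω => R ω a) (Y := fun b ω => e ω b)
      fun a b => congrFun (congrFun hcRe a) b
  have hReZ : IndepFun (fun ω => (R ω, e ω)) (Z i) P := by
    have h1 : IndepFun (fun ω => (ζ₁ i ω, ε₁ i ω)) (Z i) P :=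
      ((hM.indep_Z i).comp measurable_id (ψ := fun t => (t.1, t.2.1)) (by fun_prop)).symm
    refine h1.comp (φ := fun t => ((A - L * θ₁.Λ * A) *ᵥ t.1 + (-L) *ᵥ t.2,
      (θ₁.Λ * A) *ᵥ t.1 + (1 : Matrix _ _ ℝ) *ᵥ t.2)) ?_ measurable_id
    exact (((hmv _).comp measurable_fst).add ((hmv _).comp measurable_snd)).prodMk
      (((hmv _).comp measurable_fst).add ((hmv _).comp measurable_snd))
  have hRind := hRe.prodMk_of_prodMk hRm hem (hM.measurable_Z i) hReZ
  refine ⟨R, hRm, fun ω => ?_, ?_, ?_⟩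
  · rw [StageOneParam.posteriorMean, ← hL, hM.X_sub_condMean hθ.isUnit, hM.ξ_eq hθ.isUnit, ← hA, hR]
    simp only [sub_mulVec, neg_mulVec, mulVec_add, mulVec_mulVec, Matrix.mul_assoc]
    abel
  · rw [map_toLp_eq_multivariateGaussian hRm hjoint.fst, hcRR, hR, hM.meanVec_residuals]
    simp
  · have hc : Measurable fun t : (Fin h → ℝ) × (Fin r → ℝ) => (θ₁.condMean t.2 + t.1, t.2) := by
      have : Continuous fun t : (Fin h → ℝ) × (Fin r → ℝ) => (θ₁.condMean t.2 + t.1, t.2) := by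
        unfold StageOneParam.condMean; fun_prop
      exact this.measurable
    have := (hRind.comp measurable_id hc).symm
    simpa [Function.comp_def, ← hXe] using this

end IsNonlinearSEM

section Moments

set_option linter.unusedSectionVars false

variable {S : Type*} [MeasurableSpace S] {P : Measure S} [IsProbabilityMeasure P]

lemma ae_integrable_of_indepFun {β γ : Type*} [MeasurableSpace β] [MeasurableSpace γ]
    {W : S → β} {R : S → γ} (hW : Measurable W) (hR : Measurable R)
    (hind : IndepFun W R P) {f : β × γ → ℝ} (hf : Measurable f)
    (hint : Integrable (fun ω => f (W ω, R ω)) P) :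
    ∀ᵐ ω ∂P, Integrable (fun r => f (W ω, r)) (P.map R) := by
  have : IsProbabilityMeasure (P.map R) := Measure.isProbabilityMeasure_map hR.aemeasurable
  have hlaw := (indepFun_iff_map_prod_eq_prod_map_map hW.aemeasurable hR.aemeasurable).1 hind
  have hintp : Integrable f ((P.map W).prod (P.map R)) := by
    rw [← hlaw]
    exact (integrable_map_measure hf.aestronglyMeasurable (hW.prodMk hR).aemeasurable).2 hint
  exact ae_of_ae_map hW.aemeasurable hintp.prod_right_ae

/-- The prediction error `f - E[f | m]` is uncorrelated with `m`-measurable variables. -/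
lemma covariance_sub_condExp_eq_zero {S : Type*} {m mS : MeasurableSpace S} {P : Measure S}
    [IsProbabilityMeasure P] (hm : m ≤ mS) {U f : S → ℝ} (hU : StronglyMeasurable[m] U)
    (hU2 : MemLp U 2 P) (hf : MemLp f 2 P) :
    cov[U, fun ω => f ω - (P[f | m]) ω; P] = 0 := by
  have hc : MemLp (P[f | m]) 2 P := hf.condExp one_le_two
  have h1 : ∫ ω, U ω * f ω ∂P = ∫ ω, U ω * (P[f | m]) ω ∂P := by
    rw [← integral_condExp hm (f := fun ω => U ω * f ω)]
    exact integral_congr_ae (condExp_mul_of_stronglyMeasurable_left hU (hU2.integrable_mul hf)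
      (hf.integrable one_le_two))
  have h2 : ∫ ω, (f ω - (P[f | m]) ω) ∂P = 0 := by
    rw [integral_sub (hf.integrable one_le_two) (hc.integrable one_le_two), integral_condExp hm,
      sub_self]
  have hs : MemLp (fun ω => f ω - (P[f | m]) ω) 2 P := hf.sub hc
  rw [covariance_eq_sub hU2 hs, h2, mul_zero, sub_zero]
  have h3 : ∀ ω, (U * fun ω => f ω - (P[f | m]) ω) ω = U ω * f ω - U ω * (P[f | m]) ω :=
    fun ω => mul_sub _ _ _
  simp only [h3]
  have i1 : Integrable (fun ω => U ω * f ω) P := hU2.integrable_mul hf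
  have i2 : Integrable (fun ω => U ω * (P[f | m]) ω) P := hU2.integrable_mul hc
  rw [integral_sub i1 i2, h1, sub_self]

lemma ProbabilityTheory.IdentDistrib.meanVec_eq {ι : Type*} {U U' : S → ι → ℝ}
    (hid : IdentDistrib U U' P P) : meanVec P U = meanVec P U' :=
  funext fun a => (hid.comp (measurable_pi_apply a)).integral_eq

lemma ProbabilityTheory.IdentDistrib.covMat_eq {ι : Type*} {U U' : S → ι → ℝ}
    (hid : IdentDistrib U U' P P) : covMat P U U = covMat P U' U' := by
  ext a b
  have hm := hid.meanVec_eq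
  have h1 := congrFun hm a
  have h2 := congrFun hm b
  simp only [meanVec] at h1 h2
  simp only [covMat, of_apply, covariance, h1, h2]
  exact (hid.comp (u := fun v : ι → ℝ =>
    (v a - ∫ ω, U' ω a ∂P) * (v b - ∫ ω, U' ω b ∂P)) (by fun_prop)).integral_eq

lemma covMat_stackData {r l m : ℕ} (U : S → Fin r → ℝ) (F : S → Fin l → ℝ) (Y : S → Fin m → ℝ) :
    covMat P (fun ω => stackData (U ω) (F ω) (Y ω)) (fun ω => stackData (U ω) (F ω) (Y ω)) =
      fromBlocks (fromBlocks (covMat P U U) (covMat P U F) (covMat P U F)ᵀ (covMat P F F))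
        (fromRows (covMat P U Y) (covMat P F Y))
        (fromCols (covMat P U Y)ᵀ (covMat P F Y)ᵀ) (covMat P Y Y) := by
  simp only [covMat_transpose]
  ext ((a | a) | a) ((b | b) | b) <;> rfl

lemma memLp_stackData {r l m : ℕ} {U : S → Fin r → ℝ} {F : S → Fin l → ℝ} {Y : S → Fin m → ℝ}
    (hU : MemLp U 2 P) (hF : MemLp F 2 P) (hY : MemLp Y 2 P) :
    MemLp (fun ω => stackData (U ω) (F ω) (Y ω)) 2 P := by
  refine MemLp.of_eval ?_
  rintro ((a | a) | a)
  exacts [hU.eval a, hF.eval a, hY.eval a]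

end Moments

namespace IsNonlinearSEM

variable {S : Type*} [MeasurableSpace S] {P : Measure S} [IsProbabilityMeasure P]
  {p q r l h m : ℕ} {φ : (Fin q → ℝ) → Fin l → ℝ}
  {θ₁ : StageOneParam q r h} {θ₂ : StageTwoParam p l r m}
  {Z : ℕ → S → Fin r → ℝ} {ξ : ℕ → S → Fin q → ℝ} {X : ℕ → S → Fin h → ℝ}
  {η : ℕ → S → Fin p → ℝ} {Y : ℕ → S → Fin m → ℝ}
  {ζ₁ : ℕ → S → Fin q → ℝ} {ε₁ : ℕ → S → Fin h → ℝ}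
  {ζ₂ : ℕ → S → Fin p → ℝ} {ε₂ : ℕ → S → Fin m → ℝ}

set_option linter.unusedSectionVars false

lemma measurable_X (hM : IsNonlinearSEM P φ θ₁ θ₂ Z ξ X η Y ζ₁ ε₁ ζ₂ ε₂)
    (hB : IsUnit (1 - θ₁.B)) (i : ℕ) : Measurable (X i) :=
  (measurable_fst.comp (measurable_snd.comp measurable_snd)).comp (hM.measurable_data hB i)

/-- The conditional expectation of `φ(ξ)` given `(X, Z)` is the prediction at the true
parameter. -/
theorem condPhi_ae_eq_predict (hM : IsNonlinearSEM P φ θ₁ θ₂ Z ξ X η Y ζ₁ ε₁ ζ₂ ε₂)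
    (hθ : θ₁.Admissible) (i : ℕ) :
    condPhi P φ (ξ i) (X i) (Z i) =ᵐ[P]
      fun ω => StageOneParam.predict φ θ₁ (X i ω) (Z i ω) := by
  obtain ⟨R, hRm, hξ, hlaw, hind⟩ := hM.exists_posterior_residual hθ i
  have hW := (hM.measurable_X hθ.isUnit i).prodMk (hM.measurable_Z i)
  have key : ∀ j, ∀ᵐ ω ∂P, condPhi P φ (ξ i) (X i) (Z i) ω j =
      StageOneParam.predict φ θ₁ (X i ω) (Z i ω) j := by
    intro j
    set f : ((Fin h → ℝ) × (Fin r → ℝ)) × (Fin q → ℝ) → ℝ :=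
      fun t => φ (θ₁.posteriorMean t.1.1 t.1.2 + t.2) j with hf
    have hfm : Measurable f := (measurable_pi_apply j).comp (hM.measurable_φ.comp
      ((θ₁.continuous_posteriorMean.measurable.comp measurable_fst).add measurable_snd))
    have hfξ : (fun ω => φ (ξ i ω) j) = fun ω => f ((X i ω, Z i ω), R ω) := by
      ext ω; rw [hf, hξ ω]
    have hint : Integrable (fun ω => f ((X i ω, Z i ω), R ω)) P := by
      rw [← hfξ]; exact ((hM.memLp_φ i).eval j).integrable one_le_two
    have h1 := condExp_ae_eq_integral_of_indepFun hW hRm hind hfm hint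
    simp only [condPhi, hfξ]
    filter_upwards [h1] with ω hω
    rw [hω, StageOneParam.predict_eq_integral_add hM.measurable_φ, ← hlaw]
    have hg : Measurable fun u : Fin q → ℝ =>
        φ (θ₁.posteriorMean (X i ω) (Z i ω) + u) j :=
      (measurable_pi_apply j).comp (hM.measurable_φ.comp (measurable_const_add _))
    have hg' : Measurable fun u : EuclideanSpace ℝ (Fin q) =>
        φ (θ₁.posteriorMean (X i ω) (Z i ω) + WithLp.ofLp u) j := hg.comp (by fun_prop)
    rw [integral_map hRm.aemeasurable hg.aestronglyMeasurable, integral_map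
      (by fun_prop : Measurable fun ω => WithLp.toLp 2 (R ω)).aemeasurable
      hg'.aestronglyMeasurable]
  filter_upwards [ae_all_iff.2 key] with ω hω
  exact funext hω

/-- Almost surely, `φ` is square integrable under the conditional distribution of `ξ`. -/
lemma ae_integrable_sq_posterior (hM : IsNonlinearSEM P φ θ₁ θ₂ Z ξ X η Y ζ₁ ε₁ ζ₂ ε₂)
    (hθ : θ₁.Admissible) (i : ℕ) :
    ∀ᵐ ω ∂P, ∀ j, Integrable (fun u : EuclideanSpace ℝ (Fin q) => φ (WithLp.ofLp u) j ^ 2)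
      (multivariateGaussian (WithLp.toLp 2 (θ₁.posteriorMean (X i ω) (Z i ω)))
        θ₁.posteriorCov) := by
  obtain ⟨R, hRm, hξ, hlaw, hind⟩ := hM.exists_posterior_residual hθ i
  have hW := (hM.measurable_X hθ.isUnit i).prodMk (hM.measurable_Z i)
  refine ae_all_iff.2 fun j => ?_
  set f : ((Fin h → ℝ) × (Fin r → ℝ)) × (Fin q → ℝ) → ℝ :=
    fun t => φ (θ₁.posteriorMean t.1.1 t.1.2 + t.2) j ^ 2 with hf
  have hfm : Measurable f := ((measurable_pi_apply j).comp (hM.measurable_φ.comp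
    ((θ₁.continuous_posteriorMean.measurable.comp measurable_fst).add measurable_snd))).pow_const 2
  have hint : Integrable (fun ω => f ((X i ω, Z i ω), R ω)) P := by
    have : (fun ω => f ((X i ω, Z i ω), R ω)) = fun ω => φ (ξ i ω) j ^ 2 := by
      ext ω; rw [hf, hξ ω]
    rw [this]; exact ((hM.memLp_φ i).eval j).integrable_sq
  filter_upwards [ae_integrable_of_indepFun hW hRm hind hfm hint] with ω hω
  have hφj : Measurable fun u : Fin q → ℝ => φ u j ^ 2 :=
    ((measurable_pi_apply j).comp hM.measurable_φ).pow_const 2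
  have hg : Measurable fun u : Fin q → ℝ => f ((X i ω, Z i ω), u) := hfm.comp (by fun_prop)
  have ho : Measurable fun u : EuclideanSpace ℝ (Fin q) => φ (WithLp.ofLp u) j ^ 2 :=
    hφj.comp (by fun_prop)
  rw [multivariateGaussian_eq_map_add, integrable_map_measure
    ho.aestronglyMeasurable (by fun_prop), ← hlaw]
  rw [integrable_map_measure hg.aestronglyMeasurable hRm.aemeasurable] at hω
  refine (integrable_map_measure ?_
    (by fun_prop : Measurable fun ω => WithLp.toLp 2 (R ω)).aemeasurable).2 hω
  exact (ho.comp (by fun_prop)).aestronglyMeasurable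

lemma memLp_condPhi (hM : IsNonlinearSEM P φ θ₁ θ₂ Z ξ X η Y ζ₁ ε₁ ζ₂ ε₂) (i : ℕ) :
    MemLp (condPhi P φ (ξ i) (X i) (Z i)) 2 P :=
  MemLp.of_eval fun j => ((hM.memLp_φ i).eval j).condExp one_le_two

lemma meanVec_condPhi (hM : IsNonlinearSEM P φ θ₁ θ₂ Z ξ X η Y ζ₁ ε₁ ζ₂ ε₂)
    (hB : IsUnit (1 - θ₁.B)) (i : ℕ) :
    meanVec P (condPhi P φ (ξ i) (X i) (Z i)) = meanVec P (fun ω => φ (ξ i ω)) :=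
  funext fun _ => integral_condExp ((hM.measurable_X hB i).prodMk (hM.measurable_Z i)).comap_le

/-- The prediction error `φ(ξ) - φ*` is uncorrelated with functions of `(X, Z)`. -/
lemma covMat_predictionError (hM : IsNonlinearSEM P φ θ₁ θ₂ Z ξ X η Y ζ₁ ε₁ ζ₂ ε₂)
    (hB : IsUnit (1 - θ₁.B)) (i : ℕ) {a : ℕ} {U : S → Fin a → ℝ} (hU2 : MemLp U 2 P)
    (hU : ∀ k, StronglyMeasurable[MeasurableSpace.comap (fun ω => (X i ω, Z i ω)) inferInstance]
      fun ω => U ω k) :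
    covMat P U (fun ω => φ (ξ i ω) - condPhi P φ (ξ i) (X i) (Z i) ω) = 0 := by
  ext k j
  exact covariance_sub_condExp_eq_zero
    ((hM.measurable_X hB i).prodMk (hM.measurable_Z i)).comap_le (hU k) (hU2.eval k)
    ((hM.memLp_φ i).eval j)

lemma indepFun_stageTwo_residuals (hM : IsNonlinearSEM P φ θ₁ θ₂ Z ξ X η Y ζ₁ ε₁ ζ₂ ε₂)
    (hB : IsUnit (1 - θ₁.B)) (i : ℕ) :
    IndepFun (fun ω => (ζ₂ i ω, ε₂ i ω)) (fun ω => (Z i ω, ξ i ω, X i ω)) P := by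
  have hU := (hM.measurable_ζ₂ i).prodMk (hM.measurable_ε₂ i)
  have h1 : IndepFun (fun ω => (ζ₂ i ω, ε₂ i ω)) (ε₁ i) P := (hM.indep_ε₁ i).symm
  have h2 := h1.prodMk_of_prodMk hU (hM.measurable_ε₁ i) (hM.measurable_ζ₁ i)
    ((hM.indep_ζ₁ i).comp measurable_id (ψ := fun t => (t.2, t.1)) (by fun_prop)).symm
  have h3 := h2.prodMk_of_prodMk hU ((hM.measurable_ε₁ i).prodMk (hM.measurable_ζ₁ i))
    (hM.measurable_Z i) ((hM.indep_Z i).comp measurable_id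
      (ψ := fun t => (t.2.2, (t.2.1, t.1))) (by fun_prop)).symm
  have hg : Continuous fun t : ((Fin h → ℝ) × (Fin q → ℝ)) × (Fin r → ℝ) =>
      (t.2, θ₁.latentMean t.2 + (1 - θ₁.B)⁻¹ *ᵥ t.1.2,
        θ₁.ν + θ₁.Λ *ᵥ (θ₁.latentMean t.2 + (1 - θ₁.B)⁻¹ *ᵥ t.1.2) + θ₁.K *ᵥ t.2 + t.1.1) := by
    unfold StageOneParam.latentMean; fun_prop
  have h4 := h3.comp measurable_id hg.measurable
  simpa [Function.comp_def, ← hM.ξ_eq hB, ← hM.eq_X] using h4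

set_option maxHeartbeats 1000000 in
/-- The modelled mean and covariance of `(Z, φ*, Y)` at the limit are the true ones. -/
theorem stageTwoLimit_moments (hM : IsNonlinearSEM P φ θ₁ θ₂ Z ξ X η Y ζ₁ ε₁ ζ₂ ε₂)
    (hθ : θ₁.Admissible) (i : ℕ) :
    (stageTwoLimit P φ θ₂ (ξ i) (X i) (Z i)).mean = meanVec P (fun ω =>
        stackData (Z i ω) (condPhi P φ (ξ i) (X i) (Z i) ω) (Y i ω)) ∧
      (stageTwoLimit P φ θ₂ (ξ i) (X i) (Z i)).cov = covMat P
        (fun ω => stackData (Z i ω) (condPhi P φ (ξ i) (X i) (Z i) ω) (Y i ω))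
        (fun ω => stackData (Z i ω) (condPhi P φ (ξ i) (X i) (Z i) ω) (Y i ω)) ∧
      MemLp (Y i) 2 P := by
  have hB := hθ.isUnit
  set F := condPhi P φ (ξ i) (X i) (Z i) with hF
  set δ : S → Fin l → ℝ := fun ω => φ (ξ i ω) - F ω with hδ
  have hZ2 := hM.memLp_Z i
  have hF2 : MemLp F 2 P := hM.memLp_condPhi i
  have hδ2 : MemLp δ 2 P := (hM.memLp_φ i).sub hF2
  have hζ2 := hM.memLp_ζ₂ i
  have hε2 := hM.memLp_ε₂ i
  have hmF := hM.meanVec_condPhi hB i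
  have hmδ : meanVec P δ = 0 := by
    have h1 : meanVec P (fun ω => φ (ξ i ω)) = meanVec P F + meanVec P δ := by
      rw [← meanVec_add hF2 hδ2]; simp [hδ]
    rw [← hmF] at h1
    exact left_eq_add.1 h1
  have hZδ : covMat P (Z i) δ = 0 := by
    refine hM.covMat_predictionError hB i hZ2 fun k => ?_
    exact (((measurable_pi_apply k).comp measurable_snd).comp
      (comap_measurable fun ω => (X i ω, Z i ω))).stronglyMeasurable
  have hFδ : covMat P F δ = 0 :=
    hM.covMat_predictionError hB i hF2 fun k => stronglyMeasurable_condExp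
  -- independence of the second-stage residuals from the predictors
  have hind := hM.indepFun_stageTwo_residuals hB i
  have hpm := StageOneParam.measurable_predict hM.measurable_φ θ₁
  have haeF := hM.condPhi_ae_eq_predict hθ i
  have hindF : IndepFun (fun ω => (ζ₂ i ω, ε₂ i ω)) F P := by
    have h1 : IndepFun (fun ω => (ζ₂ i ω, ε₂ i ω))
        (fun ω => StageOneParam.predict φ θ₁ (X i ω) (Z i ω)) P :=
      hind.comp measurable_id (hpm.comp (by fun_prop : Measurable fun t :
        (Fin r → ℝ) × (Fin q → ℝ) × (Fin h → ℝ) => (t.2.2, t.1)))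
    exact h1.congr EventuallyEq.rfl haeF.symm
  have hindδ : IndepFun (fun ω => (ζ₂ i ω, ε₂ i ω)) δ P := by
    have h1 : IndepFun (fun ω => (ζ₂ i ω, ε₂ i ω))
        (fun ω => φ (ξ i ω) - StageOneParam.predict φ θ₁ (X i ω) (Z i ω)) P :=
      hind.comp measurable_id ((hM.measurable_φ.comp (by fun_prop : Measurable fun t :
        (Fin r → ℝ) × (Fin q → ℝ) × (Fin h → ℝ) => t.2.1)).sub
        (hpm.comp (by fun_prop : Measurable fun t :
          (Fin r → ℝ) × (Fin q → ℝ) × (Fin h → ℝ) => (t.2.2, t.1))))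
    refine h1.congr EventuallyEq.rfl ?_
    filter_upwards [haeF] with ω hω
    simp only [hδ, hF, hω]
  have hindZ : IndepFun (fun ω => (ζ₂ i ω, ε₂ i ω)) (Z i) P :=
    hind.comp measurable_id measurable_fst
  have cζ : ∀ {a : ℕ} {U : S → Fin a → ℝ}, IndepFun (fun ω => (ζ₂ i ω, ε₂ i ω)) U P →
      MemLp U 2 P → covMat P U (ζ₂ i) = 0 := fun h hU =>
    covMat_eq_zero_of_indepFun (h.comp measurable_fst measurable_id).symm hU hζ2
  have cε : ∀ {a : ℕ} {U : S → Fin a → ℝ}, IndepFun (fun ω => (ζ₂ i ω, ε₂ i ω)) U P →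
      MemLp U 2 P → covMat P U (ε₂ i) = 0 := fun h hU =>
    covMat_eq_zero_of_indepFun (h.comp measurable_snd measurable_id).symm hU hε2
  have cζε : covMat P (ζ₂ i) (ε₂ i) = 0 :=
    covMat_eq_zero_of_indepFun (hM.indep_ζ₂ i) hζ2 hε2
  -- `Y` is a linear function of `(Z, φ*)` plus an uncorrelated residual
  set N : S → Fin m → ℝ := fun ω =>
    (θ₂.Λ * θ₂.B) *ᵥ δ ω + (θ₂.Λ *ᵥ ζ₂ i ω + ε₂ i ω) with hN
  set T : S → Fin m → ℝ := fun ω =>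
    (θ₂.Λ * θ₂.B) *ᵥ F ω + ((θ₂.Λ * θ₂.Γ + θ₂.K) *ᵥ Z i ω + N ω) with hT
  have hζε2 : MemLp (fun ω => θ₂.Λ *ᵥ ζ₂ i ω + ε₂ i ω) 2 P := (hζ2.mulVec θ₂.Λ).add hε2
  have hBδ2 := hδ2.mulVec (θ₂.Λ * θ₂.B)
  have hN2 : MemLp N 2 P := hBδ2.add hζε2
  have hKZ2 := hZ2.mulVec (θ₂.Λ * θ₂.Γ + θ₂.K)
  have hBF2 := hF2.mulVec (θ₂.Λ * θ₂.B)
  have hZN2 : MemLp (fun ω => (θ₂.Λ * θ₂.Γ + θ₂.K) *ᵥ Z i ω + N ω) 2 P := hKZ2.add hN2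
  have hT2 : MemLp T 2 P := hBF2.add hZN2
  have hY : Y i = fun ω => (θ₂.ν + θ₂.Λ *ᵥ θ₂.α) + T ω := by
    ext1 ω
    rw [hM.eq_Y i ω, hM.eq_η i ω]
    simp only [hT, hN, hδ, mulVec_add, mulVec_sub, add_mulVec, mulVec_mulVec]
    abel
  have cUN : ∀ {a : ℕ} {U : S → Fin a → ℝ}, IndepFun (fun ω => (ζ₂ i ω, ε₂ i ω)) U P →
      MemLp U 2 P → covMat P U δ = 0 → covMat P U N = 0 := by
    intro a U h hU h0
    rw [hN, covMat_add_right hU hBδ2 hζε2, covMat_add_right hU (hζ2.mulVec θ₂.Λ) hε2,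
      covMat_mulVec_right _ hU hδ2, covMat_mulVec_right _ hU hζ2, h0, cζ h hU, cε h hU]
    simp
  have cZN : covMat P (Z i) N = 0 := cUN hindZ hZ2 hZδ
  have cFN : covMat P F N = 0 := cUN hindF hF2 hFδ
  have cNN : covMat P N N = θ₂.Λ * θ₂.B * covMat P δ δ * (θ₂.Λ * θ₂.B)ᵀ
      + θ₂.Λ * θ₂.Ψ * θ₂.Λᵀ + θ₂.Ω := by
    have cζδ : covMat P (ζ₂ i) δ = 0 := by
      rw [← covMat_transpose, cζ hindδ hδ2, transpose_zero]
    have cεδ : covMat P (ε₂ i) δ = 0 := by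
      rw [← covMat_transpose, cε hindδ hδ2, transpose_zero]
    have cεζ : covMat P (ε₂ i) (ζ₂ i) = 0 := by
      rw [← covMat_transpose, cζε, transpose_zero]
    rw [hN, covMat_add_left hBδ2 hζε2 hN2, covMat_add_left (hζ2.mulVec θ₂.Λ) hε2 hN2,
      covMat_mulVec_left _ hδ2 hN2, covMat_mulVec_left _ hζ2 hN2]
    simp only [hN]
    rw [covMat_add_right hδ2 hBδ2 hζε2, covMat_add_right hδ2 (hζ2.mulVec θ₂.Λ) hε2,
      covMat_add_right hζ2 hBδ2 hζε2, covMat_add_right hζ2 (hζ2.mulVec θ₂.Λ) hε2,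
      covMat_add_right hε2 hBδ2 hζε2, covMat_add_right hε2 (hζ2.mulVec θ₂.Λ) hε2,
      covMat_mulVec_right _ hδ2 hδ2, covMat_mulVec_right _ hδ2 hζ2, covMat_mulVec_right _ hζ2 hδ2,
      covMat_mulVec_right _ hζ2 hζ2, covMat_mulVec_right _ hε2 hδ2, covMat_mulVec_right _ hε2 hζ2,
      cζ hindδ hδ2, cε hindδ hδ2, cζδ, cεδ, cεζ, cζε, hM.cov_ζ₂, hM.cov_ε₂]
    simp [Matrix.mul_assoc, add_assoc]
  have cT : ∀ {a : ℕ} {U : S → Fin a → ℝ}, MemLp U 2 P →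
      covMat P U T = covMat P U F * (θ₂.Λ * θ₂.B)ᵀ
        + (covMat P U (Z i) * (θ₂.Λ * θ₂.Γ + θ₂.K)ᵀ + covMat P U N) := by
    intro a U hU
    rw [hT, covMat_add_right hU hBF2 hZN2, covMat_add_right hU hKZ2 hN2,
      covMat_mulVec_right _ hU hF2, covMat_mulVec_right _ hU hZ2]
  have cUY : ∀ {a : ℕ} {U : S → Fin a → ℝ}, MemLp U 2 P →
      covMat P U (Y i) = covMat P U T := fun {a U} hU => by
    rw [hY, covMat_const_add_right _ _ hT2]
  have hY2 : MemLp (Y i) 2 P := by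
    have h1 : MemLp (fun _ : S => θ₂.ν + θ₂.Λ *ᵥ θ₂.α) 2 P := memLp_const _
    have h2 : MemLp (fun ω => (θ₂.ν + θ₂.Λ *ᵥ θ₂.α) + T ω) 2 P := h1.add hT2
    rw [hY]; exact h2
  have cFZ : covMat P F (Z i) = (covMat P (Z i) F)ᵀ := (covMat_transpose _ _).symm
  have cZY : covMat P (Z i) (Y i) = (stageTwoLimit P φ θ₂ (ξ i) (X i) (Z i)).covZY := by
    rw [cUY hZ2, cT hZ2, cZN]
    simp only [StageTwoFit.covZY, stageTwoLimit, ← hF, transpose_add, transpose_mul,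
      Matrix.mul_add, Matrix.add_mul, Matrix.mul_assoc, add_zero]
    abel
  have cFY : covMat P F (Y i) = (stageTwoLimit P φ θ₂ (ξ i) (X i) (Z i)).covφY := by
    rw [cUY hF2, cT hF2, cFN, cFZ]
    simp only [StageTwoFit.covφY, stageTwoLimit, ← hF, transpose_add, transpose_mul,
      Matrix.mul_add, Matrix.add_mul, Matrix.mul_assoc, add_zero]
    abel
  have cYY : covMat P (Y i) (Y i) = (stageTwoLimit P φ θ₂ (ξ i) (X i) (Z i)).covY := by
    have cTF : covMat P T F = (covMat P F T)ᵀ := (covMat_transpose _ _).symm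
    have cTZ : covMat P T (Z i) = (covMat P (Z i) T)ᵀ := (covMat_transpose _ _).symm
    have cTN : covMat P T N = (covMat P N T)ᵀ := (covMat_transpose _ _).symm
    have cNF : covMat P N F = 0 := by rw [← covMat_transpose, cFN, transpose_zero]
    have cNZ : covMat P N (Z i) = 0 := by rw [← covMat_transpose, cZN, transpose_zero]
    rw [cUY hY2, ← covMat_transpose, cUY hT2, cT hT2, cTF, cTZ, cTN, cT hF2, cT hZ2, cT hN2,
      cFN, cZN, cNF, cNZ, cNN, cFZ]
    have cFFt : (covMat P F F)ᵀ = covMat P F F := covMat_transpose _ _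
    have cZZt : (covMat P (Z i) (Z i))ᵀ = covMat P (Z i) (Z i) := covMat_transpose _ _
    have cδδt : (covMat P δ δ)ᵀ = covMat P δ δ := covMat_transpose _ _
    have cΨt : θ₂.Ψᵀ = θ₂.Ψ := by rw [← hM.cov_ζ₂ i, covMat_transpose]
    have cΩt : θ₂.Ωᵀ = θ₂.Ω := by rw [← hM.cov_ε₂ i, covMat_transpose]
    simp only [StageTwoFit.covY, StageTwoFit.covη, stageTwoLimit, ← hF, ← hδ, transpose_add,
      transpose_mul, transpose_transpose, Matrix.mul_add, Matrix.add_mul,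
      Matrix.mul_assoc, add_zero, zero_add, Matrix.zero_mul, cFFt, cZZt, cδδt,
      cΨt, cΩt]
    abel
  refine ⟨?_, ?_, hY2⟩
  · have hmY : meanVec P (Y i) = (θ₂.ν + θ₂.Λ *ᵥ θ₂.α) + ((θ₂.Λ * θ₂.B) *ᵥ meanVec P F
        + (θ₂.Λ * θ₂.Γ + θ₂.K) *ᵥ meanVec P (Z i)) := by
      rw [hY, meanVec_const_add _ hT2, hT, meanVec_add hBF2 hZN2, meanVec_add hKZ2 hN2, hN,
        meanVec_add hBδ2 hζε2, meanVec_add (hζ2.mulVec θ₂.Λ) hε2, meanVec_mulVec _ hF2,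
        meanVec_mulVec _ hZ2, meanVec_mulVec _ hδ2, meanVec_mulVec _ hζ2, hmδ, hM.mean_ζ₂,
        hM.mean_ε₂]
      simp
    ext ((a | a) | a)
    · rfl
    · exact (congrFun hmF a).symm
    · change (θ₂.ν + θ₂.Λ *ᵥ θ₂.α + (θ₂.Λ * θ₂.B) *ᵥ meanVec P (fun ω => φ (ξ i ω))
        + (θ₂.Λ * θ₂.Γ + θ₂.K) *ᵥ meanVec P (Z i)) a = meanVec P (Y i) a
      rw [hmY, hmF]
      simp only [add_assoc]
  · rw [covMat_stackData, cZY, cFY, cYY]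
    rfl

end IsNonlinearSEM

lemma IdentifiedAt.tendsto {T M A : Type*} [TopologicalSpace T] [TopologicalSpace M] {f : T → M}
    {Θ : Set T} {θ₀ : T} (hid : IdentifiedAt f Θ θ₀) {F : Filter A} {θ : A → T}
    (hθ : ∀ᶠ a in F, θ a ∈ Θ) (hf : Tendsto (fun a => f (θ a)) F (𝓝 (f θ₀))) :
    Tendsto θ F (𝓝 θ₀) := by
  intro U hU
  obtain ⟨W, hW, hWU⟩ := hid U hU
  have h2 : ∀ᶠ a in F, f (θ a) ∈ W := hf hW
  change ∀ᶠ a in F, θ a ∈ U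
  filter_upwards [hθ, h2] with a ha haW using hWU _ ha haW

section Averages

variable {ι κ : Type*}

lemma abs_average_mul_le (n : ℕ) (f g : ℕ → ℝ) :
    |(n : ℝ)⁻¹ * ∑ i ∈ Finset.range n, f i * g i| ≤
      √(((n : ℝ)⁻¹ * ∑ i ∈ Finset.range n, f i * f i) *
        ((n : ℝ)⁻¹ * ∑ i ∈ Finset.range n, g i * g i)) := by
  refine Real.abs_le_sqrt ?_
  have h := Finset.sum_mul_sq_le_sq_mul_sq (Finset.range n) f g
  simp only [pow_two] at h ⊢
  calc _ = ((n : ℝ)⁻¹ * (n : ℝ)⁻¹) * ((∑ i ∈ Finset.range n, f i * g i) *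
        ∑ i ∈ Finset.range n, f i * g i) := by ring
    _ ≤ ((n : ℝ)⁻¹ * (n : ℝ)⁻¹) * ((∑ i ∈ Finset.range n, f i * f i) *
        ∑ i ∈ Finset.range n, g i * g i) := by gcongr
    _ = _ := by ring

/-- Averages of products with a negligible perturbation are negligible. -/
lemma tendsto_avgOuter_zero {u : ℕ → ι → ℝ} {d : ℕ → ℕ → κ → ℝ} {A : Matrix ι ι ℝ}
    (hu : Tendsto (fun n => avgOuter n u u) atTop (𝓝 A))
    (hd : Tendsto (fun n => avgOuter n (d n) (d n)) atTop (𝓝 0)) :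
    Tendsto (fun n => avgOuter n u (d n)) atTop (𝓝 0) := by
  refine tendsto_matrix_nhds.2 fun a b => squeeze_zero_norm (fun n => abs_average_mul_le n _ _) ?_
  have h := ((tendsto_matrix_nhds.1 hu a a).mul (tendsto_matrix_nhds.1 hd b b)).sqrt
  rw [Matrix.zero_apply, mul_zero, Real.sqrt_zero] at h
  exact h

lemma avgOuter_add_left (n : ℕ) (u u' : ℕ → ι → ℝ) (v : ℕ → κ → ℝ) :
    avgOuter n (fun i => u i + u' i) v = avgOuter n u v + avgOuter n u' v := by
  ext a b
  simp [avgOuter, add_mul, Finset.sum_add_distrib, mul_add]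

lemma avgOuter_transpose (n : ℕ) (u : ℕ → ι → ℝ) (v : ℕ → κ → ℝ) :
    (avgOuter n u v)ᵀ = avgOuter n v u := by
  ext a b
  simp [avgOuter, mul_comm]

lemma avgOuter_add_right (n : ℕ) (u : ℕ → ι → ℝ) (v v' : ℕ → κ → ℝ) :
    avgOuter n u (fun i => v i + v' i) = avgOuter n u v + avgOuter n u v' := by
  ext a b
  simp [avgOuter, mul_add, Finset.sum_add_distrib]

lemma Filter.Tendsto.matrix_transpose {T : Type*} {f : Filter T} {M : T → Matrix ι κ ℝ}
    {A : Matrix ι κ ℝ} (hM : Tendsto M f (𝓝 A)) : Tendsto (fun t => (M t)ᵀ) f (𝓝 Aᵀ) :=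
  ((continuous_id.matrix_transpose (A := fun M : Matrix ι κ ℝ => M)).tendsto A).comp hM

lemma tendsto_avgOuter_add {u : ℕ → ι → ℝ} {d : ℕ → ℕ → ι → ℝ} {A : Matrix ι ι ℝ}
    (hu : Tendsto (fun n => avgOuter n u u) atTop (𝓝 A))
    (hd : Tendsto (fun n => avgOuter n (d n) (d n)) atTop (𝓝 0)) :
    Tendsto (fun n => avgOuter n (fun i => u i + d n i) (fun i => u i + d n i)) atTop (𝓝 A) := by
  have h := tendsto_avgOuter_zero hu hd
  have h' : Tendsto (fun n => avgOuter n (d n) u) atTop (𝓝 0) := by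
    simpa only [avgOuter_transpose, transpose_zero] using h.matrix_transpose
  simp only [avgOuter_add_left, avgOuter_add_right]
  simpa using (hu.add h').add (h.add hd)

end Averages

namespace IsNonlinearSEM

variable {S : Type*} [MeasurableSpace S] {P : Measure S} [IsProbabilityMeasure P]
  {p q r l h m : ℕ} {φ : (Fin q → ℝ) → Fin l → ℝ}
  {θ₁ : StageOneParam q r h} {θ₂ : StageTwoParam p l r m}
  {Z : ℕ → S → Fin r → ℝ} {ξ : ℕ → S → Fin q → ℝ} {X : ℕ → S → Fin h → ℝ}
  {η : ℕ → S → Fin p → ℝ} {Y : ℕ → S → Fin m → ℝ}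
  {ζ₁ : ℕ → S → Fin q → ℝ} {ε₁ : ℕ → S → Fin h → ℝ}
  {ζ₂ : ℕ → S → Fin p → ℝ} {ε₂ : ℕ → S → Fin m → ℝ}

lemma tendsto_avgOuter (hM : IsNonlinearSEM P φ θ₁ θ₂ Z ξ X η Y ζ₁ ε₁ ζ₂ ε₂)
    (hB : IsUnit (1 - θ₁.B)) {ι κ : Type*} [Fintype ι] [Fintype κ]
    {u : (Fin r → ℝ) × (Fin q → ℝ) × (Fin h → ℝ) × (Fin m → ℝ) → ι → ℝ}
    {v : (Fin r → ℝ) × (Fin q → ℝ) × (Fin h → ℝ) × (Fin m → ℝ) → κ → ℝ}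
    (hu : Measurable u) (hv : Measurable v)
    (hu2 : MemLp (fun ω => u (Z 0 ω, ξ 0 ω, X 0 ω, Y 0 ω)) 2 P)
    (hv2 : MemLp (fun ω => v (Z 0 ω, ξ 0 ω, X 0 ω, Y 0 ω)) 2 P)
    {A : Matrix ι κ ℝ} (hA : ∀ a b, ∫ ω, u (Z 0 ω, ξ 0 ω, X 0 ω, Y 0 ω) a *
      v (Z 0 ω, ξ 0 ω, X 0 ω, Y 0 ω) b ∂P = A a b) :
    ∀ᵐ ω ∂P, Tendsto (fun n => avgOuter n (fun i => u (Z i ω, ξ i ω, X i ω, Y i ω))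
      (fun i => v (Z i ω, ξ i ω, X i ω, Y i ω))) atTop (𝓝 A) := by
  have h1 : ∀ a b, ∀ᵐ ω ∂P, Tendsto (fun n => avgOuter n
      (fun i => u (Z i ω, ξ i ω, X i ω, Y i ω)) (fun i => v (Z i ω, ξ i ω, X i ω, Y i ω)) a b)
      atTop (𝓝 (A a b)) := by
    intro a b
    rw [← hA a b]
    exact hM.tendsto_average hB (g := fun t => u t a * v t b)
      (((measurable_pi_apply a).comp hu).mul ((measurable_pi_apply b).comp hv))
      ((hu2.eval a).integrable_mul (hv2.eval b))
  filter_upwards [ae_all_iff.2 fun a => ae_all_iff.2 fun b => h1 a b] with ω hω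
  exact tendsto_matrix_nhds.2 hω

/-- Strong consistency of the first-stage maximum likelihood estimator. -/
theorem stageOne_consistent (hM : IsNonlinearSEM P φ θ₁ θ₂ Z ξ X η Y ζ₁ ε₁ ζ₂ ε₂)
    {Θ₁ : Set (StageOneParam q r h)} (hΘ₁ : ∀ θ ∈ Θ₁, θ.Admissible) (hθ₁ : θ₁ ∈ Θ₁)
    (hid : IdentifiedAt StageOneParam.reducedForm Θ₁ θ₁)
    (hVZ : (covMat P (Z 0) (Z 0)).PosDef) {θhat : ℕ → S → StageOneParam q r h}
    (hstage : ∀ᵐ ω ∂P, ∀ᶠ n in atTop,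
      StageOneParam.IsMLE Θ₁ n (fun i => X i ω) (fun i => Z i ω) (θhat n ω)) :
    ∀ᵐ ω ∂P, Tendsto (fun n => θhat n ω) atTop (𝓝 θ₁) := by
  have hadm := hΘ₁ θ₁ hθ₁
  have hB := hadm.isUnit
  set μ := meanVec P (Z 0) with hμ
  set u : (Fin r → ℝ) × (Fin q → ℝ) × (Fin h → ℝ) × (Fin m → ℝ) → Fin h → ℝ :=
    fun t => t.2.2.1 - θ₁.condMean t.1 with hu
  set w : (Fin r → ℝ) → Unit ⊕ Fin r → ℝ := fun z => Sum.elim (fun _ => 1) (z - μ) with hw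
  set e : S → Fin h → ℝ := fun ω => X 0 ω - θ₁.condMean (Z 0 ω) with he
  have hum : Measurable u := by
    have : Continuous u := by rw [hu]; unfold StageOneParam.condMean; fun_prop
    exact this.measurable
  have hwm : Measurable w := by
    refine measurable_pi_lambda _ ?_
    rintro (a | a)
    · exact measurable_const
    · exact (measurable_pi_apply a).comp (measurable_id.sub_const μ)
  have hwm' : Measurable fun t : (Fin r → ℝ) × (Fin q → ℝ) × (Fin h → ℝ) × (Fin m → ℝ) => w t.1 :=
    hwm.comp measurable_fst
  have hee : e = fun ω => (θ₁.Λ * (1 - θ₁.B)⁻¹) *ᵥ ζ₁ 0 ω + (1 : Matrix _ _ ℝ) *ᵥ ε₁ 0 ω := by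
    ext1 ω; rw [he]; dsimp only; rw [hM.X_sub_condMean hB, one_mulVec]
  have he2 : MemLp e 2 P := by
    have h1 : MemLp (fun ω => (θ₁.Λ * (1 - θ₁.B)⁻¹) *ᵥ ζ₁ 0 ω) 2 P := (hM.memLp_ζ₁ 0).mulVec _
    have h2 : MemLp (fun ω => (1 : Matrix (Fin h) (Fin h) ℝ) *ᵥ ε₁ 0 ω) 2 P :=
      (hM.memLp_ε₁ 0).mulVec _
    rw [hee]
    exact MemLp.add h1 h2
  have hme : meanVec P e = 0 := by rw [hee, hM.meanVec_residuals]
  have hce : covMat P e e = θ₁.cov := by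
    rw [hee, hM.covMat_residuals hadm.posSemidef_Ψ hadm.posSemidef_Ω, StageOneParam.cov,
      StageOneParam.latentCov]
    simp [transpose_mul, Matrix.mul_assoc]
  have hceZ : covMat P e (Z 0) = 0 := by
    refine covMat_eq_zero_of_indepFun ?_ he2 (hM.memLp_Z 0)
    have h1 : IndepFun (fun ω => (ζ₁ 0 ω, ε₁ 0 ω)) (Z 0) P :=
      ((hM.indep_Z 0).comp measurable_id (ψ := fun t => (t.1, t.2.1)) (by fun_prop)).symm
    rw [hee]
    exact h1.comp (φ := fun t => (θ₁.Λ * (1 - θ₁.B)⁻¹) *ᵥ t.1 + (1 : Matrix _ _ ℝ) *ᵥ t.2)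
      (by fun_prop : Continuous _).measurable measurable_id
  have hZc2 : MemLp (fun ω => Z 0 ω - μ) 2 P := (hM.memLp_Z 0).sub (memLp_const μ)
  have hw2 : MemLp (fun ω => w (Z 0 ω)) 2 P := by
    refine MemLp.of_eval ?_
    rintro (a | a)
    · exact memLp_const 1
    · exact hZc2.eval a
  have hZc : (fun ω => Z 0 ω - μ) = fun ω => (-μ) + Z 0 ω := by ext1 ω; abel
  have hmZc : meanVec P (fun ω => Z 0 ω - μ) = 0 := by
    rw [hZc, meanVec_const_add _ (hM.memLp_Z 0), ← hμ, neg_add_cancel]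
  have hcZc : covMat P (fun ω => Z 0 ω - μ) (fun ω => Z 0 ω - μ) = covMat P (Z 0) (Z 0) := by
    simp only [hZc]
    rw [covMat_const_add_left _ _ (hM.memLp_Z 0), covMat_const_add_right _ _ (hM.memLp_Z 0)]
  have hceZc : covMat P e (fun ω => Z 0 ω - μ) = 0 := by
    rw [hZc, covMat_const_add_right _ _ (hM.memLp_Z 0), hceZ]
  have hS := hM.tendsto_avgOuter hB hum hum he2 he2 (A := θ₁.cov) fun a b => by
    have := covMat_apply_eq_sub he2 he2 a b
    rw [hme, hce] at this
    rw [Pi.zero_apply, zero_mul, sub_zero] at this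
    exact this.symm
  have hC := hM.tendsto_avgOuter hB hum hwm' he2 hw2 (A := 0) fun a b => by
    rcases b with b | b
    · have h1 : ∫ ω, e ω a ∂P = 0 := congrFun hme a
      simpa [hw] using h1
    · have h1 := covMat_apply_eq_sub he2 hZc2 a b
      rw [hme, hceZc, Pi.zero_apply, zero_mul, sub_zero] at h1
      exact h1.symm
  set W₀ : Matrix (Unit ⊕ Fin r) (Unit ⊕ Fin r) ℝ := fromBlocks 1 0 0 (covMat P (Z 0) (Z 0))
    with hW₀
  have hW := hM.tendsto_avgOuter hB hwm' hwm' hw2 hw2 (A := W₀) fun a b => by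
    rcases a with a | a <;> rcases b with b | b
    · simp [hw, hW₀]
    · have h1 : ∫ ω, (Z 0 ω - μ) b ∂P = 0 := congrFun hmZc b
      simpa [hw, hW₀] using h1
    · have h1 : ∫ ω, (Z 0 ω - μ) a ∂P = 0 := congrFun hmZc a
      simpa [hw, hW₀] using h1
    · have h1 := covMat_apply_eq_sub hZc2 hZc2 a b
      rw [hmZc, hcZc, Pi.zero_apply, zero_mul, sub_zero] at h1
      exact h1.symm
  have hW₀pos : W₀.PosDef := by
    have hherm : W₀.IsHermitian := by
      rw [hW₀]
      exact IsHermitian.fromBlocks isHermitian_one (by simp) hVZ.isHermitian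
    refine .of_dotProduct_mulVec_pos hherm fun x hx => ?_
    obtain ⟨a, b, rfl⟩ : ∃ a b, x = Sum.elim a b := ⟨_, _, (Sum.elim_comp_inl_inr x).symm⟩
    rw [hW₀, fromBlocks_mulVec, star_trivial]
    simp only [Sum.elim_comp_inl, Sum.elim_comp_inr, one_mulVec, zero_mulVec, add_zero, zero_add,
      sumElim_dotProduct_sumElim]
    have ha : 0 ≤ a ⬝ᵥ a := Finset.sum_nonneg fun i _ => mul_self_nonneg (a i)
    have hb := hVZ.posSemidef.dotProduct_mulVec_nonneg b
    rw [star_trivial] at hb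
    by_cases hb0 : b = 0
    · have ha0 : a ≠ 0 := by
        rintro rfl
        apply hx
        subst hb0
        ext (i | i) <;> rfl
      have : a ⬝ᵥ a ≠ 0 := fun h0 => ha0 (dotProduct_self_eq_zero.1 h0)
      have : 0 < a ⬝ᵥ a := lt_of_le_of_ne ha this.symm
      linarith
    · have := hVZ.dotProduct_mulVec_pos hb0
      rw [star_trivial] at this
      linarith
  filter_upwards [hstage, hS, hC, hW] with ω hω hSω hCω hWω
  set v : ℕ → Fin h → ℝ := fun n => (θhat n ω).intercept - θ₁.intercept
    + ((θhat n ω).slope - θ₁.slope) *ᵥ μ with hv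
  set D : ℕ → Matrix (Fin h) (Unit ⊕ Fin r) ℝ := fun n =>
    fromCols (replicateCol Unit (v n)) ((θhat n ω).slope - θ₁.slope) with hD
  have hres : ∀ n i, u (Z i ω, ξ i ω, X i ω, Y i ω) - D n *ᵥ w (Z i ω) =
      X i ω - (θhat n ω).condMean (Z i ω) := by
    intro n i
    have h1 : replicateCol Unit (v n) *ᵥ (fun _ => 1) = v n := by
      ext a; simp [mulVec, dotProduct]
    rw [hD, hw]
    dsimp only
    rw [fromCols_mulVec_sumElim, h1, hv, hu]
    simp only [StageOneParam.condMean, mulVec_sub, sub_mulVec]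
    abel
  have hmain := tendsto_of_gaussian_logLik_le hadm.posDef_cov hW₀pos
    (e := fun _ i => u (Z i ω, ξ i ω, X i ω, Y i ω)) (w := fun i => w (Z i ω)) hSω hCω hWω
    (A := fun n => (θhat n ω).cov) (D := D)
    (hω.mono fun n hn => (hΘ₁ _ hn.1).posDef_cov) (by
      filter_upwards [hω] with n hn
      have h1 := hn.2 θ₁ hθ₁
      simp only [StageOneParam.logLik] at h1
      simp only [hres]
      simp only [gaussianLogDensity_eq_zero_mean (StageOneParam.condMean _ _)] at h1
      exact h1)
  obtain ⟨hA, hD0⟩ := hmain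
  have hslope : Tendsto (fun n => (θhat n ω).slope) atTop (𝓝 θ₁.slope) := by
    refine tendsto_matrix_nhds.2 fun a b => ?_
    have h1 := tendsto_matrix_nhds.1 hD0 a (Sum.inr b)
    simp only [hD, fromCols_apply_inr, Matrix.sub_apply, Matrix.zero_apply] at h1
    simpa using h1.add_const (θ₁.slope a b)
  have hv0 : Tendsto v atTop (𝓝 0) := by
    refine tendsto_pi_nhds.2 fun a => ?_
    have h1 := tendsto_matrix_nhds.1 hD0 a (Sum.inl ())
    simpa [hD] using h1
  have hint : Tendsto (fun n => (θhat n ω).intercept) atTop (𝓝 θ₁.intercept) := by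
    have h1 : Tendsto (fun n => ((θhat n ω).slope - θ₁.slope) *ᵥ μ) atTop (𝓝 0) := by
      simpa using (hslope.sub_const θ₁.slope).matrix_mulVec (tendsto_const_nhds (x := μ))
    have h2 := (hv0.sub h1).add_const θ₁.intercept
    simpa [hv] using h2
  exact hid.tendsto (hω.mono fun n hn => hn.1) (hint.prodMk_nhds (hslope.prodMk_nhds hA))

end IsNonlinearSEM

lemma Filter.Tendsto.matrix_mul {T ι κ σ : Type*} [Fintype κ] {f : Filter T}
    {M : T → Matrix ι κ ℝ} {N : T → Matrix κ σ ℝ} {A : Matrix ι κ ℝ} {B : Matrix κ σ ℝ}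
    (hM : Tendsto M f (𝓝 A)) (hN : Tendsto N f (𝓝 B)) :
    Tendsto (fun t => M t * N t) f (𝓝 (A * B)) := by
  have h : Continuous fun x : Matrix ι κ ℝ × Matrix κ σ ℝ => x.1 * x.2 :=
    continuous_fst.matrix_mul continuous_snd
  exact (h.tendsto (A, B)).comp (hM.prodMk_nhds hN)

namespace StageOneParam

variable {q r h l : ℕ}

instance : SecondCountableTopology (StageOneParam q r h) :=
  haveI (a b : ℕ) : SecondCountableTopology (Matrix (Fin a) (Fin b) ℝ) :=
    inferInstanceAs (SecondCountableTopology (Fin a → Fin b → ℝ))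
  (Topology.IsInducing.mk rfl :
    IsInducing fun θ : StageOneParam q r h =>
      (θ.α, θ.B, θ.Γ, θ.ν, θ.Λ, θ.K, θ.Ω, θ.Ψ)).secondCountableTopology

lemma tendsto_components {T : Type*} {f : Filter T} {θ : T → StageOneParam q r h}
    {θ₀ : StageOneParam q r h} (hθ : Tendsto θ f (𝓝 θ₀)) :
    Tendsto (fun t => (θ t).α) f (𝓝 θ₀.α) ∧ Tendsto (fun t => (θ t).B) f (𝓝 θ₀.B) ∧
      Tendsto (fun t => (θ t).Γ) f (𝓝 θ₀.Γ) ∧ Tendsto (fun t => (θ t).ν) f (𝓝 θ₀.ν) ∧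
      Tendsto (fun t => (θ t).Λ) f (𝓝 θ₀.Λ) ∧ Tendsto (fun t => (θ t).K) f (𝓝 θ₀.K) ∧
      Tendsto (fun t => (θ t).Ω) f (𝓝 θ₀.Ω) ∧ Tendsto (fun t => (θ t).Ψ) f (𝓝 θ₀.Ψ) := by
  have h0 : Continuous fun θ : StageOneParam q r h =>
      (θ.α, θ.B, θ.Γ, θ.ν, θ.Λ, θ.K, θ.Ω, θ.Ψ) := continuous_induced_dom
  have h1 := (h0.tendsto θ₀).comp hθ
  exact ⟨h1.fst_nhds, h1.snd_nhds.fst_nhds, h1.snd_nhds.snd_nhds.fst_nhds,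
    h1.snd_nhds.snd_nhds.snd_nhds.fst_nhds, h1.snd_nhds.snd_nhds.snd_nhds.snd_nhds.fst_nhds,
    h1.snd_nhds.snd_nhds.snd_nhds.snd_nhds.snd_nhds.fst_nhds,
    h1.snd_nhds.snd_nhds.snd_nhds.snd_nhds.snd_nhds.snd_nhds.fst_nhds,
    h1.snd_nhds.snd_nhds.snd_nhds.snd_nhds.snd_nhds.snd_nhds.snd_nhds⟩

variable {T : Type*} {f : Filter T} {θ : T → StageOneParam q r h} {θ₀ : StageOneParam q r h}

lemma tendsto_inv_one_sub (hθ : Tendsto θ f (𝓝 θ₀)) (hB : IsUnit (1 - θ₀.B)) :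
    Tendsto (fun t => (1 - (θ t).B)⁻¹) f (𝓝 (1 - θ₀.B)⁻¹) := by
  have h1 : Tendsto (fun t => 1 - (θ t).B) f (𝓝 (1 - θ₀.B)) :=
    tendsto_const_nhds.sub (tendsto_components hθ).2.1
  exact Tendsto.comp (continuousAt_inv_of_isUnit hB) h1

lemma tendsto_latentCov (hθ : Tendsto θ f (𝓝 θ₀)) (hB : IsUnit (1 - θ₀.B)) :
    Tendsto (fun t => (θ t).latentCov) f (𝓝 θ₀.latentCov) := by
  have h1 := tendsto_inv_one_sub hθ hB
  obtain ⟨-, -, -, -, -, -, -, hΨ⟩ := tendsto_components hθ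
  exact (h1.matrix_mul hΨ).matrix_mul h1.matrix_transpose

lemma tendsto_cov (hθ : Tendsto θ f (𝓝 θ₀)) (hB : IsUnit (1 - θ₀.B)) :
    Tendsto (fun t => (θ t).cov) f (𝓝 θ₀.cov) := by
  obtain ⟨-, -, -, -, hΛ, -, hΩ, -⟩ := tendsto_components hθ
  exact ((hΛ.matrix_mul (tendsto_latentCov hθ hB)).matrix_mul hΛ.matrix_transpose).add hΩ

lemma tendsto_gain (hθ : Tendsto θ f (𝓝 θ₀)) (hadm : θ₀.Admissible) :
    Tendsto (fun t => (θ t).latentCov * (θ t).Λᵀ * (θ t).cov⁻¹) f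
      (𝓝 (θ₀.latentCov * θ₀.Λᵀ * θ₀.cov⁻¹)) := by
  obtain ⟨-, -, -, -, hΛ, -, -, -⟩ := tendsto_components hθ
  have h2 : Tendsto (fun t => (θ t).cov⁻¹) f (𝓝 θ₀.cov⁻¹) :=
    Tendsto.comp (continuousAt_inv_of_isUnit hadm.posDef_cov.isUnit) (tendsto_cov hθ hadm.isUnit)
  exact ((tendsto_latentCov hθ hadm.isUnit).matrix_mul hΛ.matrix_transpose).matrix_mul h2

lemma tendsto_posteriorCov (hθ : Tendsto θ f (𝓝 θ₀)) (hadm : θ₀.Admissible) :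
    Tendsto (fun t => (θ t).posteriorCov) f (𝓝 θ₀.posteriorCov) := by
  obtain ⟨-, -, -, -, hΛ, -, -, -⟩ := tendsto_components hθ
  have h1 := tendsto_latentCov hθ hadm.isUnit
  exact h1.sub (((tendsto_gain hθ hadm).matrix_mul hΛ).matrix_mul h1)

lemma tendsto_posteriorMean (hθ : Tendsto θ f (𝓝 θ₀)) (hadm : θ₀.Admissible)
    (x : Fin h → ℝ) (z : Fin r → ℝ) :
    Tendsto (fun t => (θ t).posteriorMean x z) f (𝓝 (θ₀.posteriorMean x z)) := by
  obtain ⟨hα, -, hΓ, hν, hΛ, hK, -, -⟩ := tendsto_components hθ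
  have hI := tendsto_inv_one_sub hθ hadm.isUnit
  have hz : Tendsto (fun _ : T => z) f (𝓝 z) := tendsto_const_nhds
  have h1 : Tendsto (fun t => (θ t).latentMean z) f (𝓝 (θ₀.latentMean z)) :=
    hI.matrix_mulVec (hα.add (hΓ.matrix_mulVec hz))
  have h2 : Tendsto (fun t => (θ t).condMean z) f (𝓝 (θ₀.condMean z)) :=
    (hν.add (hΛ.matrix_mulVec (hI.matrix_mulVec hα))).add
      ((((hΛ.matrix_mul hI).matrix_mul hΓ).add hK).matrix_mulVec hz)
  exact h1.add ((tendsto_gain hθ hadm).matrix_mulVec (tendsto_const_nhds.sub h2))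

lemma Admissible.isHermitian_posteriorCov (hadm : θ₀.Admissible) :
    θ₀.posteriorCov.IsHermitian := by
  have hΨ : θ₀.Ψᵀ = θ₀.Ψ := by
    simpa [IsHermitian, conjTranspose_eq_transpose_of_trivial] using hadm.posSemidef_Ψ.isHermitian
  have hc : θ₀.covᵀ = θ₀.cov := by
    simpa [IsHermitian, conjTranspose_eq_transpose_of_trivial] using hadm.posDef_cov.isHermitian
  have hL : θ₀.latentCovᵀ = θ₀.latentCov := by
    simp [latentCov, transpose_mul, hΨ, Matrix.mul_assoc]
  rw [IsHermitian, conjTranspose_eq_transpose_of_trivial, posteriorCov]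
  simp [transpose_mul, transpose_nonsing_inv, hL, hc, Matrix.mul_assoc]

/-- Near a parameter with nonsingular residual covariances, predictions are continuous
in the parameter wherever `φ` is square integrable under the conditional distribution at that
parameter. -/
lemma exists_continuousOn_predict {φ : (Fin q → ℝ) → Fin l → ℝ} (hφ : Measurable φ)
    {Θ : Set (StageOneParam q r h)} (hΘ : ∀ θ ∈ Θ, θ.Admissible) (hθ₀ : θ₀.Admissible)
    (hC₀ : θ₀.posteriorCov.PosDef) :
    ∃ U ∈ 𝓝 θ₀, ∀ x z, (∀ j, Integrable (fun u => φ (WithLp.ofLp u) j ^ 2)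
      (multivariateGaussian (WithLp.toLp 2 (θ₀.posteriorMean x z)) θ₀.posteriorCov)) →
      ContinuousOn (fun θ => predict φ θ x z) (U ∩ Θ) := by
  have hid : Tendsto (fun θ : StageOneParam q r h => θ) (𝓝[Θ] θ₀) (𝓝 θ₀) := nhdsWithin_le_nhds
  have hC := tendsto_posteriorCov hid hθ₀
  have hmem : ∀ᶠ θ in 𝓝[Θ] θ₀, θ.Admissible :=
    eventually_nhdsWithin_of_forall hΘ
  have hP := hC₀.eventually_posDef hC (hmem.mono fun θ hθ => hθ.isHermitian_posteriorCov)
  have hinv : Tendsto (fun θ : StageOneParam q r h => (θ.posteriorCov)⁻¹) (𝓝[Θ] θ₀)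
      (𝓝 θ₀.posteriorCov⁻¹) := Tendsto.comp (continuousAt_inv_of_isUnit hC₀.isUnit) hC
  have hE : Tendsto (fun θ : StageOneParam q r h => (2 : ℝ) • (θ.posteriorCov)⁻¹
      - θ₀.posteriorCov⁻¹) (𝓝[Θ] θ₀) (𝓝 θ₀.posteriorCov⁻¹) := by
    have h1 := (hinv.const_smul (2 : ℝ)).sub_const θ₀.posteriorCov⁻¹
    rwa [two_smul, add_sub_cancel_right] at h1
  have hEP := hC₀.inv.eventually_posDef hE (hmem.mono fun θ hθ =>
    (IsHermitian.smul hθ.isHermitian_posteriorCov.inv (by simp [IsSelfAdjoint])).sub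
      hC₀.inv.isHermitian)
  set U : Set (StageOneParam q r h) := {θ | θ ∈ Θ → θ.posteriorCov.PosDef ∧
    ((2 : ℝ) • (θ.posteriorCov)⁻¹ - θ₀.posteriorCov⁻¹).PosDef} with hU
  refine ⟨U, eventually_nhdsWithin_iff.1 (hP.and hEP), fun x z hint θ hθ => ?_⟩
  obtain ⟨hθU, hθΘ⟩ := hθ
  obtain ⟨h1, h2⟩ := hθU hθΘ
  have hid' : Tendsto (fun θ : StageOneParam q r h => θ) (𝓝[U ∩ Θ] θ) (𝓝 θ) := nhdsWithin_le_nhds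
  refine tendsto_pi_nhds.2 fun j => ?_
  refine tendsto_integral_multivariateGaussian (f := fun u => φ u j)
    ((measurable_pi_apply j).comp hφ) hC₀ (hint j) h1 h2
    (tendsto_posteriorMean hid' (hΘ θ hθΘ) x z) (tendsto_posteriorCov hid' (hΘ θ hθΘ))
    (eventually_nhdsWithin_of_forall fun θ' hθ' => (hθ'.1 hθ'.2).1)

end StageOneParam

/-- A locally uniform strong law of large numbers: averages of `g (θ n)` tend to zero when
`θ n` tends to a point `θ₀` with `g θ₀ = 0`. -/
lemma ae_tendsto_average_zero_of_continuousOn {S D T : Type*} [MeasurableSpace S] {P : Measure S}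
    [MeasurableSpace D] [TopologicalSpace T] [SecondCountableTopology T] {d : ℕ → S → D}
    (hident : ∀ i, IdentDistrib (d i) (d 0) P P)
    (hslln : ∀ f : D → ℝ, Measurable f → Integrable (fun ω => f (d 0 ω)) P → ∀ᵐ ω ∂P,
      Tendsto (fun n : ℕ => (n : ℝ)⁻¹ * ∑ i ∈ Finset.range n, f (d i ω)) atTop
        (𝓝 (∫ ω, f (d 0 ω) ∂P)))
    {g : T → D → ℝ} (hg : ∀ θ, Measurable (g θ)) (hg0 : ∀ θ x, 0 ≤ g θ x)
    {s : Set T} {θ₀ : T} (hs : θ₀ ∈ s) (hgθ₀ : ∀ x, g θ₀ x = 0)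
    (hcont : ∀ i, ∀ᵐ ω ∂P, ContinuousOn (fun θ => g θ (d i ω)) s)
    {G : S → ℝ} (hG : Integrable G P) (hdom : ∀ᵐ ω ∂P, ∀ θ ∈ s, g θ (d 0 ω) ≤ G ω) :
    ∀ᵐ ω ∂P, ∀ θ : ℕ → T, Tendsto θ atTop (𝓝 θ₀) → (∀ᶠ n in atTop, θ n ∈ s) →
      Tendsto (fun n : ℕ => (n : ℝ)⁻¹ * ∑ i ∈ Finset.range n, g (θ n) (d i ω)) atTop (𝓝 0) := by
  obtain ⟨N, hN⟩ := (𝓝 θ₀).exists_antitone_basis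
  have hsep : ∀ k, ∃ c : Set T, c ⊆ N k ∩ s ∧ c.Countable ∧ N k ∩ s ⊆ closure c := by
    intro k
    obtain ⟨b, hb, hbd⟩ := TopologicalSpace.exists_countable_dense ↥(N k ∩ s)
    exact ⟨Subtype.val '' b, Subtype.coe_image_subset _ _, hb.image _, Subtype.dense_iff.1 hbd⟩
  choose c hcs hcc hcd using hsep
  set H : ℕ → D → ENNReal := fun k x => ⨆ θ ∈ c k, ENNReal.ofReal (g θ x) with hH
  have hHm : ∀ k, Measurable (H k) := fun k =>
    Measurable.biSup (c k) (hcc k) fun θ _ => (hg θ).ennreal_ofReal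
  have hhm : ∀ k, Measurable fun x => (H k x).toReal := fun k => (hHm k).ennreal_toReal
  have hle : ∀ x, ContinuousOn (fun θ => g θ x) s → ∀ k, ∀ θ ∈ N k ∩ s,
      ENNReal.ofReal (g θ x) ≤ H k x := by
    intro x hx k θ hθ
    have h1 : ContinuousWithinAt (fun θ => ENNReal.ofReal (g θ x)) (c k) θ :=
      (ENNReal.continuous_ofReal.tendsto _).comp
        ((hx θ hθ.2).mono ((hcs k).trans Set.inter_subset_right))
    have : (𝓝[c k] θ).NeBot := mem_closure_iff_nhdsWithin_neBot.1 (hcd k hθ)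
    refine le_of_tendsto h1 (eventually_nhdsWithin_of_forall fun θ' hθ' => ?_)
    exact le_biSup (fun θ => ENNReal.ofReal (g θ x)) hθ'
  have hbound : ∀ᵐ ω ∂P, ∀ k, H k (d 0 ω) ≤ ENNReal.ofReal |G ω| := by
    filter_upwards [hdom] with ω hω k
    exact iSup₂_le fun θ hθ => ENNReal.ofReal_le_ofReal
      ((hω θ (hcs k hθ).2).trans (le_abs_self _))
  have hbound' : ∀ᵐ ω ∂P, ∀ k, ‖(H k (d 0 ω)).toReal‖ ≤ |G ω| := by
    filter_upwards [hbound] with ω hω k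
    rw [Real.norm_of_nonneg ENNReal.toReal_nonneg]
    exact ENNReal.toReal_le_of_le_ofReal (abs_nonneg _) (hω k)
  have hd0 : AEMeasurable (d 0) P := (hident 0).aemeasurable_fst
  have hmeas : ∀ k, AEStronglyMeasurable (fun ω => (H k (d 0 ω)).toReal) P := fun k =>
    ((hhm k).comp_aemeasurable hd0).aestronglyMeasurable
  have hint : ∀ k, Integrable (fun ω => (H k (d 0 ω)).toReal) P := fun k =>
    hG.abs.mono' (hmeas k) (hbound'.mono fun ω hω => hω k)
  have hlim : ∀ᵐ ω ∂P, Tendsto (fun k => (H k (d 0 ω)).toReal) atTop (𝓝 0) := by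
    filter_upwards [hcont 0] with ω hω
    rw [Metric.tendsto_atTop]
    intro ε hε
    have h1 : ∀ᶠ θ in 𝓝[s] θ₀, g θ (d 0 ω) < ε / 2 := by
      have h2 := hω θ₀ hs
      rw [ContinuousWithinAt, hgθ₀] at h2
      exact h2.eventually_lt_const (half_pos hε)
    obtain ⟨k, -, hk⟩ := hN.toHasBasis.mem_iff.1 (eventually_nhdsWithin_iff.1 h1)
    refine ⟨k, fun k' hk' => ?_⟩
    rw [Real.dist_eq, sub_zero, abs_of_nonneg ENNReal.toReal_nonneg]
    refine lt_of_le_of_lt (ENNReal.toReal_le_of_le_ofReal (half_pos hε).le ?_) (half_lt_self hε)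
    exact iSup₂_le fun θ hθ => ENNReal.ofReal_le_ofReal
      (hk (hN.antitone hk' (hcs k' hθ).1) (hcs k' hθ).2).le
  have hE : Tendsto (fun k => ∫ ω, (H k (d 0 ω)).toReal ∂P) atTop (𝓝 0) := by
    simpa using tendsto_integral_of_dominated_convergence (fun ω => |G ω|) hmeas hG.abs
      (fun k => hbound'.mono fun ω hω => hω k) hlim
  have hfin : ∀ i, ∀ᵐ ω ∂P, ∀ k, H k (d i ω) ≠ ⊤ := by
    intro i
    rw [ae_all_iff]
    intro k
    have hset : MeasurableSet {x | H k x ≠ ⊤} :=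
      ((hHm k) (measurableSet_singleton ⊤)).compl
    refine (hident i).symm.ae_snd hset ?_
    filter_upwards [hbound] with ω hω
    exact ne_top_of_le_ne_top ENNReal.ofReal_ne_top (hω k)
  filter_upwards [ae_all_iff.2 hcont, ae_all_iff.2 hfin,
    ae_all_iff.2 fun k => hslln _ (hhm k) (hint k)] with ω hc hf hl θ hθ hθs
  rw [Metric.tendsto_atTop]
  intro ε hε
  obtain ⟨k, hk⟩ := (hE.eventually_lt_const hε).exists
  obtain ⟨n₀, hn₀⟩ := eventually_atTop.1 (((hl k).eventually_lt_const hk).and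
    (hθs.and (hθ.eventually (hN.mem k))))
  refine ⟨n₀, fun n hn => ?_⟩
  obtain ⟨h1, h2, h3⟩ := hn₀ n hn
  have h4 : 0 ≤ (n : ℝ)⁻¹ * ∑ i ∈ Finset.range n, g (θ n) (d i ω) :=
    mul_nonneg (by positivity) (Finset.sum_nonneg fun i _ => hg0 _ _)
  rw [Real.dist_eq, sub_zero, abs_of_nonneg h4]
  refine lt_of_le_of_lt ?_ h1
  gcongr with i _
  rw [← ENNReal.ofReal_le_iff_le_toReal (hf i k)]
  exact hle _ (hc i) k (θ n) ⟨h3, h2⟩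

namespace StageTwoFit

variable {p l r m : ℕ}

lemma tendsto_components {T : Type*} {f : Filter T} {τ : T → StageTwoFit p l r m}
    {τ₀ : StageTwoFit p l r m} (hτ : Tendsto τ f (𝓝 τ₀)) :
    Tendsto (fun t => (τ t).θ.α) f (𝓝 τ₀.θ.α) ∧ Tendsto (fun t => (τ t).θ.B) f (𝓝 τ₀.θ.B) ∧
      Tendsto (fun t => (τ t).θ.Γ) f (𝓝 τ₀.θ.Γ) ∧ Tendsto (fun t => (τ t).θ.ν) f (𝓝 τ₀.θ.ν) ∧
      Tendsto (fun t => (τ t).θ.Λ) f (𝓝 τ₀.θ.Λ) ∧ Tendsto (fun t => (τ t).θ.K) f (𝓝 τ₀.θ.K) ∧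
      Tendsto (fun t => (τ t).θ.Ω) f (𝓝 τ₀.θ.Ω) ∧ Tendsto (fun t => (τ t).θ.Ψ) f (𝓝 τ₀.θ.Ψ) := by
  have h0 : Continuous fun τ : StageTwoFit p l r m =>
      (τ.θ, τ.μZ, τ.μφ, τ.VZ, τ.VZφ, τ.Vφ) := continuous_induced_dom
  have h0' : Continuous fun θ : StageTwoParam p l r m =>
      (θ.α, θ.B, θ.Γ, θ.ν, θ.Λ, θ.K, θ.Ω, θ.Ψ) := continuous_induced_dom
  have h1 := (h0'.tendsto _).comp ((h0.tendsto τ₀).comp hτ).fst_nhds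
  exact ⟨h1.fst_nhds, h1.snd_nhds.fst_nhds, h1.snd_nhds.snd_nhds.fst_nhds,
    h1.snd_nhds.snd_nhds.snd_nhds.fst_nhds, h1.snd_nhds.snd_nhds.snd_nhds.snd_nhds.fst_nhds,
    h1.snd_nhds.snd_nhds.snd_nhds.snd_nhds.snd_nhds.fst_nhds,
    h1.snd_nhds.snd_nhds.snd_nhds.snd_nhds.snd_nhds.snd_nhds.fst_nhds,
    h1.snd_nhds.snd_nhds.snd_nhds.snd_nhds.snd_nhds.snd_nhds.snd_nhds⟩

end StageTwoFit

namespace IsNonlinearSEM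

variable {S : Type*} [MeasurableSpace S] {P : Measure S} [IsProbabilityMeasure P]
  {p q r l h m : ℕ} {φ : (Fin q → ℝ) → Fin l → ℝ}
  {θ₁ : StageOneParam q r h} {θ₂ : StageTwoParam p l r m}
  {Z : ℕ → S → Fin r → ℝ} {ξ : ℕ → S → Fin q → ℝ} {X : ℕ → S → Fin h → ℝ}
  {η : ℕ → S → Fin p → ℝ} {Y : ℕ → S → Fin m → ℝ}
  {ζ₁ : ℕ → S → Fin q → ℝ} {ε₁ : ℕ → S → Fin h → ℝ}
  {ζ₂ : ℕ → S → Fin p → ℝ} {ε₂ : ℕ → S → Fin m → ℝ}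

lemma measurable_predict_data (hφ : Measurable φ) (θ : StageOneParam q r h) :
    Measurable fun t : (Fin r → ℝ) × (Fin q → ℝ) × (Fin h → ℝ) × (Fin m → ℝ) =>
      StageOneParam.predict φ θ t.2.2.1 t.1 := by
  have h1 : Measurable fun t : (Fin r → ℝ) × (Fin q → ℝ) × (Fin h → ℝ) × (Fin m → ℝ) =>
    (t.2.2.1, t.1) := measurable_snd.snd.fst.prodMk measurable_fst
  have h2 := (StageOneParam.measurable_predict hφ θ).comp h1
  simp only [Function.comp_def] at h2
  exact h2

lemma measurable_stackData_predict (hφ : Measurable φ) (θ : StageOneParam q r h) :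
    Measurable fun t : (Fin r → ℝ) × (Fin q → ℝ) × (Fin h → ℝ) × (Fin m → ℝ) =>
      stackData t.1 (StageOneParam.predict φ θ t.2.2.1 t.1) t.2.2.2 := by
  refine measurable_pi_lambda _ ?_
  rintro ((a | a) | a)
  · exact (measurable_pi_apply a).comp measurable_fst
  · exact (measurable_pi_apply a).comp (measurable_predict_data hφ θ)
  · exact (measurable_pi_apply a).comp measurable_snd.snd.snd

/-- The mean squared difference of the predictions at a consistent sequence of first-stage
estimates and at the true parameter tends to zero. -/
theorem tendsto_average_predict_sub (hM : IsNonlinearSEM P φ θ₁ θ₂ Z ξ X η Y ζ₁ ε₁ ζ₂ ε₂)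
    {Θ₁ : Set (StageOneParam q r h)} (hΘ₁ : ∀ θ ∈ Θ₁, θ.Admissible) (hθ₁ : θ₁ ∈ Θ₁)
    (hΨ₁ : θ₁.Ψ.PosDef) (hΩ₁ : θ₁.Ω.PosDef)
    (hdom : ∃ U ∈ 𝓝 θ₁, ∃ G : S → ℝ, Integrable G P ∧
      ∀ᵐ ω ∂P, ∀ θ ∈ U ∩ Θ₁, ‖StageOneParam.predict φ θ (X 0 ω) (Z 0 ω)‖ ^ 2 ≤ G ω) :
    ∀ᵐ ω ∂P, ∀ θ : ℕ → StageOneParam q r h, Tendsto θ atTop (𝓝 θ₁) →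
      (∀ᶠ n in atTop, θ n ∈ Θ₁) →
      Tendsto (fun n : ℕ => (n : ℝ)⁻¹ * ∑ i ∈ Finset.range n,
        ‖StageOneParam.predict φ (θ n) (X i ω) (Z i ω)
          - StageOneParam.predict φ θ₁ (X i ω) (Z i ω)‖ ^ 2) atTop (𝓝 0) := by
  have hadm := hΘ₁ θ₁ hθ₁
  obtain ⟨U, hU, G, hG, hUG⟩ := hdom
  obtain ⟨U', hU', hcont⟩ := StageOneParam.exists_continuousOn_predict hM.measurable_φ hΘ₁ hadm
    (StageOneParam.posDef_posteriorCov hadm hΨ₁ hΩ₁)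
  have hs₀ : θ₁ ∈ U ∩ (U' ∩ Θ₁) := ⟨mem_of_mem_nhds hU, mem_of_mem_nhds hU', hθ₁⟩
  obtain ⟨g, hg⟩ : ∃ g : StageOneParam q r h →
      (Fin r → ℝ) × (Fin q → ℝ) × (Fin h → ℝ) × (Fin m → ℝ) → ℝ, g =
        fun θ t => ‖StageOneParam.predict φ θ t.2.2.1 t.1 - StageOneParam.predict φ θ₁ t.2.2.1 t.1‖ ^ 2 := ⟨_, rfl⟩
  have hgm : ∀ θ, Measurable (g θ) := fun θ => by
    rw [hg]
    exact ((measurable_predict_data hM.measurable_φ θ).sub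
      (measurable_predict_data hM.measurable_φ θ₁)).norm.pow_const 2
  have hgc : ∀ i, ∀ᵐ ω ∂P, ContinuousOn (fun θ => g θ (Z i ω, ξ i ω, X i ω, Y i ω))
      (U ∩ (U' ∩ Θ₁)) := by
    intro i
    filter_upwards [hM.ae_integrable_sq_posterior hadm i] with ω hω
    rw [hg]
    exact (((hcont _ _ hω).sub continuousOn_const).norm.pow 2).mono Set.inter_subset_right
  have hgdom : ∀ᵐ ω ∂P, ∀ θ ∈ U ∩ (U' ∩ Θ₁), g θ (Z 0 ω, ξ 0 ω, X 0 ω, Y 0 ω) ≤ 4 * G ω := by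
    filter_upwards [hUG] with ω hω θ hθ
    rw [hg]
    have h1 := hω θ ⟨hθ.1, hθ.2.2⟩
    have h2 := hω θ₁ ⟨hs₀.1, hθ₁⟩
    have h3 := norm_sub_le (StageOneParam.predict φ θ (X 0 ω) (Z 0 ω))
      (StageOneParam.predict φ θ₁ (X 0 ω) (Z 0 ω))
    refine (pow_le_pow_left₀ (norm_nonneg _) h3 2).trans ?_
    nlinarith [sq_nonneg (‖StageOneParam.predict φ θ (X 0 ω) (Z 0 ω)‖
      - ‖StageOneParam.predict φ θ₁ (X 0 ω) (Z 0 ω)‖)]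
  have key := ae_tendsto_average_zero_of_continuousOn (P := P)
    (d := fun i ω => (Z i ω, ξ i ω, X i ω, Y i ω))
    (fun i => hM.identDistrib_data hadm.isUnit i)
    (fun f hf hint => hM.tendsto_average hadm.isUnit hf hint)
    hgm (fun _ _ => by rw [hg]; exact sq_nonneg _) hs₀ (fun t => by simp [hg])
    hgc (hG.const_mul 4) hgdom
  filter_upwards [key] with ω hω θ hθ hθΘ
  simp only [hg] at hω
  refine hω θ hθ ?_
  filter_upwards [hθΘ, hθ.eventually hU, hθ.eventually hU'] with n h1 h2 h3
  exact ⟨h2, h3, h1⟩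

/-- The second-stage data have the same mean and covariance for all subjects. -/
lemma moments_stackData_eq (hM : IsNonlinearSEM P φ θ₁ θ₂ Z ξ X η Y ζ₁ ε₁ ζ₂ ε₂)
    (hθ : θ₁.Admissible) (i : ℕ) :
    meanVec P (fun ω => stackData (Z i ω) (condPhi P φ (ξ i) (X i) (Z i) ω) (Y i ω)) =
        meanVec P (fun ω => stackData (Z 0 ω) (condPhi P φ (ξ 0) (X 0) (Z 0) ω) (Y 0 ω)) ∧
      covMat P (fun ω => stackData (Z i ω) (condPhi P φ (ξ i) (X i) (Z i) ω) (Y i ω))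
          (fun ω => stackData (Z i ω) (condPhi P φ (ξ i) (X i) (Z i) ω) (Y i ω)) =
        covMat P (fun ω => stackData (Z 0 ω) (condPhi P φ (ξ 0) (X 0) (Z 0) ω) (Y 0 ω))
          (fun ω => stackData (Z 0 ω) (condPhi P φ (ξ 0) (X 0) (Z 0) ω) (Y 0 ω)) := by
  have hae : ∀ i, (fun ω => stackData (Z i ω) (condPhi P φ (ξ i) (X i) (Z i) ω) (Y i ω)) =ᵐ[P]
      fun ω => stackData (Z i ω) (StageOneParam.predict φ θ₁ (X i ω) (Z i ω)) (Y i ω) := by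
    intro i
    filter_upwards [hM.condPhi_ae_eq_predict hθ i] with ω hω
    rw [hω]
  have hid := (hM.identDistrib_data hθ.isUnit i).comp
    (measurable_stackData_predict hM.measurable_φ θ₁)
  rw [meanVec_congr_ae (hae i), meanVec_congr_ae (hae 0), covMat_congr_ae (hae i) (hae i),
    covMat_congr_ae (hae 0) (hae 0)]
  exact ⟨hid.meanVec_eq, hid.covMat_eq⟩

/-- The second-stage estimate tends to the pseudo-true parameter when the predictions are
asymptotically correct in mean square. -/
theorem stageTwo_consistent (hM : IsNonlinearSEM P φ θ₁ θ₂ Z ξ X η Y ζ₁ ε₁ ζ₂ ε₂)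
    (hθ : θ₁.Admissible) {Θ₂ : Set (StageTwoParam p l r m)}
    (hlim : (stageTwoLimit P φ θ₂ (ξ 0) (X 0) (Z 0)).θ ∈ Θ₂)
    (hid : IdentifiedAt StageTwoFit.moments (StageTwoFit.paramSet Θ₂)
      (stageTwoLimit P φ θ₂ (ξ 0) (X 0) (Z 0)))
    (hV : (covMat P (fun ω => stackData (Z 0 ω) (condPhi P φ (ξ 0) (X 0) (Z 0) ω) (Y 0 ω))
      (fun ω => stackData (Z 0 ω) (condPhi P φ (ξ 0) (X 0) (Z 0) ω) (Y 0 ω))).PosDef)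
    {f : ℕ → S → ℕ → Fin l → ℝ} {τhat : ℕ → S → StageTwoFit p l r m}
    (hf : ∀ᵐ ω ∂P, Tendsto (fun n : ℕ => (n : ℝ)⁻¹ * ∑ i ∈ Finset.range n,
      ‖f n ω i - StageOneParam.predict φ θ₁ (X i ω) (Z i ω)‖ ^ 2) atTop (𝓝 0))
    (hstage : ∀ᵐ ω ∂P, ∀ᶠ n in atTop,
      StageTwoFit.IsMLE Θ₂ n (fun i => stackData (Z i ω) (f n ω i) (Y i ω)) (τhat n ω)) :
    ∀ᵐ ω ∂P, Tendsto (fun n => τhat n ω) atTop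
      (𝓝 (stageTwoLimit P φ θ₂ (ξ 0) (X 0) (Z 0))) := by
  obtain ⟨hmean, hcov, hY2⟩ := hM.stageTwoLimit_moments hθ 0
  set τ₀ := stageTwoLimit P φ θ₂ (ξ 0) (X 0) (Z 0) with hτ₀
  rw [← hcov] at hV
  have hae : (fun ω => stackData (Z 0 ω) (condPhi P φ (ξ 0) (X 0) (Z 0) ω) (Y 0 ω)) =ᵐ[P]
      fun ω => stackData (Z 0 ω) (StageOneParam.predict φ θ₁ (X 0 ω) (Z 0 ω)) (Y 0 ω) := by
    filter_upwards [hM.condPhi_ae_eq_predict hθ 0] with ω hω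
    rw [hω]
  have hV2 : MemLp (fun ω => stackData (Z 0 ω) (StageOneParam.predict φ θ₁ (X 0 ω) (Z 0 ω))
      (Y 0 ω)) 2 P :=
    (memLp_congr_ae hae).1 (memLp_stackData (hM.memLp_Z 0) (hM.memLp_condPhi 0) hY2)
  rw [meanVec_congr_ae hae] at hmean
  rw [covMat_congr_ae hae hae] at hcov
  set u : (Fin r → ℝ) × (Fin q → ℝ) × (Fin h → ℝ) × (Fin m → ℝ) → (Fin r ⊕ Fin l) ⊕ Fin m → ℝ :=
    fun t => stackData t.1 (StageOneParam.predict φ θ₁ t.2.2.1 t.1) t.2.2.2 - τ₀.mean with hu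
  have hum : Measurable u :=
    (measurable_stackData_predict hM.measurable_φ θ₁).sub_const _
  have hu2 : MemLp (fun ω => u (Z 0 ω, ξ 0 ω, X 0 ω, Y 0 ω)) 2 P :=
    MemLp.sub hV2 (memLp_const τ₀.mean)
  have hu' : (fun ω => u (Z 0 ω, ξ 0 ω, X 0 ω, Y 0 ω)) = fun ω => -τ₀.mean +
      stackData (Z 0 ω) (StageOneParam.predict φ θ₁ (X 0 ω) (Z 0 ω)) (Y 0 ω) := by
    ext1 ω
    simp only [hu]
    abel
  have hmu : meanVec P (fun ω => u (Z 0 ω, ξ 0 ω, X 0 ω, Y 0 ω)) = 0 := by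
    rw [hu', meanVec_const_add _ hV2, ← hmean, neg_add_cancel]
  have hcu : covMat P (fun ω => u (Z 0 ω, ξ 0 ω, X 0 ω, Y 0 ω))
      (fun ω => u (Z 0 ω, ξ 0 ω, X 0 ω, Y 0 ω)) = τ₀.cov := by
    rw [hu', covMat_const_add_left _ _ hV2, covMat_const_add_right _ _ hV2, hcov]
  have hS := hM.tendsto_avgOuter hθ.isUnit hum hum hu2 hu2 (A := τ₀.cov) fun a b => by
    have h1 := covMat_apply_eq_sub hu2 hu2 a b
    rw [hmu, hcu, Pi.zero_apply, zero_mul, sub_zero] at h1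
    exact h1.symm
  have hone : MemLp (fun _ : S => fun _ : Unit => (1 : ℝ)) 2 P := memLp_const _
  have hC := hM.tendsto_avgOuter hθ.isUnit hum (v := fun _ (_ : Unit) => (1 : ℝ)) measurable_const
    hu2 hone (A := 0) fun a b => by
      have h1 : ∫ ω, u (Z 0 ω, ξ 0 ω, X 0 ω, Y 0 ω) a ∂P = 0 := congrFun hmu a
      simpa using h1
  have hW := hM.tendsto_avgOuter hθ.isUnit (u := fun _ (_ : Unit) => (1 : ℝ))
    (v := fun _ (_ : Unit) => (1 : ℝ)) measurable_const measurable_const hone hone (A := 1)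
    fun a b => by simp
  filter_upwards [hstage, hf, hS, hC, hW] with ω hω hfω hSω hCω hWω
  set d : ℕ → ℕ → (Fin r ⊕ Fin l) ⊕ Fin m → ℝ := fun n i =>
    stackData 0 (f n ω i - StageOneParam.predict φ θ₁ (X i ω) (Z i ω)) 0 with hd
  have hd_le : ∀ n i a, |d n i a| ≤ ‖f n ω i - StageOneParam.predict φ θ₁ (X i ω) (Z i ω)‖ := by
    rintro n i ((a | a) | a)
    · simp [hd, stackData]
    · exact norm_le_pi_norm (f n ω i - StageOneParam.predict φ θ₁ (X i ω) (Z i ω)) a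
    · simp [hd, stackData]
  have hdd : Tendsto (fun n => avgOuter n (d n) (d n)) atTop (𝓝 0) := by
    refine tendsto_matrix_nhds.2 fun a b => squeeze_zero_norm (fun n => ?_) hfω
    change |(n : ℝ)⁻¹ * ∑ i ∈ Finset.range n, d n i a * d n i b| ≤ _
    rw [abs_mul, abs_of_nonneg (by positivity : (0 : ℝ) ≤ (n : ℝ)⁻¹)]
    refine mul_le_mul_of_nonneg_left ((Finset.abs_sum_le_sum_abs _ _).trans
      (Finset.sum_le_sum fun i _ => ?_)) (by positivity)
    rw [abs_mul, pow_two]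
    exact mul_le_mul (hd_le n i a) (hd_le n i b) (abs_nonneg _) (norm_nonneg _)
  set e : ℕ → ℕ → (Fin r ⊕ Fin l) ⊕ Fin m → ℝ :=
    fun n i => u (Z i ω, ξ i ω, X i ω, Y i ω) + d n i with he
  have hdata : ∀ n i, stackData (Z i ω) (f n ω i) (Y i ω) - τ₀.mean = e n i := by
    intro n i
    ext ((a | a) | a) <;> simp [he, hu, hd, stackData]
  have hCe : Tendsto (fun n => avgOuter n (e n) (fun _ (_ : Unit) => (1 : ℝ))) atTop (𝓝 0) := by
    have h1 : Tendsto (fun n => avgOuter n (d n) (fun _ (_ : Unit) => (1 : ℝ))) atTop (𝓝 0) := by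
      simpa only [avgOuter_transpose, transpose_zero] using
        (tendsto_avgOuter_zero hWω hdd).matrix_transpose
    have h2 := hCω.add h1
    rw [add_zero] at h2
    simpa only [he, avgOuter_add_left] using h2
  set D : ℕ → Matrix ((Fin r ⊕ Fin l) ⊕ Fin m) Unit ℝ := fun n =>
    replicateCol Unit ((τhat n ω).mean - τ₀.mean) with hD
  have hres : ∀ n i, e n i - D n *ᵥ (fun _ => 1) =
      stackData (Z i ω) (f n ω i) (Y i ω) - (τhat n ω).mean := by
    intro n i
    have h1 : D n *ᵥ (fun _ => 1) = (τhat n ω).mean - τ₀.mean := by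
      ext a; simp [hD, mulVec, dotProduct]
    rw [h1, ← hdata]
    abel
  obtain ⟨hA, hD0⟩ := tendsto_of_gaussian_logLik_le hV PosDef.one (e := e)
    (w := fun _ _ => 1) (tendsto_avgOuter_add hSω hdd) hCe hWω (A := fun n => (τhat n ω).cov)
    (D := D) (hω.mono fun n hn => hn.1.2) (by
      filter_upwards [hω] with n hn
      have h1 := hn.2 τ₀ ⟨hlim, hV⟩
      simp only [StageTwoFit.logLik] at h1
      simp only [gaussianLogDensity_eq_zero_mean (StageTwoFit.mean _), hdata] at h1
      simp only [hres]
      exact h1)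
  have hm : Tendsto (fun n => (τhat n ω).mean) atTop (𝓝 τ₀.mean) := by
    refine tendsto_pi_nhds.2 fun a => ?_
    have h1 := tendsto_matrix_nhds.1 hD0 a ()
    simp only [hD, replicateCol_apply, Pi.sub_apply, Matrix.zero_apply] at h1
    simpa using h1.add_const (τ₀.mean a)
  exact hid.tendsto (hω.mono fun n hn => hn.1) (hm.prodMk_nhds hA)

end IsNonlinearSEM

theorem mainTheorem2 {S : Type*} [MeasurableSpace S] {P : Measure S} [IsProbabilityMeasure P]
    {p q r l h m : ℕ}
    (φ : (Fin q → ℝ) → Fin l → ℝ)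
    (θ₁ : StageOneParam q r h) (θ₂ : StageTwoParam p l r m)
    (Z : ℕ → S → Fin r → ℝ) (ξ : ℕ → S → Fin q → ℝ) (X : ℕ → S → Fin h → ℝ)
    (η : ℕ → S → Fin p → ℝ) (Y : ℕ → S → Fin m → ℝ)
    (ζ₁ : ℕ → S → Fin q → ℝ) (ε₁ : ℕ → S → Fin h → ℝ)
    (ζ₂ : ℕ → S → Fin p → ℝ) (ε₂ : ℕ → S → Fin m → ℝ)
    (hSEM : IsNonlinearSEM P φ θ₁ θ₂ Z ξ X η Y ζ₁ ε₁ ζ₂ ε₂)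
    -- first-stage model: parameter set, true parameter, identification
    (Θ₁ : Set (StageOneParam q r h)) (hΘ₁ : ∀ θ ∈ Θ₁, θ.Admissible) (hθ₁ : θ₁ ∈ Θ₁)
    (hΨ₁ : θ₁.Ψ.PosDef) (hΩ₁ : θ₁.Ω.PosDef)
    (hid₁ : IdentifiedAt StageOneParam.reducedForm Θ₁ θ₁)
    -- second-stage model: parameter set with `Ψ` unrestricted, true parameter, identification
    (Θ₂ : Set (StageTwoParam p l r m))
    (hΘ₂ : ∀ θ ∈ Θ₂, θ.Ψ.PosSemidef ∧ θ.Ω.PosSemidef)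
    (hΨfree : ∀ θ ∈ Θ₂, ∀ Ψ' : Matrix (Fin p) (Fin p) ℝ, (Ψ' - θ.Ψ).PosSemidef →
      { θ with Ψ := Ψ' } ∈ Θ₂)
    (hθ₂ : θ₂ ∈ Θ₂)
    (hid₂ : IdentifiedAt StageTwoFit.moments (StageTwoFit.paramSet Θ₂)
      (stageTwoLimit P φ θ₂ (ξ 0) (X 0) (Z 0)))
    -- regularity: nonsingular covariance of `(Z, φ*, Y)`, local domination of the predictions
    (hV : (covMat P (fun ω => stackData (Z 0 ω) (condPhi P φ (ξ 0) (X 0) (Z 0) ω) (Y 0 ω))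
      (fun ω => stackData (Z 0 ω) (condPhi P φ (ξ 0) (X 0) (Z 0) ω) (Y 0 ω))).PosDef)
    (hdom : ∃ U ∈ 𝓝 θ₁, ∃ G : S → ℝ, Integrable G P ∧
      ∀ᵐ ω ∂P, ∀ θ ∈ U ∩ Θ₁, ‖StageOneParam.predict φ θ (X 0 ω) (Z 0 ω)‖ ^ 2 ≤ G ω)
    -- the two-stage estimator
    (θhat₁ : ℕ → S → StageOneParam q r h) (θhat₂ : ℕ → S → StageTwoFit p l r m)
    (hstage₁ : ∀ᵐ ω ∂P, ∀ᶠ n in atTop,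
      StageOneParam.IsMLE Θ₁ n (fun i => X i ω) (fun i => Z i ω) (θhat₁ n ω))
    (hstage₂ : ∀ᵐ ω ∂P, ∀ᶠ n in atTop,
      StageTwoFit.IsMLE Θ₂ n (fun i => stackData (Z i ω)
        (StageOneParam.predict φ (θhat₁ n ω) (X i ω) (Z i ω)) (Y i ω)) (θhat₂ n ω)) :
    -- the modelled mean and covariance of `(Z, φ*, Y)` match the true ones
    (∀ i, (stageTwoLimit P φ θ₂ (ξ 0) (X 0) (Z 0)).mean =
        meanVec P (fun ω => stackData (Z i ω) (condPhi P φ (ξ i) (X i) (Z i) ω) (Y i ω)) ∧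
      (stageTwoLimit P φ θ₂ (ξ 0) (X 0) (Z 0)).cov =
        covMat P (fun ω => stackData (Z i ω) (condPhi P φ (ξ i) (X i) (Z i) ω) (Y i ω))
          (fun ω => stackData (Z i ω) (condPhi P φ (ξ i) (X i) (Z i) ω) (Y i ω))) ∧
    -- strong consistency for all parameters but `Ψ`, and the limit of the estimate of `Ψ`
    ∀ᵐ ω ∂P,
      Tendsto (fun n => θhat₁ n ω) atTop (𝓝 θ₁) ∧
      Tendsto (fun n => (θhat₂ n ω).θ.α) atTop (𝓝 θ₂.α) ∧
      Tendsto (fun n => (θhat₂ n ω).θ.B) atTop (𝓝 θ₂.B) ∧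
      Tendsto (fun n => (θhat₂ n ω).θ.Γ) atTop (𝓝 θ₂.Γ) ∧
      Tendsto (fun n => (θhat₂ n ω).θ.ν) atTop (𝓝 θ₂.ν) ∧
      Tendsto (fun n => (θhat₂ n ω).θ.Λ) atTop (𝓝 θ₂.Λ) ∧
      Tendsto (fun n => (θhat₂ n ω).θ.K) atTop (𝓝 θ₂.K) ∧
      Tendsto (fun n => (θhat₂ n ω).θ.Ω) atTop (𝓝 θ₂.Ω) ∧
      Tendsto (fun n => (θhat₂ n ω).θ.Ψ) atTop
        (𝓝 (θ₂.Ψ + θ₂.B * covMat P (fun ω => φ (ξ 0 ω) - condPhi P φ (ξ 0) (X 0) (Z 0) ω)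
          (fun ω => φ (ξ 0 ω) - condPhi P φ (ξ 0) (X 0) (Z 0) ω) * θ₂.Bᵀ)) := by
  have hadm := hΘ₁ θ₁ hθ₁
  have hφ2 : MemLp (fun ω => φ (ξ 0 ω) - condPhi P φ (ξ 0) (X 0) (Z 0) ω) 2 P :=
    MemLp.sub (hSEM.memLp_φ 0) (hSEM.memLp_condPhi 0)
  have hlim : (stageTwoLimit P φ θ₂ (ξ 0) (X 0) (Z 0)).θ ∈ Θ₂ := by
    refine hΨfree θ₂ hθ₂ _ ?_
    rw [add_sub_cancel_left]
    simpa [conjTranspose_eq_transpose_of_trivial] using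
      (posSemidef_covMat hφ2).mul_mul_conjTranspose_same θ₂.B
  have hVZ : (covMat P (Z 0) (Z 0)).PosDef := by
    rw [covMat_stackData] at hV
    exact hV.submatrix (e := fun a => Sum.inl (Sum.inl a))
      (Sum.inl_injective.comp Sum.inl_injective)
  refine ⟨fun i => ?_, ?_⟩
  · obtain ⟨hmean, hcov, -⟩ := hSEM.stageTwoLimit_moments hadm 0
    obtain ⟨hmean', hcov'⟩ := hSEM.moments_stackData_eq hadm i
    exact ⟨hmean.trans hmean'.symm, hcov.trans hcov'.symm⟩
  · have h1 := hSEM.stageOne_consistent hΘ₁ hθ₁ hid₁ hVZ hstage₁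
    have hf : ∀ᵐ ω ∂P, Tendsto (fun n : ℕ => (n : ℝ)⁻¹ * ∑ i ∈ Finset.range n,
        ‖StageOneParam.predict φ (θhat₁ n ω) (X i ω) (Z i ω)
          - StageOneParam.predict φ θ₁ (X i ω) (Z i ω)‖ ^ 2) atTop (𝓝 0) := by
      filter_upwards [h1, hstage₁,
        hSEM.tendsto_average_predict_sub hΘ₁ hθ₁ hΨ₁ hΩ₁ hdom] with ω hω₁ hω₂ hω
      exact hω _ hω₁ (hω₂.mono fun n hn => hn.1)
    have h2 := hSEM.stageTwo_consistent hadm hlim hid₂ hV hf hstage₂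
    filter_upwards [h1, h2] with ω hω₁ hω₂
    exact ⟨hω₁, StageTwoFit.tendsto_components hω₂⟩
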